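/- Let $\mathbb{H}^+=\{(x,y)\in\mathbb{R}^2 : x>0\}$, let $m\in\mathbb{C}$, and let $L_m u=\partial_\xi^2u+\partial_\eta^2u+\frac{m}{\xi}\,\partial_\xi u$ be the Weinstein operator in the variables $(\xi,\eta)\in\mathbb{H}^+$. For $(x,y),(\xi,\eta)\in\mathbb{H}^+$ put $$E_m(x,y,\xi,\eta)=-\frac{\xi^m}{2\pi}\int_0^\pi\frac{\sin^{m-1}\theta\,d\theta}{\left[(x-\xi)^2+4x\xi\sin^2\frac{\theta}{2}+(y-\eta)^2\right]^{m/2}}\qquad\text{if }\operatorname{Re}m\ge 1,$$ $$E_m(x,y,\xi,\eta)=-\frac{\xi\,x^{1-m}}{2\pi}\int_0^\pi\frac{\sin^{1-m}\theta\,d\theta}{\left[(x-\xi)^2+4x\xi\sin^2\frac{\theta}{2}+(y-\eta)^2\right]^{1-m/2}}\qquad\text{if }\operatorname{Re}m<1.$$ Let $\Omega$ be an open set whose closure $\overline\Omega$ is a compact subset of $\mathbb{H}^+$ and whose boundary is piecewise $C^1$: $\partial\Omega$ is the union of finitely many regular $C^1$ arcs (nonvanishing derivative up to the endpoints) which may meet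 themselves or one another only at endpoints, and $\Omega$ lies locally on one side of each arc away from its endpoints, so that the outer unit normal vector $\vec n$ to $\partial\Omega$ exists there. Let $ds$ be the arc length element on $\partial\Omega$. Let $u:\overline\Omega\to\mathbb{C}$ belong to $C^2(\overline\Omega)$, i.e. $u$ is continuous on $\overline\Omega$ and $C^2$ in $\Omega$, and its partial derivatives of order $1$ and $2$ extend continuously to $\overline\Omega$ (on $\partial\Omega$, $\partial_\xi u$ and $\partial_\eta u$ denote these extensions). Then for every $(x,y)\in\Omega$ the integrals below converge absolutely and $$u(x,y)=\int_\Omega L_m(u)\,E_m\,d\xi\,d\eta-\int_{\partial\Omega}\Big(\big[(\partial_\xi u)E_m-u\,(\partial_\xi E_m)+\tfrac{m}{\xi}\,uE_m\big],\ \big[(\partial_\eta u)E_m-u\,(\partial_\eta E_m)\big]\Big)\cdot\vec n\,ds,$$ where $u=u(\xi,\eta)$ and $E_m=E_m(x,y,\xi,\eta)$. -/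

import Mathlib

open Set Filter Topology MeasureTheory

noncomputable section

namespace Weinstein

/-- The right half-plane `ℍ⁺ = {(x, y) ∈ ℝ² : x > 0}`. -/
def rightHalfPlane : Set (ℝ × ℝ) := {p | 0 < p.1}

/-- The partial derivative with respect to the first variable. -/
def pd₁ (f : ℝ × ℝ → ℂ) (p : ℝ × ℝ) : ℂ := deriv (fun t : ℝ => f (t, p.2)) p.1

/-- The partial derivative with respect to the second variable. -/
def pd₂ (f : ℝ × ℝ → ℂ) (p : ℝ × ℝ) : ℂ := deriv (fun t : ℝ => f (p.1, t)) p.2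

/-- The Weinstein operator `L_m u = Δu + (m / x) ∂ₓu`. -/
def weinsteinOp (m : ℂ) (u : ℝ × ℝ → ℂ) (p : ℝ × ℝ) : ℂ :=
  pd₁ (pd₁ u) p + pd₂ (pd₂ u) p + m / (p.1 : ℂ) * pd₁ u p

/-- `(x - ξ)² + 4 x ξ sin²(θ/2) + (y - η)²` for `p = (x, y)`, `q = (ξ, η)`. -/
def kernelBase (p q : ℝ × ℝ) (θ : ℝ) : ℝ :=
  (p.1 - q.1) ^ 2 + 4 * p.1 * q.1 * Real.sin (θ / 2) ^ 2 + (p.2 - q.2) ^ 2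

/-- The fundamental solution `E_m(x, y, ξ, η)`, for `p = (x, y)` and `q = (ξ, η)`.
All powers are complex powers of nonnegative reals. -/
def fundSol (m : ℂ) (p q : ℝ × ℝ) : ℂ :=
  if 1 ≤ m.re then
    -((q.1 : ℂ) ^ m / (2 * (Real.pi : ℂ))) *
      ∫ θ in (0 : ℝ)..Real.pi,
        (Real.sin θ : ℂ) ^ (m - 1) / (kernelBase p q θ : ℂ) ^ (m / 2)
  else
    -((q.1 : ℂ) * (p.1 : ℂ) ^ (1 - m) / (2 * (Real.pi : ℂ))) *
      ∫ θ in (0 : ℝ)..Real.pi,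
        (Real.sin θ : ℂ) ^ (1 - m) / (kernelBase p q θ : ℂ) ^ (1 - m / 2)

/-- The Euclidean inner product on `ℝ²` (`ℝ × ℝ` itself carries the sup norm). -/
def dot (v w : ℝ × ℝ) : ℝ := v.1 * w.1 + v.2 * w.2

/-- The Euclidean length on `ℝ²`. -/
def len (v : ℝ × ℝ) : ℝ := Real.sqrt (dot v v)

theorem dot_self_nonneg (v : ℝ × ℝ) : 0 ≤ dot v v :=
  add_nonneg (mul_self_nonneg _) (mul_self_nonneg _)

/-- `ν` is an outer unit normal to `Ω` at `p`: it is a unit vector, and infinitesimally at `p`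
the set `Ω` is the half-plane `{w : ⟨w, ν⟩ < 0}` and the exterior of `Ω` is the half-plane
`{w : ⟨w, ν⟩ > 0}`. -/
def IsOuterUnitNormal (Ω : Set (ℝ × ℝ)) (p ν : ℝ × ℝ) : Prop :=
  len ν = 1 ∧ ∀ ε : ℝ, 0 < ε → ∀ᶠ q in 𝓝 p,
    (dot (q - p) ν < -ε * len (q - p) → q ∈ Ω) ∧
    (ε * len (q - p) < dot (q - p) ν → q ∉ closure Ω)

/-- An outer unit normal is unique. -/
theorem IsOuterUnitNormal.unique {Ω : Set (ℝ × ℝ)} {p ν ν' : ℝ × ℝ}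
    (h : IsOuterUnitNormal Ω p ν) (h' : IsOuterUnitNormal Ω p ν') : ν = ν' := by
  by_contra hne
  obtain ⟨h1, h2⟩ := h
  obtain ⟨h1', h2'⟩ := h'
  have e1 : dot ν ν = 1 := by
    have hs := Real.mul_self_sqrt (dot_self_nonneg ν)
    rw [← len, h1, one_mul] at hs
    exact hs.symm
  have e2 : dot ν' ν' = 1 := by
    have hs := Real.mul_self_sqrt (dot_self_nonneg ν')
    rw [← len, h1', one_mul] at hs
    exact hs.symm
  set w : ℝ × ℝ := ν' - ν with hw
  have hww : 0 < dot w w := by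
    rcases lt_or_eq_of_le (dot_self_nonneg w) with h | h
    · exact h
    · exfalso
      apply hne
      unfold dot at h
      have a1 : w.1 = 0 := by nlinarith [sq_nonneg w.1, sq_nonneg w.2]
      have a2 : w.2 = 0 := by nlinarith [sq_nonneg w.1, sq_nonneg w.2]
      have : w = 0 := Prod.ext a1 a2
      exact (sub_eq_zero.mp this).symm
  have b1 : dot w ν = -(dot w w) / 2 := by
    simp only [dot, hw, Prod.fst_sub, Prod.snd_sub] at *
    linarith
  have b2 : dot w ν' = dot w w / 2 := by
    simp only [dot, hw, Prod.fst_sub, Prod.snd_sub] at *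
    linarith
  have hl : 0 < len w := Real.sqrt_pos.mpr hww
  have hl2 : len w * len w = dot w w := Real.mul_self_sqrt hww.le
  have hlen : ∀ s : ℝ, 0 < s → len (s • w) = s * len w := by
    intro s hs
    have : dot (s • w) (s • w) = s ^ 2 * dot w w := by simp [dot]; ring
    rw [len, this, Real.sqrt_mul (by positivity), Real.sqrt_sq hs.le, len]
  have hdot : ∀ (s : ℝ) (z : ℝ × ℝ), dot (s • w) z = s * dot w z := by
    intro s z; simp [dot]; ring
  have htend : Tendsto (fun s : ℝ => p + s • w) (𝓝[>] 0) (𝓝 p) := by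
    have : ContinuousAt (fun s : ℝ => p + s • w) 0 := by fun_prop
    simpa using this.tendsto.mono_left (nhdsWithin_le_nhds (s := Ioi (0 : ℝ)))
  have k1 := htend.eventually (h2 (len w / 4) (by positivity))
  have k2 := htend.eventually (h2' (len w / 4) (by positivity))
  obtain ⟨s, ⟨⟨c1, c2⟩, hs⟩⟩ := ((k1.and k2).and self_mem_nhdsWithin).exists
  have hs : 0 < s := hs
  simp only [add_sub_cancel_left, hlen s hs, hdot, b1, b2] at c1 c2
  have hp : 0 < s * dot w w := by positivity
  refine c2.2 ?_ (subset_closure (c1.1 ?_))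
  · have : len w / 4 * (s * len w) = s * dot w w / 4 := by rw [← hl2]; ring
    rw [this]; linarith
  · have : -(len w / 4) * (s * len w) = -(s * dot w w / 4) := by rw [← hl2]; ring
    rw [this]; linarith

open Classical in
/-- The outer unit normal vector to `Ω` at `p` (zero where there is none). -/
def outerNormal (Ω : Set (ℝ × ℝ)) (p : ℝ × ℝ) : ℝ × ℝ :=
  if h : ∃ ν, IsOuterUnitNormal Ω p ν then h.choose else 0

/-- The outer unit normal vector, where there is one. -/
theorem outerNormal_eq {Ω : Set (ℝ × ℝ)} {p ν : ℝ × ℝ} (h : IsOuterUnitNormal Ω p ν) :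
    outerNormal Ω p = ν := by
  have hex : ∃ ν, IsOuterUnitNormal Ω p ν := ⟨ν, h⟩
  rw [outerNormal, dif_pos hex]
  exact hex.choose_spec.unique h

/-- A piecewise `C¹` parametrization of the boundary of `Ω`: the boundary is the union of finitely
many regular `C¹` arcs, which may have only endpoints in common, and at each point of an open arc
`Ω` has an outer unit normal (`Ω` lies on one side of the arc). -/
structure PiecewiseC1Boundary (Ω : Set (ℝ × ℝ)) where
  /-- the number of arcs -/
  N : ℕ
  /-- left ends of the parameter intervals -/
  a : Fin N → ℝ
  /-- right ends of the parameter intervals -/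
  b : Fin N → ℝ
  a_lt_b : ∀ i, a i < b i
  /-- the arcs -/
  γ : Fin N → ℝ → ℝ × ℝ
  contDiffOn : ∀ i, ContDiffOn ℝ 1 (γ i) (Icc (a i) (b i))
  regular : ∀ i, ∀ t ∈ Icc (a i) (b i), derivWithin (γ i) (Icc (a i) (b i)) t ≠ 0
  frontier_eq : frontier Ω = ⋃ i, γ i '' Icc (a i) (b i)
  simple : ∀ i, ∀ s ∈ Ioo (a i) (b i), ∀ j, ∀ t ∈ Icc (a j) (b j),
    γ i s = γ j t → i = j ∧ s = t
  exists_normal : ∀ i, ∀ t ∈ Ioo (a i) (b i), ∃ ν, IsOuterUnitNormal Ω (γ i t) ν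

/-- The expression `(X · n) ds / dt` along the `i`-th arc, `n` the outer unit normal and
`ds = |γᵢ'(t)| dt` the arc length element. -/
def PiecewiseC1Boundary.fluxDensity {Ω : Set (ℝ × ℝ)} (B : PiecewiseC1Boundary Ω)
    (X : ℝ × ℝ → ℂ × ℂ) (i : Fin B.N) (t : ℝ) : ℂ :=
  ((X (B.γ i t)).1 * ((outerNormal Ω (B.γ i t)).1 : ℂ) +
    (X (B.γ i t)).2 * ((outerNormal Ω (B.γ i t)).2 : ℂ)) *
    (len (derivWithin (B.γ i) (Icc (B.a i) (B.b i)) t) : ℂ)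

/-- The boundary integral `∫_{∂Ω} X · n ds`. -/
def PiecewiseC1Boundary.flux {Ω : Set (ℝ × ℝ)} (B : PiecewiseC1Boundary Ω)
    (X : ℝ × ℝ → ℂ × ℂ) : ℂ :=
  ∑ i, ∫ t in (B.a i)..(B.b i), B.fluxDensity X i t

/-- `f`, defined on `Ω`, has a continuous extension to the closure of `Ω`. -/
def ExtendsToClosure (Ω : Set (ℝ × ℝ)) (f : ℝ × ℝ → ℂ) : Prop :=
  ∃ g : ℝ × ℝ → ℂ, ContinuousOn g (closure Ω) ∧ EqOn g f Ω

/-- `u ∈ C²(Ω̄)`: `u` is continuous on the closure of `Ω` and `C²` in `Ω`, and all its partial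
derivatives of order one and two extend continuously to the closure. -/
structure IsC2OnClosure (Ω : Set (ℝ × ℝ)) (u : ℝ × ℝ → ℂ) : Prop where
  continuousOn : ContinuousOn u (closure Ω)
  contDiffOn : ContDiffOn ℝ 2 u Ω
  ext₁ : ExtendsToClosure Ω (pd₁ u)
  ext₂ : ExtendsToClosure Ω (pd₂ u)
  ext₁₁ : ExtendsToClosure Ω (pd₁ (pd₁ u))
  ext₁₂ : ExtendsToClosure Ω (pd₁ (pd₂ u))
  ext₂₁ : ExtendsToClosure Ω (pd₂ (pd₁ u))
  ext₂₂ : ExtendsToClosure Ω (pd₂ (pd₂ u))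

/-- The vector field
`((∂_ξ u) E - u (∂_ξ E) + (m / ξ) u E, (∂_η u) E - u (∂_η E))` on the closure of `Ω`, the first
derivatives of `u` being extended continuously from `Ω` to its closure. -/
def greenField (m : ℂ) (Ω : Set (ℝ × ℝ)) (u E : ℝ × ℝ → ℂ) (q : ℝ × ℝ) : ℂ × ℂ :=
  (extendFrom Ω (pd₁ u) q * E q - u q * pd₁ E q + m / (q.1 : ℂ) * u q * E q,
   extendFrom Ω (pd₂ u) q * E q - u q * pd₂ E q)

end Weinstein

end

/-! For a positive integer m, `L_m` is the Laplacian of ℝ^(m+2) acting on functions invariant under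
rotations of the first m + 1 coordinates, and `E_m` is the Newtonian kernel averaged over an orbit:
`kernelBase` is a squared distance by the law of cosines, and sin^(m-1) θ dθ is the density of the
angle. The algebra survives for complex m. Both formulas for `E_m` are multiples of ∫ sin^(μ-1) θ ·
ξ^α D^(-μ/2) dθ, where D is `kernelBase`, μ = 2α - m, and α = m or α = 1; the case distinction
serves to keep Re μ ≥ 1.

Instead of excising a disc around the singularity, D is replaced by D + h with h > 0. Then `kern` is
smooth and Green's identity `green` holds on all of Ω for each θ. The crux is `weinsteinAdj_kern`:
the formal adjoint of `L_m` applied to `kern`, times sin^(μ-1) θ, is a θ-derivative minus μ(μ+2) h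
ξ^α sin^(μ-1) θ (D + h)^(-μ/2-2). The θ-derivative integrates to zero
(`integral_sinPow_mul_eq_zero`). The rest concentrates at p as h → 0: for h = ε², dilating the three
variables (q, θ) about (p, 0) by ε gives a convergent integrand, of limit mass 2π x^(-μ) / (μ(μ+2))
(`tendsto_integral_deltaKernel`, `integral_limitKernel`). This produces the term in u(p). The area
integral converges by domination (`tendsto_integral_mul_regSol`), the boundary integral because ∂Ω
avoids p (`tendsto_boundaryTerm`).

The divergence theorem on Ω is proved by localization. The difference `defect` of its two sides is
additive in f. It vanishes when f is supported in Ω, or near a point of an open arc, where Ω is one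
side of a collar (`exists_collar`, `integral_collar`); cutoffs glue these cases. At the endpoints of
arcs nothing is assumed about the shape of Ω. There a cutoff at scale 1/n has gradient O(n) on a set
of area O(1/n²), so the endpoints do not contribute (`tendsto_defect_shrinking`). -/

namespace Weinstein

/-! ### Euclidean geometry of the plane. -/

/-- The determinant of two vectors of the plane. -/
def det2 (v w : ℝ × ℝ) : ℝ := v.1 * w.2 - v.2 * w.1

theorem len_nonneg (v : ℝ × ℝ) : 0 ≤ len v := Real.sqrt_nonneg _

theorem len_mul_self (v : ℝ × ℝ) : len v * len v = dot v v := Real.mul_self_sqrt (dot_self_nonneg v)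

theorem len_smul (c : ℝ) (v : ℝ × ℝ) : len (c • v) = |c| * len v := by
  have : dot (c • v) (c • v) = c ^ 2 * dot v v := by simp [dot]; ring
  rw [len, this, Real.sqrt_mul (sq_nonneg c), Real.sqrt_sq_eq_abs, len]

theorem dot_smul_left (c : ℝ) (v w : ℝ × ℝ) : dot (c • v) w = c * dot v w := by
  simp [dot]; ring

theorem len_pos {v : ℝ × ℝ} (h : v ≠ 0) : 0 < len v := by
  refine lt_of_le_of_ne (len_nonneg v) fun h0 => h ?_
  have h1 := len_mul_self v
  rw [← h0, dot] at h1
  exact Prod.ext (by simp; nlinarith [mul_self_nonneg v.1, mul_self_nonneg v.2])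
    (by simp; nlinarith [mul_self_nonneg v.1, mul_self_nonneg v.2])

@[fun_prop]
theorem continuous_len : Continuous len := by unfold len dot; fun_prop

theorem continuous_dot_left (w : ℝ × ℝ) : Continuous fun v => dot v w := by unfold dot; fun_prop

theorem IsOuterUnitNormal.dot_self_eq_one {Ω : Set (ℝ × ℝ)} {p ν : ℝ × ℝ}
    (h : IsOuterUnitNormal Ω p ν) : dot ν ν = 1 := by
  rw [← len_mul_self, h.1, one_mul]

theorem hasDerivAt_fst_comp {f : ℝ → ℝ × ℝ} {f' : ℝ × ℝ} {t : ℝ} (h : HasDerivAt f f' t) :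
    HasDerivAt (fun x => (f x).1) f'.1 t := by
  simpa using h.hasFDerivAt.fst.hasDerivAt

theorem hasDerivAt_snd_comp {f : ℝ → ℝ × ℝ} {f' : ℝ × ℝ} {t : ℝ} (h : HasDerivAt f f' t) :
    HasDerivAt (fun x => (f x).2) f'.2 t := by
  simpa using h.hasFDerivAt.snd.hasDerivAt

theorem hasDerivAt_det2_comp {f : ℝ → ℝ × ℝ} {f' : ℝ × ℝ} {t : ℝ} (h : HasDerivAt f f' t)
    (e : ℝ × ℝ) : HasDerivAt (fun x => det2 (f x) e) (det2 f' e) t :=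
  ((hasDerivAt_fst_comp h).mul_const e.2).sub ((hasDerivAt_snd_comp h).mul_const e.1)

/-! ### Boundary arcs: tangents, collars and normals. -/

namespace PiecewiseC1Boundary

variable {Ω : Set (ℝ × ℝ)} (B : PiecewiseC1Boundary Ω)

/-- The derivative of the `i`-th arc. -/
noncomputable def tangent (i : Fin B.N) (t : ℝ) : ℝ × ℝ := derivWithin (B.γ i) (Icc (B.a i) (B.b i)) t

/-- The vector `n ds / dt` along the `i`-th arc. -/
noncomputable def normalDensity (i : Fin B.N) (t : ℝ) : ℝ × ℝ :=
  len (B.tangent i t) • outerNormal Ω (B.γ i t)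

theorem continuousOn_tangent (i : Fin B.N) :
    ContinuousOn (B.tangent i) (Icc (B.a i) (B.b i)) :=
  (B.contDiffOn i).continuousOn_derivWithin (uniqueDiffOn_Icc (B.a_lt_b i)) le_rfl

theorem hasDerivAt_arc {i : Fin B.N} {t : ℝ} (ht : t ∈ Ioo (B.a i) (B.b i)) :
    HasDerivAt (B.γ i) (B.tangent i t) t :=
  (((B.contDiffOn i).differentiableOn one_ne_zero t
    (Ioo_subset_Icc_self ht)).hasDerivWithinAt).hasDerivAt (Icc_mem_nhds ht.1 ht.2)

theorem continuousOn_arc (i : Fin B.N) : ContinuousOn (B.γ i) (Icc (B.a i) (B.b i)) :=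
  (B.contDiffOn i).continuousOn

theorem arc_mem_frontier {i : Fin B.N} {t : ℝ} (ht : t ∈ Icc (B.a i) (B.b i)) :
    B.γ i t ∈ frontier Ω := by
  rw [B.frontier_eq]
  exact mem_iUnion.2 ⟨i, t, ht, rfl⟩

/-- The parameters of the `j`-th arc to be excluded form a compact set, whose image is closed and
misses `γ i t₀` by `simple`. -/
theorem eventually_param_near {i : Fin B.N} {t₀ : ℝ} (ht : t₀ ∈ Ioo (B.a i) (B.b i)) {δ : ℝ}
    (hδ : 0 < δ) : ∀ᶠ q in 𝓝 (B.γ i t₀), ∀ j, ∀ t ∈ Icc (B.a j) (B.b j), B.γ j t = q →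
      i = j ∧ |t - t₀| < δ := by
  rw [eventually_all]
  intro j
  set K : Set ℝ := Icc (B.a j) (B.b j) ∩ {t | i = j → δ ≤ |t - t₀|} with hK
  have hKc : IsCompact K := by
    refine isCompact_Icc.inter_right ?_
    by_cases h : i = j
    · simp only [h, forall_const]
      exact isClosed_le continuous_const (by fun_prop)
    · simp [h]
  have hcl : IsClosed (B.γ j '' K) :=
    (hKc.image_of_continuousOn ((B.continuousOn_arc j).mono inter_subset_left)).isClosed
  have hnot : B.γ i t₀ ∉ B.γ j '' K := by
    rintro ⟨t, ⟨h1, h2⟩, h3⟩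
    obtain ⟨h4, h5⟩ := B.simple i t₀ ht j t h1 h3.symm
    have := h2 h4
    rw [h5] at this
    simp at this
    linarith
  filter_upwards [hcl.isOpen_compl.mem_nhds hnot] with q hq t ht' hqt
  by_contra hcon
  refine hq ⟨t, ⟨ht', fun hij => ?_⟩, hqt⟩
  by_contra hlt
  exact hcon ⟨hij, not_le.1 hlt⟩

/-- Frontier points near `γ i t₀` lie in neither of the two cones of `IsOuterUnitNormal`, so each
short chord satisfies |chord · ν| ≤ ε |chord|; this passes to the limit of the difference quotients,
for every ε. -/
theorem dot_tangent_eq_zero (hΩ : IsOpen Ω) {i : Fin B.N} {t₀ : ℝ}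
    (ht : t₀ ∈ Ioo (B.a i) (B.b i)) {ν : ℝ × ℝ} (hν : IsOuterUnitNormal Ω (B.γ i t₀) ν) :
    dot (B.tangent i t₀) ν = 0 := by
  have hslope := (hasDerivAt_iff_tendsto_slope.1 (B.hasDerivAt_arc ht))
  have hcont : Tendsto (B.γ i) (𝓝[≠] t₀) (𝓝 (B.γ i t₀)) :=
    (B.hasDerivAt_arc ht).continuousAt.tendsto.mono_left nhdsWithin_le_nhds
  have key : ∀ ε > 0, |dot (B.tangent i t₀) ν| ≤ ε * len (B.tangent i t₀) := by
    intro ε hε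
    refine le_of_tendsto_of_tendsto
      (((continuous_dot_left ν).abs.tendsto _).comp hslope)
      ((continuous_len.tendsto _).comp hslope |>.const_mul ε) ?_
    filter_upwards [hcont.eventually (hν.2 ε hε),
      nhdsWithin_le_nhds (Icc_mem_nhds ht.1 ht.2)] with t h htI
    have hfr := B.arc_mem_frontier htI
    rw [hΩ.frontier_eq] at hfr
    have h1 := mt h.1 hfr.2
    have h2 : ¬ _ := fun hh => (h.2 hh) hfr.1
    simp only [Function.comp_apply, slope, vsub_eq_sub]
    rw [dot_smul_left, len_smul, abs_mul, mul_left_comm]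
    gcongr
    rw [abs_le]
    constructor <;> linarith
  by_contra hne
  have hpos : 0 < |dot (B.tangent i t₀) ν| := abs_pos.2 hne
  have hl := len_nonneg (B.tangent i t₀)
  have := key (|dot (B.tangent i t₀) ν| / (2 * (len (B.tangent i t₀) + 1))) (by positivity)
  rw [div_mul_eq_mul_div, le_div_iff₀ (by positivity)] at this
  nlinarith

/-- Near a point of an open arc, `Ω` is one side of the arc in the coordinates
`(t, s) ↦ γ t + s • e`. -/
theorem exists_collar (hΩ : IsOpen Ω) {i : Fin B.N} {t₀ : ℝ} (ht : t₀ ∈ Ioo (B.a i) (B.b i)) :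
    ∃ e : ℝ × ℝ, ∃ σ δ ρ : ℝ, (σ = 1 ∨ σ = -1) ∧ 0 < δ ∧ 0 < ρ ∧
      Icc (t₀ - δ) (t₀ + δ) ⊆ Ioo (B.a i) (B.b i) ∧
      (∀ t ∈ Icc (t₀ - δ) (t₀ + δ), 0 < σ * det2 (B.tangent i t) e) ∧
      (∀ t ∈ Icc (t₀ - δ) (t₀ + δ), ∀ t' ∈ Icc (t₀ - δ) (t₀ + δ), ∀ s s' : ℝ,
        B.γ i t + s • e = B.γ i t' + s' • e → t = t' ∧ s = s') ∧
      (∀ t ∈ Icc (t₀ - δ) (t₀ + δ), ∀ s ∈ Ico (-ρ) 0, B.γ i t + s • e ∈ Ω) ∧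
      (∀ t ∈ Icc (t₀ - δ) (t₀ + δ), ∀ s ∈ Ioc 0 ρ, B.γ i t + s • e ∉ closure Ω) ∧
      (∀ t ∈ Icc (t₀ - δ) (t₀ + δ), ∀ s ∈ Icc (-ρ) ρ, ∀ j, ∀ t' ∈ Icc (B.a j) (B.b j),
        B.γ j t' = B.γ i t + s • e → i = j ∧ t' = t) := by
  -- The transversal direction is the normal at the single point `t₀`, held fixed along the collar,
  -- so that the chart is as smooth as `γ`.
  obtain ⟨e, he⟩ := B.exists_normal i t₀ ht
  have hdot := B.dot_tangent_eq_zero hΩ ht he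
  have hee := he.dot_self_eq_one
  have htan0 : B.tangent i t₀ ≠ 0 := B.regular i t₀ (Ioo_subset_Icc_self ht)
  have hdet : det2 (B.tangent i t₀) e ≠ 0 := by
    intro h0
    refine htan0 ?_
    unfold dot at hdot hee
    unfold det2 at h0
    refine Prod.ext ?_ ?_
    · simp only [Prod.fst_zero]
      linear_combination e.1 * hdot + e.2 * h0 - (B.tangent i t₀).1 * hee
    · simp only [Prod.snd_zero]
      linear_combination e.2 * hdot - e.1 * h0 - (B.tangent i t₀).2 * hee
  obtain ⟨σ, hσ, hσpos⟩ : ∃ σ : ℝ, (σ = 1 ∨ σ = -1) ∧ 0 < σ * det2 (B.tangent i t₀) e := by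
    rcases lt_or_gt_of_ne hdet with h | h
    · exact ⟨-1, Or.inr rfl, by linarith⟩
    · exact ⟨1, Or.inl rfl, by linarith⟩
  have hnI : Icc (B.a i) (B.b i) ∈ 𝓝 t₀ := Icc_mem_nhds ht.1 ht.2
  have hct : ContinuousAt (fun t => σ * det2 (B.tangent i t) e) t₀ := by
    have := (B.continuousOn_tangent i).continuousAt hnI
    unfold det2
    fun_prop
  have hev := (hct.eventually (lt_mem_nhds hσpos)).and (Ioo_mem_nhds ht.1 ht.2)
  obtain ⟨δ₁, hδ₁, hball⟩ := Metric.eventually_nhds_iff.1 hev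
  have hnear := B.eventually_param_near ht (half_pos hδ₁)
  have hΨ : ContinuousAt (fun z : ℝ × ℝ => B.γ i z.1 + z.2 • e) (t₀, 0) := by
    have h1 : ContinuousAt (B.γ i) (t₀, (0 : ℝ)).1 := (B.hasDerivAt_arc ht).continuousAt
    have h2 : ContinuousAt (fun z : ℝ × ℝ => B.γ i z.1) (t₀, 0) :=
      ContinuousAt.comp h1 continuousAt_fst
    fun_prop
  have hΨt : Tendsto (fun z : ℝ × ℝ => B.γ i z.1 + z.2 • e) (𝓝 (t₀, 0)) (𝓝 (B.γ i t₀)) := by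
    simpa [ContinuousAt] using hΨ
  have hnear' := hΨt.eventually hnear
  obtain ⟨r, hr, hball'⟩ := Metric.eventually_nhds_iff.1 hnear'
  set δ : ℝ := min (δ₁ / 2) (r / 2) with hδdef
  have hδ : 0 < δ := by positivity
  have hδ1 : δ ≤ δ₁ / 2 := min_le_left _ _
  have hδ2 : δ ≤ r / 2 := min_le_right _ _
  have hJ : ∀ {d : ℝ}, d ≤ δ₁ / 2 → ∀ t ∈ Icc (t₀ - d) (t₀ + d), dist t t₀ < δ₁ := by
    intro d hd t ht
    rw [Real.dist_eq, abs_lt]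
    constructor <;> linarith [ht.1, ht.2]
  -- Adding a multiple of `e` does not change the determinant with `e`, so its strict monotonicity
  -- along the arc determines `t` from the point `γ t + s • e`.
  have hmono : StrictMonoOn (fun t => σ * det2 (B.γ i t) e)
      (Icc (t₀ - δ₁ / 2) (t₀ + δ₁ / 2)) := by
    have hd : ∀ t ∈ Icc (t₀ - δ₁ / 2) (t₀ + δ₁ / 2),
        HasDerivAt (fun t => σ * det2 (B.γ i t) e) (σ * det2 (B.tangent i t) e) t := by
      intro t ht
      have h := B.hasDerivAt_arc (hball (hJ le_rfl t ht)).2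
      exact (hasDerivAt_det2_comp h e).const_mul σ
    refine strictMonoOn_of_deriv_pos (convex_Icc _ _)
      (fun t ht => (hd t ht).continuousAt.continuousWithinAt) fun t ht => ?_
    have ht' := interior_subset ht
    rw [(hd t ht').deriv]
    exact (hball (hJ le_rfl t ht')).1
  have hinj : ∀ t ∈ Icc (t₀ - δ₁ / 2) (t₀ + δ₁ / 2), ∀ t' ∈ Icc (t₀ - δ₁ / 2) (t₀ + δ₁ / 2),
      ∀ s s' : ℝ, B.γ i t + s • e = B.γ i t' + s' • e → t = t' ∧ s = s' := by
    intro t ht t' ht' s s' h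
    have hx := congrArg Prod.fst h
    have hy := congrArg Prod.snd h
    simp only [Prod.fst_add, Prod.snd_add, Prod.smul_fst, Prod.smul_snd, smul_eq_mul] at hx hy
    have htt : t = t' := by
      refine hmono.injOn ht ht' ?_
      simp only [det2]
      linear_combination σ * e.2 * hx - σ * e.1 * hy
    subst htt
    refine ⟨rfl, ?_⟩
    unfold dot at hee
    linear_combination e.1 * hx + e.2 * hy + (s' - s) * hee
  have hsubJ : Icc (t₀ - δ) (t₀ + δ) ⊆ Icc (t₀ - δ₁ / 2) (t₀ + δ₁ / 2) :=
    Icc_subset_Icc (by linarith) (by linarith)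
  -- In the chart rectangle the frontier is met on the line `s = 0` only.
  have hpar : ∀ t ∈ Icc (t₀ - δ) (t₀ + δ), ∀ s ∈ Icc (-δ) δ, ∀ j,
      ∀ t' ∈ Icc (B.a j) (B.b j), B.γ j t' = B.γ i t + s • e → i = j ∧ t' = t ∧ s = 0 := by
    intro t ht s hs j t' ht' h
    have hd : dist (t, s) (t₀, (0 : ℝ)) < r := by
      rw [Prod.dist_eq, max_lt_iff, Real.dist_eq, Real.dist_eq, abs_lt, abs_lt]
      constructor <;> constructor <;> linarith [ht.1, ht.2, hs.1, hs.2]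
    obtain ⟨hij, hlt⟩ := hball' hd j t' ht' h
    subst hij
    rw [abs_lt] at hlt
    have := hinj t' ⟨by linarith, by linarith⟩ t (hsubJ ht) 0 s (by simpa using h)
    exact ⟨rfl, this.1, this.2.symm⟩
  -- Each half of the collar is connected and misses the frontier, hence lies wholly in `Ω` or
  -- wholly in the exterior.
  have hside : ∀ S : Set ℝ, Convex ℝ S → S ⊆ Icc (-δ) δ → (0 : ℝ) ∉ S →
      (fun z : ℝ × ℝ => B.γ i z.1 + z.2 • e) '' (Icc (t₀ - δ) (t₀ + δ) ×ˢ S) ⊆ Ω ∨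
      (fun z : ℝ × ℝ => B.γ i z.1 + z.2 • e) '' (Icc (t₀ - δ) (t₀ + δ) ×ˢ S) ⊆ (closure Ω)ᶜ := by
    intro S hS hSδ h0
    have hpre : IsPreconnected
        ((fun z : ℝ × ℝ => B.γ i z.1 + z.2 • e) '' (Icc (t₀ - δ) (t₀ + δ) ×ˢ S)) := by
      refine ((convex_Icc _ _).prod hS).isPreconnected.image _ ?_
      have h1 : ContinuousOn (fun z : ℝ × ℝ => B.γ i z.1) (Icc (t₀ - δ) (t₀ + δ) ×ˢ S) := by
        refine (B.continuousOn_arc i).comp continuousOn_fst fun z hz => ?_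
        exact Ioo_subset_Icc_self (hball (hJ hδ1 z.1 hz.1)).2
      fun_prop
    refine isPreconnected_iff_subset_of_disjoint.1 hpre Ω (closure Ω)ᶜ hΩ
      isClosed_closure.isOpen_compl ?_ ?_
    · rintro _ ⟨⟨t, s⟩, ⟨h1, h2⟩, rfl⟩
      by_contra hcon
      rw [mem_union, not_or, mem_compl_iff, not_not] at hcon
      have hfr : B.γ i t + s • e ∈ frontier Ω := by
        rw [hΩ.frontier_eq]
        exact ⟨hcon.2, hcon.1⟩
      rw [B.frontier_eq] at hfr
      obtain ⟨j, t', ht', h⟩ := mem_iUnion.1 hfr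
      obtain ⟨-, -, h00⟩ := hpar t h1 s (hSδ h2) j t' ht' h
      exact h0 (h00 ▸ h2)
    · rw [eq_empty_iff_forall_notMem]
      rintro q ⟨-, h1, h2⟩
      exact h2 (subset_closure h1)
  have hlen : len e = 1 := he.1
  -- The points `γ i t₀ ± s₀ • e` decide which half is which. Any cone constant below 1 would do, as
  -- `e` is the unit normal at `t₀`.
  have hev2 := hΨt.eventually (he.2 (1 / 2) (by norm_num))
  obtain ⟨r', hr', hball2⟩ := Metric.eventually_nhds_iff.1 hev2
  set s₀ : ℝ := min (r' / 2) δ with hs₀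
  have hs₀pos : 0 < s₀ := by positivity
  have hs₀r : s₀ ≤ r' / 2 := min_le_left _ _
  have hs₀δ : s₀ ≤ δ := min_le_right _ _
  have hdist : ∀ s : ℝ, |s| = s₀ → dist (t₀, s) (t₀, (0 : ℝ)) < r' := by
    intro s hs
    rw [Prod.dist_eq, dist_self, Real.dist_eq, sub_zero, hs, max_lt_iff]
    exact ⟨hr', by linarith⟩
  have ht₀J : t₀ ∈ Icc (t₀ - δ) (t₀ + δ) := ⟨by linarith, by linarith⟩
  have hplus : B.γ i t₀ + s₀ • e ∉ closure Ω := by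
    refine (hball2 (hdist s₀ (abs_of_pos hs₀pos))).2 ?_
    simp only [add_sub_cancel_left, len_smul, dot_smul_left, hlen, hee, abs_of_pos hs₀pos]
    linarith
  have hminus : B.γ i t₀ + (-s₀) • e ∈ Ω := by
    refine (hball2 (hdist (-s₀) (by rw [abs_neg, abs_of_pos hs₀pos]))).1 ?_
    simp only [add_sub_cancel_left, len_smul, dot_smul_left, hlen, hee, abs_neg,
      abs_of_pos hs₀pos]
    linarith
  refine ⟨e, σ, δ, δ, hσ, hδ, hδ, fun t ht => (hball (hJ hδ1 t ht)).2,
    fun t ht => (hball (hJ hδ1 t ht)).1,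
    fun t ht t' ht' => hinj t (hsubJ ht) t' (hsubJ ht'), ?_, ?_,
    fun t ht s hs j t' ht' h => ⟨(hpar t ht s hs j t' ht' h).1, (hpar t ht s hs j t' ht' h).2.1⟩⟩
  · intro t ht s hs
    rcases hside (Ico (-δ) 0) (convex_Ico _ _) (fun s hs => ⟨hs.1, by linarith [hs.2]⟩)
      (by simp) with h | h
    · exact h ⟨(t, s), ⟨ht, hs⟩, rfl⟩
    · exact absurd (subset_closure hminus)
        (h ⟨(t₀, -s₀), ⟨ht₀J, by simp; constructor <;> linarith⟩, rfl⟩)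
  · intro t ht s hs
    rcases hside (Ioc 0 δ) (convex_Ioc _ _) (fun s hs => ⟨by linarith [hs.1], hs.2⟩)
      (by simp) with h | h
    · exact absurd (subset_closure (h ⟨(t₀, s₀), ⟨ht₀J, ⟨hs₀pos, hs₀δ⟩⟩, rfl⟩)) hplus
    · exact h ⟨(t, s), ⟨ht, hs⟩, rfl⟩

end PiecewiseC1Boundary
namespace PiecewiseC1Boundary

variable {Ω : Set (ℝ × ℝ)} (B : PiecewiseC1Boundary Ω)

/-- A unit vector orthogonal to the tangent, times the length of the tangent, is the rotated tangent
up to sign; the sign is `σ` because `e` points out of `Ω`. Although `outerNormal` is a choice at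
each point, this formula makes `normalDensity` continuous and bounded on the open arc. -/
theorem normalDensity_eq (hΩ : IsOpen Ω) {i : Fin B.N} {t : ℝ} (ht : t ∈ Ioo (B.a i) (B.b i))
    {e : ℝ × ℝ} {σ ρ : ℝ} (hσ : σ = 1 ∨ σ = -1) (hpos : 0 < σ * det2 (B.tangent i t) e)
    (hρ : 0 < ρ) (hout : ∀ s ∈ Ioc 0 ρ, B.γ i t + s • e ∉ closure Ω) :
    B.normalDensity i t = σ • (-(B.tangent i t).2, (B.tangent i t).1) := by
  obtain ⟨ν, hν⟩ := B.exists_normal i t ht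
  rw [normalDensity, outerNormal_eq hν]
  have hdot := B.dot_tangent_eq_zero hΩ ht hν
  have hνν := hν.dot_self_eq_one
  have hTL := len_mul_self (B.tangent i t)
  have hLpos := len_pos (B.regular i t (Ioo_subset_Icc_self ht))
  change 0 < len (B.tangent i t) at hLpos
  have hlim : Tendsto (fun s : ℝ => B.γ i t + s • e) (𝓝[>] 0) (𝓝 (B.γ i t)) := by
    have : ContinuousAt (fun s : ℝ => B.γ i t + s • e) 0 := by fun_prop
    simpa using this.tendsto.mono_left (nhdsWithin_le_nhds (s := Ioi (0 : ℝ)))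
  -- If this product were negative, `γ t + s • e` would enter the inner cone for small `s > 0`.
  have heν : 0 ≤ dot e ν := by
    by_contra hneg
    push Not at hneg
    have hl := len_nonneg e
    have h1 := hlim.eventually (hν.2 (-dot e ν / (2 * (len e + 1)))
      (div_pos (by linarith) (by positivity)))
    obtain ⟨s, h2, h3⟩ := (h1.and (Ioc_mem_nhdsGT hρ)).exists
    refine hout s h3 (subset_closure (h2.1 ?_))
    have hs := h3.1
    simp only [add_sub_cancel_left, len_smul, dot_smul_left, abs_of_pos hs]
    have h4 : -(-dot e ν / (2 * (len e + 1))) * (s * len e) =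
        s * (dot e ν * (len e / (2 * (len e + 1)))) := by field_simp
    rw [h4]
    have h5 : len e / (2 * (len e + 1)) < 1 := by
      rw [div_lt_one (by positivity)]; linarith
    refine mul_lt_mul_of_pos_left ?_ hs
    nlinarith
  generalize B.tangent i t = T at *
  generalize len T = L at *
  have hσσ : σ * σ = 1 := by rcases hσ with h | h <;> rw [h] <;> norm_num
  unfold dot at *
  unfold det2 at *
  set w : ℝ := ν.2 * T.1 - ν.1 * T.2 with hw
  have hww : w * w = L * L := by
    rw [hw, hTL]
    linear_combination (T.1 * T.1 + T.2 * T.2) * hνν - (T.1 * ν.1 + T.2 * ν.2) * hdot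
  have e1 : L * L * ν.1 = -w * T.2 := by
    rw [hTL, hw]; linear_combination T.1 * hdot
  have e2 : L * L * ν.2 = w * T.1 := by
    rw [hTL, hw]; linear_combination T.2 * hdot
  have hwσ : 0 ≤ w * σ := by
    have h1 : L * L * (e.1 * ν.1 + e.2 * ν.2) = w * (T.1 * e.2 - T.2 * e.1) := by
      linear_combination e.1 * e1 + e.2 * e2
    have h2 : 0 ≤ (w * σ) * (σ * (T.1 * e.2 - T.2 * e.1)) := by
      have : (w * σ) * (σ * (T.1 * e.2 - T.2 * e.1)) =
        L * L * (e.1 * ν.1 + e.2 * ν.2) := by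
        rw [h1]; linear_combination w * (T.1 * e.2 - T.2 * e.1) * hσσ
      rw [this]; positivity
    exact nonneg_of_mul_nonneg_left h2 hpos
  have hwL : w * σ = L := by
    have : (w * σ - L) * (w * σ + L) = 0 := by linear_combination w * w * hσσ + hww
    rcases mul_eq_zero.1 this with h | h <;> linarith
  have hw' : w = σ * L := by linear_combination σ * hwL - w * hσσ
  refine Prod.ext ?_ ?_
  · simp only [Prod.smul_mk, smul_eq_mul, Prod.smul_fst]
    refine mul_left_cancel₀ hLpos.ne' ?_
    rw [hw'] at e1
    linarith
  · simp only [Prod.smul_mk, smul_eq_mul, Prod.smul_snd]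
    refine mul_left_cancel₀ hLpos.ne' ?_
    rw [hw'] at e2
    linarith

theorem continuousOn_normalDensity (hΩ : IsOpen Ω) (i : Fin B.N) :
    ContinuousOn (B.normalDensity i) (Ioo (B.a i) (B.b i)) := by
  intro t₀ ht
  obtain ⟨e, σ, δ, ρ, hσ, hδ, hρ, hJ, hpos, -, -, hout, -⟩ := B.exists_collar hΩ ht
  have hev : B.normalDensity i =ᶠ[𝓝 t₀]
      fun t => σ • (-(B.tangent i t).2, (B.tangent i t).1) := by
    filter_upwards [Icc_mem_nhds (show t₀ - δ < t₀ by linarith) (show t₀ < t₀ + δ by linarith)]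
      with t htJ
    exact B.normalDensity_eq hΩ (hJ htJ) hσ (hpos t htJ) hρ (hout t htJ)
  have hT : ContinuousAt (B.tangent i) t₀ :=
    (B.continuousOn_tangent i).continuousAt (Icc_mem_nhds ht.1 ht.2)
  refine ContinuousAt.continuousWithinAt (ContinuousAt.congr ?_ hev.symm)
  fun_prop

theorem exists_norm_normalDensity_le (hΩ : IsOpen Ω) (i : Fin B.N) :
    ∃ C, ∀ t ∈ Ioo (B.a i) (B.b i), ‖B.normalDensity i t‖ ≤ C := by
  obtain ⟨C, hC⟩ := isCompact_Icc.exists_bound_of_continuousOn (B.continuousOn_tangent i)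
  refine ⟨C, fun t ht => ?_⟩
  obtain ⟨e, σ, δ, ρ, hσ, hδ, hρ, hJ, hpos, -, -, hout, -⟩ := B.exists_collar hΩ ht
  have htJ : t ∈ Icc (t - δ) (t + δ) := ⟨by linarith, by linarith⟩
  rw [B.normalDensity_eq hΩ (hJ htJ) hσ (hpos t htJ) hρ (hout t htJ), norm_smul]
  have h1 : ‖σ‖ = 1 := by rcases hσ with h | h <;> simp [h]
  rw [h1, one_mul]
  refine le_trans (le_of_eq ?_) (hC t (Ioo_subset_Icc_self ht))
  -- The norm is the sup norm, and the rotation only swaps the two entries up to sign.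
  rw [Prod.norm_def, Prod.norm_def, norm_neg, max_comm]

end PiecewiseC1Boundary

/-! ### Functions `C¹` up to the boundary, and integration over a collar. -/

theorem det_smulRight_add_smulRight (T e : ℝ × ℝ) :
    ((ContinuousLinearMap.fst ℝ ℝ ℝ).smulRight T +
      (ContinuousLinearMap.snd ℝ ℝ ℝ).smulRight e).det = det2 T e := by
  have h : (ContinuousLinearMap.fst ℝ ℝ ℝ).smulRight T +
      (ContinuousLinearMap.snd ℝ ℝ ℝ).smulRight e =
      LinearMap.toContinuousLinearMap (Matrix.toLin (Module.Basis.finTwoProd ℝ)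
        (Module.Basis.finTwoProd ℝ) !![T.1, e.1; T.2, e.2]) := by
    ext <;> simp [Matrix.toLin_finTwoProd_apply]
  rw [h, LinearMap.det_toContinuousLinearMap, LinearMap.det_toLin, Matrix.det_fin_two_of, det2]
  ring

theorem integrableOn_of_forall_norm_le {α E : Type*} [MeasurableSpace α] [NormedAddCommGroup E]
    {μ : Measure α} {s : Set α} {f : α → E} {C : ℝ} (hs : MeasurableSet s) (hfin : μ s < ⊤)
    (hf : AEStronglyMeasurable f (μ.restrict s)) (hC : ∀ x ∈ s, ‖f x‖ ≤ C) :
    IntegrableOn f s μ := by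
  have : IsFiniteMeasure (μ.restrict s) := ⟨by simpa using hfin⟩
  exact Integrable.of_bound hf C ((ae_restrict_mem hs).mono hC)

/-- `f` is continuous on the closure of `Ω` and has continuous bounded derivatives in `Ω`. -/
structure IsC1UpToBoundary (Ω : Set (ℝ × ℝ)) (f : ℝ × ℝ → ℂ) : Prop where
  continuousOn : ContinuousOn f (closure Ω)
  contDiffOn : ContDiffOn ℝ 1 f Ω
  bound : ∃ C, ∀ q ∈ Ω, ‖fderiv ℝ f q‖ ≤ C

theorem IsC1UpToBoundary.hasFDerivAt {Ω : Set (ℝ × ℝ)} {f : ℝ × ℝ → ℂ}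
    (hf : IsC1UpToBoundary Ω f) (hΩ : IsOpen Ω) {q : ℝ × ℝ} (hq : q ∈ Ω) :
    HasFDerivAt f (fderiv ℝ f q) q :=
  ((hf.contDiffOn.differentiableOn one_ne_zero).differentiableAt (hΩ.mem_nhds hq)).hasFDerivAt

theorem IsC1UpToBoundary.continuousOn_fderiv {Ω : Set (ℝ × ℝ)} {f : ℝ × ℝ → ℂ}
    (hf : IsC1UpToBoundary Ω f) (hΩ : IsOpen Ω) : ContinuousOn (fderiv ℝ f) Ω :=
  hf.contDiffOn.continuousOn_fderiv_of_isOpen hΩ le_rfl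

/-- Integration over a collar of a `C¹` arc. -/
theorem integral_collar {Ω : Set (ℝ × ℝ)} (hΩ : IsOpen Ω) {f : ℝ × ℝ → ℂ}
    (hf : IsC1UpToBoundary Ω f) {γ T : ℝ → ℝ × ℝ} {c d ρ σ : ℝ} {e : ℝ × ℝ} (hcd : c ≤ d)
    (hρ : 0 < ρ) (hT : ContinuousOn T (Icc c d)) (hγ : ∀ t ∈ Icc c d, HasDerivAt γ (T t) t)
    (hσ : σ = 1 ∨ σ = -1)
    (hpos : ∀ t ∈ Icc c d, 0 < σ * det2 (T t) e)
    (hinj : ∀ t ∈ Icc c d, ∀ t' ∈ Icc c d, ∀ s s' : ℝ, γ t + s • e = γ t' + s' • e →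
      t = t' ∧ s = s')
    (hin : ∀ t ∈ Icc c d, ∀ s ∈ Ico (-ρ) 0, γ t + s • e ∈ Ω)
    (hcl : ∀ t ∈ Icc c d, γ t ∈ closure Ω)
    (hc : ∀ s ∈ Ico (-ρ) 0, f (γ c + s • e) = 0) (hd : ∀ s ∈ Ico (-ρ) 0, f (γ d + s • e) = 0)
    (hb : ∀ t ∈ Icc c d, f (γ t + (-ρ) • e) = 0) (v : ℝ × ℝ) :
    ∫ q in (fun z : ℝ × ℝ => γ z.1 + z.2 • e) '' (Ioo c d ×ˢ Ioo (-ρ) 0), fderiv ℝ f q v =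
      ∫ t in Ioo c d, f (γ t) * ((σ * det2 (T t) v : ℝ) : ℂ) := by
  obtain ⟨C, hC⟩ := hf.bound
  set Ψ : ℝ × ℝ → ℝ × ℝ := fun z => γ z.1 + z.2 • e with hΨdef
  set R : Set (ℝ × ℝ) := Ioo c d ×ˢ Ioo (-ρ) 0 with hR
  have hRm : MeasurableSet R := measurableSet_Ioo.prod measurableSet_Ioo
  have hRfin : volume R < ⊤ := by
    rw [hR, Measure.volume_eq_prod, Measure.prod_prod]
    exact ENNReal.mul_lt_top (by simp) (by simp)
  have hRI : ∀ z ∈ R, z.1 ∈ Icc c d ∧ z.2 ∈ Ico (-ρ) 0 :=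
    fun z hz => ⟨Ioo_subset_Icc_self hz.1, Ioo_subset_Ico_self hz.2⟩
  have hγc : ContinuousOn γ (Icc c d) := fun t ht => (hγ t ht).continuousAt.continuousWithinAt
  have hΨΩ : ∀ z ∈ R, Ψ z ∈ Ω := fun z hz => hin _ (hRI z hz).1 _ (hRI z hz).2
  have hΨ' : ∀ z ∈ R, HasFDerivWithinAt Ψ ((ContinuousLinearMap.fst ℝ ℝ ℝ).smulRight (T z.1) +
      (ContinuousLinearMap.snd ℝ ℝ ℝ).smulRight e) R z := by
    intro z hz
    refine HasFDerivAt.hasFDerivWithinAt (HasFDerivAt.add ?_ ?_)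
    · refine ((hγ z.1 (hRI z hz).1).hasFDerivAt.comp z hasFDerivAt_fst).congr_fderiv ?_
      ext <;> simp
    · exact hasFDerivAt_snd.smul_const e
  have hinjR : InjOn Ψ R := by
    intro z hz z' hz' h
    obtain ⟨h1, h2⟩ := hinj _ (hRI z hz).1 _ (hRI z' hz').1 _ _ h
    exact Prod.ext h1 h2
  rw [integral_image_eq_integral_abs_det_fderiv_smul volume hRm hΨ' hinjR]
  have hpt : ∀ z ∈ R, |((ContinuousLinearMap.fst ℝ ℝ ℝ).smulRight (T z.1) +
      (ContinuousLinearMap.snd ℝ ℝ ℝ).smulRight e).det| • fderiv ℝ f (Ψ z) v =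
      ((σ * det2 v e : ℝ) : ℂ) * fderiv ℝ f (Ψ z) (T z.1) +
      ((σ * det2 (T z.1) v : ℝ) : ℂ) * fderiv ℝ f (Ψ z) e := by
    intro z hz
    rw [det_smulRight_add_smulRight]
    have h1 : |det2 (T z.1) e| = σ * det2 (T z.1) e := by
      have := hpos _ (hRI z hz).1
      rcases hσ with h | h
      · rw [h, one_mul] at this ⊢
        exact abs_of_pos this
      · rw [h] at this ⊢
        rw [abs_of_neg (by linarith)]
        ring
    rw [h1, ← map_smul]
    -- Cramer's rule for `v` in the basis `(T, e)`. Since `e` is fixed, the coefficient of `T` is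
    -- constant and leaves the integral, so no derivative of `T` is ever needed.
    have h2 : (σ * det2 (T z.1) e) • v = (σ * det2 v e) • T z.1 + (σ * det2 (T z.1) v) • e := by
      refine Prod.ext ?_ ?_ <;> simp [det2] <;> ring
    rw [h2, map_add, map_smul, map_smul, Complex.real_smul, Complex.real_smul]
  rw [setIntegral_congr_fun hRm hpt]
  have hΨc : ContinuousOn Ψ R := fun z hz => (hΨ' z hz).continuousWithinAt
  have hDc : ContinuousOn (fun z => fderiv ℝ f (Ψ z)) R :=
    (hf.continuousOn_fderiv hΩ).comp hΨc hΨΩ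
  have hTc : ContinuousOn (fun z : ℝ × ℝ => T z.1) R :=
    hT.comp continuousOn_fst fun z hz => (hRI z hz).1
  obtain ⟨K, hK⟩ := isCompact_Icc.exists_bound_of_continuousOn hT
  have hdetc : ContinuousOn (fun t => det2 (T t) v) (Icc c d) := by
    unfold det2; fun_prop
  obtain ⟨K', hK'⟩ := isCompact_Icc.exists_bound_of_continuousOn hdetc
  have hdetc' : ContinuousOn (fun z : ℝ × ℝ => det2 (T z.1) v) R :=
    hdetc.comp continuousOn_fst fun z hz => (hRI z hz).1
  have hint1 : IntegrableOn (fun z => fderiv ℝ f (Ψ z) (T z.1)) R := by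
    refine integrableOn_of_forall_norm_le (C := C * K) hRm hRfin ?_ fun z hz => ?_
    · exact (hDc.clm_apply hTc).aestronglyMeasurable hRm
    · exact (ContinuousLinearMap.le_opNorm _ _).trans (mul_le_mul (hC _ (hΨΩ z hz))
        (hK _ (hRI z hz).1) (norm_nonneg _) ((norm_nonneg _).trans (hC _ (hΨΩ z hz))))
  have hint2 : IntegrableOn
      (fun z => ((σ * det2 (T z.1) v : ℝ) : ℂ) * fderiv ℝ f (Ψ z) e) R := by
    refine integrableOn_of_forall_norm_le (C := K' * (C * ‖e‖)) hRm hRfin ?_ fun z hz => ?_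
    · refine ContinuousOn.aestronglyMeasurable ?_ hRm
      exact (Complex.continuous_ofReal.comp_continuousOn (hdetc'.const_mul σ |>.congr fun _ _ => rfl)).mul
        (hDc.clm_apply continuousOn_const)
    · have hσ1 : |σ| = 1 := by rcases hσ with h | h <;> simp [h]
      rw [norm_mul, Complex.norm_real, norm_mul, Real.norm_eq_abs σ, hσ1, one_mul]
      exact mul_le_mul (hK' _ (hRI z hz).1) ((ContinuousLinearMap.le_opNorm _ _).trans
        (mul_le_mul_of_nonneg_right (hC _ (hΨΩ z hz)) (norm_nonneg _))) (norm_nonneg _)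
        ((norm_nonneg _).trans (hK' _ (hRI z hz).1))
  rw [integral_add (hint1.const_mul _) hint2, integral_const_mul]
  -- The derivative along `T` is the `t`-derivative of `f (γ t + s • e)`, and `f` vanishes at both
  -- lateral edges.
  have hzero : ∫ z in R, fderiv ℝ f (Ψ z) (T z.1) = 0 := by
    rw [hR, Measure.volume_eq_prod, ← Measure.prod_restrict, integral_prod_symm]
    · refine (setIntegral_congr_fun measurableSet_Ioo (g := fun _ => (0 : ℂ)) ?_).trans (by simp)
      intro s hs
      have hs' := Ioo_subset_Ico_self hs
      change ∫ t in Ioo c d, fderiv ℝ f (γ t + s • e) (T t) = 0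
      rw [← integral_Ioc_eq_integral_Ioo, ← intervalIntegral.integral_of_le hcd,
        intervalIntegral.integral_eq_sub_of_hasDerivAt (f := fun t => f (γ t + s • e)),
        hc s hs', hd s hs', sub_zero]
      · intro t ht
        rw [uIcc_of_le hcd] at ht
        exact (hf.hasFDerivAt hΩ (hin t ht s hs')).comp_hasDerivAt t
          ((hγ t ht).add_const (s • e))
      · refine ContinuousOn.intervalIntegrable ?_
        rw [uIcc_of_le hcd]
        exact ((hf.continuousOn_fderiv hΩ).comp (hγc.add continuousOn_const)
          fun t ht => hin t ht s hs').clm_apply hT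
    · rw [Measure.prod_restrict]
      exact hint1
  rw [hzero, mul_zero, zero_add, hR, Measure.volume_eq_prod, setIntegral_prod _ hint2]
  refine setIntegral_congr_fun measurableSet_Ioo fun t ht => ?_
  have ht' := Ioo_subset_Icc_self ht
  change ∫ s in Ioo (-ρ) 0, ((σ * det2 (T t) v : ℝ) : ℂ) * fderiv ℝ f (γ t + s • e) e = _
  have hlin : ∀ s : ℝ, HasDerivAt (fun s : ℝ => γ t + s • e) e s := by
    intro s
    simpa using ((hasDerivAt_id s).smul_const e).const_add (γ t)
  -- The derivative along `e` integrates to the value at `s = 0`, where `f` is merely continuous,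
  -- minus the value at `s = -ρ`, which is zero.
  rw [integral_const_mul, ← integral_Ioc_eq_integral_Ioo,
    ← intervalIntegral.integral_of_le (by linarith),
    intervalIntegral.integral_eq_sub_of_hasDerivAt_of_le (f := fun s => f (γ t + s • e))
      (by linarith), hb t ht', zero_smul, add_zero, sub_zero, mul_comm]
  · refine hf.continuousOn.comp (by fun_prop) fun s hs => ?_
    rcases eq_or_lt_of_le hs.2 with h | h
    · rw [h, zero_smul, add_zero]; exact hcl t ht'
    · exact subset_closure (hin t ht' s ⟨hs.1, h⟩)
  · intro s hs
    exact (hf.hasFDerivAt hΩ (hin t ht' s (Ioo_subset_Ico_self hs))).comp_hasDerivAt s (hlin s)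
  · rw [intervalIntegrable_iff_integrableOn_Ioo_of_le (by linarith)]
    refine integrableOn_of_forall_norm_le (C := C * ‖e‖) measurableSet_Ioo (by simp) ?_
      fun s hs => ?_
    · refine ContinuousOn.aestronglyMeasurable ?_ measurableSet_Ioo
      exact ((hf.continuousOn_fderiv hΩ).comp (by fun_prop)
        fun s hs => hin t ht' s (Ioo_subset_Ico_self hs)).clm_apply continuousOn_const
    · exact (ContinuousLinearMap.le_opNorm _ _).trans (mul_le_mul_of_nonneg_right
        (hC _ (hin t ht' s (Ioo_subset_Ico_self hs))) (norm_nonneg _))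

namespace IsC1UpToBoundary

variable {Ω : Set (ℝ × ℝ)} {f g : ℝ × ℝ → ℂ}

theorem fderiv_add (hΩ : IsOpen Ω) (hf : IsC1UpToBoundary Ω f) (hg : IsC1UpToBoundary Ω g)
    {q : ℝ × ℝ} (hq : q ∈ Ω) :
    fderiv ℝ (fun q => f q + g q) q = fderiv ℝ f q + fderiv ℝ g q :=
  ((hf.hasFDerivAt hΩ hq).add (hg.hasFDerivAt hΩ hq)).fderiv

theorem fderiv_mul (hΩ : IsOpen Ω) (hf : IsC1UpToBoundary Ω f) (hg : IsC1UpToBoundary Ω g)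
    {q : ℝ × ℝ} (hq : q ∈ Ω) :
    fderiv ℝ (fun q => f q * g q) q = f q • fderiv ℝ g q + g q • fderiv ℝ f q :=
  ((hf.hasFDerivAt hΩ hq).mul (hg.hasFDerivAt hΩ hq)).fderiv

theorem add (hΩ : IsOpen Ω) (hf : IsC1UpToBoundary Ω f) (hg : IsC1UpToBoundary Ω g) :
    IsC1UpToBoundary Ω fun q => f q + g q := by
  refine ⟨hf.continuousOn.add hg.continuousOn, hf.contDiffOn.add hg.contDiffOn, ?_⟩
  obtain ⟨C, hC⟩ := hf.bound
  obtain ⟨C', hC'⟩ := hg.bound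
  refine ⟨C + C', fun q hq => ?_⟩
  rw [fderiv_add hΩ hf hg hq]
  exact (norm_add_le _ _).trans (add_le_add (hC q hq) (hC' q hq))

theorem mul (hΩ : IsOpen Ω) (hcompact : IsCompact (closure Ω)) (hf : IsC1UpToBoundary Ω f)
    (hg : IsC1UpToBoundary Ω g) : IsC1UpToBoundary Ω fun q => f q * g q := by
  refine ⟨hf.continuousOn.mul hg.continuousOn, hf.contDiffOn.mul hg.contDiffOn, ?_⟩
  obtain ⟨C, hC⟩ := hf.bound
  obtain ⟨C', hC'⟩ := hg.bound
  obtain ⟨K, hK⟩ := hcompact.exists_bound_of_continuousOn hf.continuousOn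
  obtain ⟨K', hK'⟩ := hcompact.exists_bound_of_continuousOn hg.continuousOn
  refine ⟨K * C' + K' * C, fun q hq => ?_⟩
  rw [fderiv_mul hΩ hf hg hq]
  have h1 := hK q (subset_closure hq)
  have h2 := hK' q (subset_closure hq)
  refine (norm_add_le _ _).trans (add_le_add ?_ ?_)
  · rw [norm_smul]
    exact mul_le_mul h1 (hC' q hq) (norm_nonneg _) ((norm_nonneg _).trans h1)
  · rw [norm_smul]
    exact mul_le_mul h2 (hC q hq) (norm_nonneg _) ((norm_nonneg _).trans h2)

theorem of_contDiffOn {W : Set (ℝ × ℝ)} (hcompact : IsCompact (closure Ω))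
    (hW : IsOpen W) (hsub : closure Ω ⊆ W) (hf : ContDiffOn ℝ 1 f W) : IsC1UpToBoundary Ω f := by
  refine ⟨hf.continuousOn.mono hsub, hf.mono (subset_closure.trans hsub), ?_⟩
  obtain ⟨C, hC⟩ := hcompact.exists_bound_of_continuousOn
    ((hf.continuousOn_fderiv_of_isOpen hW le_rfl).mono hsub)
  exact ⟨C, fun q hq => hC q (subset_closure hq)⟩

theorem ofReal_mul (hΩ : IsOpen Ω) (hcompact : IsCompact (closure Ω))
    (hf : IsC1UpToBoundary Ω f) {φ : ℝ × ℝ → ℝ} (hφ : ContDiff ℝ 1 φ) :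
    IsC1UpToBoundary Ω fun q => (φ q : ℂ) * f q :=
  mul hΩ hcompact (of_contDiffOn hcompact isOpen_univ (subset_univ _)
    (Complex.ofRealCLM.contDiff.comp hφ).contDiffOn) hf

theorem integrableOn_fderiv (hΩ : IsOpen Ω) (hcompact : IsCompact (closure Ω))
    (hf : IsC1UpToBoundary Ω f) (v : ℝ × ℝ) : IntegrableOn (fun q => fderiv ℝ f q v) Ω := by
  obtain ⟨C, hC⟩ := hf.bound
  refine integrableOn_of_forall_norm_le (C := C * ‖v‖) hΩ.measurableSet
    ((measure_mono subset_closure).trans_lt hcompact.measure_lt_top) ?_ fun q hq => ?_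
  · exact ((hf.continuousOn_fderiv hΩ).clm_apply continuousOn_const).aestronglyMeasurable
      hΩ.measurableSet
  · exact (ContinuousLinearMap.le_opNorm _ _).trans
      (mul_le_mul_of_nonneg_right (hC q hq) (norm_nonneg _))

end IsC1UpToBoundary

/-! ### Divergence theorem: the defect and its local vanishing. -/

namespace PiecewiseC1Boundary

variable {Ω : Set (ℝ × ℝ)} (B : PiecewiseC1Boundary Ω)

theorem arc_mem_closure {i : Fin B.N} {t : ℝ} (ht : t ∈ Icc (B.a i) (B.b i)) :
    B.γ i t ∈ closure Ω := frontier_subset_closure (B.arc_mem_frontier ht)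

theorem continuousOn_comp_arc {f : ℝ × ℝ → ℂ} (hf : ContinuousOn f (closure Ω)) (i : Fin B.N) :
    ContinuousOn (fun t => f (B.γ i t)) (Icc (B.a i) (B.b i)) :=
  hf.comp (B.continuousOn_arc i) fun _ ht => B.arc_mem_closure ht

theorem exists_abs_dot_normalDensity_le (hΩ : IsOpen Ω) (i : Fin B.N) (v : ℝ × ℝ) :
    ∃ C, ∀ t ∈ Ioo (B.a i) (B.b i), |dot (B.normalDensity i t) v| ≤ C := by
  obtain ⟨C, hC⟩ := B.exists_norm_normalDensity_le hΩ i
  refine ⟨C * |v.1| + C * |v.2|, fun t ht => ?_⟩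
  have h := hC t ht
  have h1 : |(B.normalDensity i t).1| ≤ C := (norm_fst_le (B.normalDensity i t)).trans h
  have h2 : |(B.normalDensity i t).2| ≤ C := (norm_snd_le (B.normalDensity i t)).trans h
  refine (abs_add_le _ _).trans (add_le_add ?_ ?_) <;> rw [abs_mul] <;> gcongr

theorem continuousOn_dot_normalDensity (hΩ : IsOpen Ω) (i : Fin B.N) (v : ℝ × ℝ) :
    ContinuousOn (fun t => dot (B.normalDensity i t) v) (Ioo (B.a i) (B.b i)) :=
  (continuous_dot_left v).comp_continuousOn (B.continuousOn_normalDensity hΩ i)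

theorem intervalIntegrable_mul_normalDensity (hΩ : IsOpen Ω) {i : Fin B.N} {f : ℝ → ℂ}
    (hf : ContinuousOn f (Icc (B.a i) (B.b i))) (v : ℝ × ℝ) :
    IntervalIntegrable (fun t => f t * ((dot (B.normalDensity i t) v : ℝ) : ℂ)) volume
      (B.a i) (B.b i) := by
  rw [intervalIntegrable_iff_integrableOn_Ioo_of_le (B.a_lt_b i).le]
  obtain ⟨C, hC⟩ := B.exists_abs_dot_normalDensity_le hΩ i v
  obtain ⟨K, hK⟩ := isCompact_Icc.exists_bound_of_continuousOn hf
  refine integrableOn_of_forall_norm_le (C := K * C) measurableSet_Ioo (by simp) ?_ fun t ht => ?_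
  · refine ContinuousOn.aestronglyMeasurable ?_ measurableSet_Ioo
    exact (hf.mono Ioo_subset_Icc_self).mul
      (Complex.continuous_ofReal.comp_continuousOn (B.continuousOn_dot_normalDensity hΩ i v))
  · have h1 := hK t (Ioo_subset_Icc_self ht)
    rw [norm_mul, Complex.norm_real]
    exact mul_le_mul h1 (hC t ht) (norm_nonneg _) ((norm_nonneg _).trans h1)

/-- The two sides of the divergence theorem for the field `f • v`, subtracted. -/
noncomputable def defect (v : ℝ × ℝ) (f : ℝ × ℝ → ℂ) : ℂ :=
  (∫ q in Ω, fderiv ℝ f q v) -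
    ∑ i, ∫ t in (B.a i)..(B.b i), f (B.γ i t) * ((dot (B.normalDensity i t) v : ℝ) : ℂ)

theorem defect_add (hΩ : IsOpen Ω) (hcompact : IsCompact (closure Ω)) {f g : ℝ × ℝ → ℂ}
    (hf : IsC1UpToBoundary Ω f) (hg : IsC1UpToBoundary Ω g) (v : ℝ × ℝ) :
    B.defect v (fun q => f q + g q) = B.defect v f + B.defect v g := by
  have h1 : ∫ q in Ω, fderiv ℝ (fun q => f q + g q) q v =
      (∫ q in Ω, fderiv ℝ f q v) + ∫ q in Ω, fderiv ℝ g q v := by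
    rw [← integral_add (hf.integrableOn_fderiv hΩ hcompact v)
      (hg.integrableOn_fderiv hΩ hcompact v)]
    refine setIntegral_congr_fun hΩ.measurableSet fun q hq => ?_
    simp only [IsC1UpToBoundary.fderiv_add hΩ hf hg hq, add_apply]
  simp only [defect, h1, add_mul]
  rw [Finset.sum_congr rfl fun i _ => intervalIntegral.integral_add
    (B.intervalIntegrable_mul_normalDensity hΩ (B.continuousOn_comp_arc hf.continuousOn i) v)
    (B.intervalIntegrable_mul_normalDensity hΩ (B.continuousOn_comp_arc hg.continuousOn i) v),
    Finset.sum_add_distrib]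
  ring

theorem defect_congr (hΩ : IsOpen Ω) {f g : ℝ × ℝ → ℂ} (hfg : EqOn f g (closure Ω)) (v : ℝ × ℝ) :
    B.defect v f = B.defect v g := by
  unfold defect
  congr 1
  · refine setIntegral_congr_fun hΩ.measurableSet fun q hq => ?_
    have : f =ᶠ[𝓝 q] g := by
      filter_upwards [hΩ.mem_nhds hq] with z hz using hfg (subset_closure hz)
    simp only [this.fderiv_eq]
  · refine Finset.sum_congr rfl fun i _ => intervalIntegral.integral_congr fun t ht => ?_
    rw [uIcc_of_le (B.a_lt_b i).le] at ht
    simp only [hfg (B.arc_mem_closure ht)]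

theorem defect_zero (v : ℝ × ℝ) : B.defect v (fun _ => 0) = 0 := by simp [defect]

theorem defect_eq_zero_of_tsupport_subset (hΩ : IsOpen Ω) (hcompact : IsCompact (closure Ω))
    {f : ℝ × ℝ → ℂ} (hf : IsC1UpToBoundary Ω f) (hsupp : tsupport f ⊆ Ω) (v : ℝ × ℝ) :
    B.defect v f = 0 := by
  have hcs : HasCompactSupport f :=
    hcompact.of_isClosed_subset (isClosed_tsupport f) (hsupp.trans subset_closure)
  have hd : Differentiable ℝ f := by
    intro q
    by_cases hq : q ∈ tsupport f
    · exact (hf.hasFDerivAt hΩ (hsupp hq)).differentiableAt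
    · exact (notMem_tsupport_iff_eventuallyEq.1 hq).differentiableAt_iff.2
        (differentiableAt_const _)
  have hzero : ∀ q ∉ Ω, f q = 0 := fun q hq => image_eq_zero_of_notMem_tsupport fun h => hq (hsupp h)
  have h1 : ∫ q in Ω, fderiv ℝ f q v = ∫ q, fderiv ℝ f q v := by
    refine setIntegral_eq_integral_of_forall_compl_eq_zero fun q hq => ?_
    have : fderiv ℝ f q = 0 := by
      by_contra h
      exact hq (hsupp (support_fderiv_subset ℝ h))
    rw [this]; rfl
  have hint : Integrable fun q => fderiv ℝ f q v := by
    rw [← integrableOn_iff_integrable_of_support_subset (s := Ω)]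
    · exact hf.integrableOn_fderiv hΩ hcompact v
    · intro q hq
      refine hsupp (support_fderiv_subset ℝ fun h => hq ?_)
      simp only [h]; rfl
  have h2 : ∫ q, fderiv ℝ f q v = 0 := by
    -- Integration by parts over the whole plane against the constant 1.
    have := integral_mul_fderiv_eq_neg_fderiv_mul_of_integrable (μ := (volume : Measure (ℝ × ℝ)))
      (f := fun _ => (1 : ℂ)) (g := f)
      (v := v) (by simp) (by simpa using hint)
      (by simpa using hd.continuous.integrable_of_hasCompactSupport hcs)
      (fun _ _ => differentiableAt_const _) (fun q _ => hd q)
    simpa using this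
  have h3 : ∀ i, ∫ t in (B.a i)..(B.b i), f (B.γ i t) * ((dot (B.normalDensity i t) v : ℝ) : ℂ)
      = 0 := by
    intro i
    refine intervalIntegral.integral_zero_ae (ae_of_all _ fun t ht => ?_)
    rw [uIoc_of_le (B.a_lt_b i).le] at ht
    have hfr := B.arc_mem_frontier (Ioc_subset_Icc_self ht)
    rw [hΩ.frontier_eq] at hfr
    rw [hzero _ hfr.2, zero_mul]
  simp only [defect, h1, h2, h3, Finset.sum_const_zero, sub_zero]

/-- The neighbourhood is the image of a chart rectangle of half the size, so that `f` vanishes on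
the lateral edges and on the inner edge of the full collar, as `integral_collar` requires. -/
theorem exists_isOpen_defect_eq_zero_of_arc (hΩ : IsOpen Ω) {i : Fin B.N} {t₀ : ℝ}
    (ht : t₀ ∈ Ioo (B.a i) (B.b i)) (v : ℝ × ℝ) : ∃ U, IsOpen U ∧ B.γ i t₀ ∈ U ∧
      ∀ f, IsC1UpToBoundary Ω f → tsupport f ⊆ U → B.defect v f = 0 := by
  obtain ⟨e, σ, δ, ρ, hσ, hδ, hρ, hJ, hpos, hinj, hin, hout, hpar⟩ := B.exists_collar hΩ ht
  set Ψ : ℝ × ℝ → ℝ × ℝ := fun z => B.γ i z.1 + z.2 • e with hΨ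
  set R' : Set (ℝ × ℝ) := Ioo (t₀ - δ / 2) (t₀ + δ / 2) ×ˢ Ioo (-(ρ / 2)) (ρ / 2) with hR'
  have ht₀ : t₀ ∈ Icc (t₀ - δ) (t₀ + δ) := ⟨by linarith, by linarith⟩
  have hR'J : ∀ z ∈ R', z.1 ∈ Icc (t₀ - δ) (t₀ + δ) ∧ z.2 ∈ Icc (-ρ) ρ := by
    rintro z ⟨h1, h2⟩
    exact ⟨⟨by linarith [h1.1], by linarith [h1.2]⟩, ⟨by linarith [h2.1], by linarith [h2.2]⟩⟩
  -- The derivative of the chart at `(t₀, 0)` is invertible, so the inverse function theorem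
  -- applies.
  have hV : Ψ '' R' ∈ 𝓝 (B.γ i t₀) := by
    have hγs : HasStrictDerivAt (B.γ i) (B.tangent i t₀) t₀ := by
      have h1 : ContDiffAt ℝ 1 (B.γ i) t₀ :=
        (B.contDiffOn i).contDiffAt (Icc_mem_nhds ht.1 ht.2)
      have h2 := h1.hasStrictDerivAt one_ne_zero
      rwa [(B.hasDerivAt_arc ht).deriv] at h2
    set L := (ContinuousLinearMap.fst ℝ ℝ ℝ).smulRight (B.tangent i t₀) +
      (ContinuousLinearMap.snd ℝ ℝ ℝ).smulRight e with hL
    have hs : HasStrictFDerivAt Ψ L (t₀, 0) := by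
      refine HasStrictFDerivAt.add ?_ (hasStrictFDerivAt_snd.smul_const e)
      refine (HasStrictFDerivAt.comp (t₀, (0 : ℝ)) (g := B.γ i) (f := Prod.fst)
        hγs.hasStrictFDerivAt hasStrictFDerivAt_fst).congr_fderiv ?_
      ext <;> simp
    have hdet : L.det ≠ 0 := by
      rw [hL, det_smulRight_add_smulRight]
      intro h
      have := hpos t₀ ht₀
      rw [h] at this
      simp at this
    rw [← ContinuousLinearMap.coe_toContinuousLinearEquivOfDetNeZero L hdet] at hs
    have hm := hs.map_nhds_eq_of_equiv
    have h0 : Ψ (t₀, 0) = B.γ i t₀ := by simp [hΨ]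
    rw [← h0, ← hm]
    refine image_mem_map (prod_mem_nhds (Ioo_mem_nhds ?_ ?_) (Ioo_mem_nhds ?_ ?_)) <;>
      linarith
  refine ⟨interior (Ψ '' R'), isOpen_interior, mem_interior_iff_mem_nhds.2 hV, fun f hf hsupp => ?_⟩
  have hmem : ∀ t ∈ Icc (t₀ - δ) (t₀ + δ), ∀ s : ℝ, f (B.γ i t + s • e) ≠ 0 → (t, s) ∈ R' := by
    intro t ht s hne
    obtain ⟨⟨t', s'⟩, hz, h⟩ := interior_subset (hsupp (subset_tsupport f hne))
    obtain ⟨h1, h2⟩ := hinj t' (hR'J _ hz).1 t ht s' s h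
    rwa [← h1, ← h2]
  have harc : ∀ j, ∀ t ∈ Icc (B.a j) (B.b j), f (B.γ j t) ≠ 0 →
      i = j ∧ t ∈ Ioo (t₀ - δ / 2) (t₀ + δ / 2) := by
    intro j t htj hne
    obtain ⟨z, hz, h⟩ := interior_subset (hsupp (subset_tsupport f hne))
    obtain ⟨h1, h2⟩ := hpar z.1 (hR'J _ hz).1 z.2 (hR'J _ hz).2 j t htj h.symm
    exact ⟨h1, h2 ▸ hz.1⟩
  have hcd : t₀ - δ ≤ t₀ + δ := by linarith
  have hvol : ∫ q in Ω, fderiv ℝ f q v =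
      ∫ q in Ψ '' (Ioo (t₀ - δ) (t₀ + δ) ×ˢ Ioo (-ρ) 0), fderiv ℝ f q v := by
    refine setIntegral_eq_of_subset_of_forall_sdiff_eq_zero hΩ.measurableSet ?_ ?_
    · rintro _ ⟨z, hz, rfl⟩
      exact hin _ (Ioo_subset_Icc_self hz.1) _ (Ioo_subset_Ico_self hz.2)
    · rintro q ⟨hq, hq'⟩
      have : fderiv ℝ f q = 0 := by
        by_contra h
        obtain ⟨z, hz, rfl⟩ := interior_subset (hsupp (support_fderiv_subset ℝ h))
        rcases lt_trichotomy z.2 0 with hs | hs | hs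
        · exact hq' ⟨z, ⟨⟨by linarith [hz.1.1], by linarith [hz.1.2]⟩,
            ⟨by linarith [hz.2.1], hs⟩⟩, rfl⟩
        · have hfr := B.arc_mem_frontier (Ioo_subset_Icc_self (hJ (hR'J z hz).1))
          rw [hΩ.frontier_eq] at hfr
          refine hfr.2 ?_
          simpa [hΨ, hs] using hq
        · exact hout _ (hR'J z hz).1 _ ⟨hs, (hR'J z hz).2.2⟩ (subset_closure hq)
      rw [this]; rfl
  have hzero : ∀ t ∈ Icc (t₀ - δ) (t₀ + δ), ∀ s : ℝ, (t, s) ∉ R' → f (B.γ i t + s • e) = 0 :=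
    fun t ht s h => by_contra fun hne => h (hmem t ht s hne)
  have hT : ContinuousOn (B.tangent i) (Icc (t₀ - δ) (t₀ + δ)) :=
    (B.continuousOn_tangent i).mono (hJ.trans Ioo_subset_Icc_self)
  have hcollar := integral_collar hΩ hf hcd hρ hT (fun t ht => B.hasDerivAt_arc (hJ ht)) hσ hpos
    hinj hin (fun t ht => B.arc_mem_closure (Ioo_subset_Icc_self (hJ ht)))
    (fun s _ => hzero _ ⟨le_rfl, hcd⟩ s fun h => by linarith [h.1.1])
    (fun s _ => hzero _ ⟨hcd, le_rfl⟩ s fun h => by linarith [h.1.2])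
    (fun t ht => hzero t ht _ fun h => by linarith [h.2.1]) v
  have hbd : ∑ j, ∫ t in (B.a j)..(B.b j), f (B.γ j t) * ((dot (B.normalDensity j t) v : ℝ) : ℂ) =
      ∫ t in Ioo (t₀ - δ) (t₀ + δ), f (B.γ i t) * ((σ * det2 (B.tangent i t) v : ℝ) : ℂ) := by
    rw [Finset.sum_eq_single i]
    · rw [intervalIntegral.integral_of_le (B.a_lt_b i).le, integral_Ioc_eq_integral_Ioo]
      refine (setIntegral_eq_of_subset_of_forall_sdiff_eq_zero measurableSet_Ioo
        (Ioo_subset_Icc_self.trans hJ) ?_).trans ?_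
      · rintro t ⟨h1, h2⟩
        have : f (B.γ i t) = 0 := by
          by_contra hne
          have := (harc i t (Ioo_subset_Icc_self h1) hne).2
          exact h2 ⟨by linarith [this.1], by linarith [this.2]⟩
        rw [this, zero_mul]
      · refine setIntegral_congr_fun measurableSet_Ioo fun t ht => ?_
        have ht' := Ioo_subset_Icc_self ht
        simp only [B.normalDensity_eq hΩ (hJ ht') hσ (hpos t ht') hρ (hout t ht'), dot_smul_left]
        congr 3
        simp only [dot, det2]
        ring
    · intro j _ hj
      refine intervalIntegral.integral_zero_ae (ae_of_all _ fun t ht => ?_)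
      rw [uIoc_of_le (B.a_lt_b j).le] at ht
      have : f (B.γ j t) = 0 := by
        by_contra hne
        exact hj (harc j t (Ioc_subset_Icc_self ht) hne).1.symm
      rw [this, zero_mul]
    · simp
  rw [defect, hvol, hbd, hcollar, sub_self]

end PiecewiseC1Boundary
-- Divergence theorem: gluing, and removal of the endpoints.
namespace PiecewiseC1Boundary

variable {Ω : Set (ℝ × ℝ)} (B : PiecewiseC1Boundary Ω)

/-- Being contained in an open set on which defects vanish passes to the union of two sets by a
smooth cutoff; compactness of the support does the rest. -/
theorem defect_eq_zero_of_local (hΩ : IsOpen Ω) (hcompact : IsCompact (closure Ω)) (v : ℝ × ℝ)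
    {f : ℝ × ℝ → ℂ} (hf : IsC1UpToBoundary Ω f) (hcs : HasCompactSupport f)
    (hloc : ∀ x ∈ tsupport f, ∃ U, IsOpen U ∧ x ∈ U ∧
      ∀ g, IsC1UpToBoundary Ω g → tsupport g ⊆ U → B.defect v g = 0) : B.defect v f = 0 := by
  have key : ∃ U, IsOpen U ∧ tsupport f ⊆ U ∧
      ∀ g, IsC1UpToBoundary Ω g → tsupport g ⊆ U → B.defect v g = 0 := by
    refine hcs.isCompact.induction_on (p := fun s => ∃ U, IsOpen U ∧ s ⊆ U ∧
      ∀ g, IsC1UpToBoundary Ω g → tsupport g ⊆ U → B.defect v g = 0) ?_ ?_ ?_ ?_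
    · refine ⟨∅, isOpen_empty, subset_rfl, fun g _ hg => ?_⟩
      have : g = fun _ => 0 := tsupport_eq_empty_iff.1 (subset_empty_iff.1 hg)
      rw [this, B.defect_zero]
    · rintro s t hst ⟨U, h1, h2, h3⟩
      exact ⟨U, h1, hst.trans h2, h3⟩
    · rintro s t ⟨U, hU, hsU, h1⟩ ⟨V, hV, htV, h2⟩
      refine ⟨U ∪ V, hU.union hV, union_subset_union hsU htV, fun g hg hgUV => ?_⟩
      have hdisj : Disjoint (tsupport g \ U) (tsupport g \ V) := by
        rw [Set.disjoint_left]
        rintro x ⟨hx, hxU⟩ ⟨-, hxV⟩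
        exact (hgUV hx).elim hxU hxV
      -- The cutoff is 0 near the part of the support outside `U` and 1 near the part outside `V`,
      -- so `ψ g` is supported in `U` and `(1 - ψ) g` in `V`.
      obtain ⟨ψ, h0, h1', -⟩ := exists_contMDiffMap_zero_one_nhds_of_isClosed
        (n := 1) (modelWithCornersSelf ℝ (ℝ × ℝ)) ((isClosed_tsupport g).sdiff hU)
        ((isClosed_tsupport g).sdiff hV) hdisj
      have hψ : ContDiff ℝ 1 ψ := ψ.contMDiff.contDiff
      have hg1 := hg.ofReal_mul hΩ hcompact hψ
      have hg2 := hg.ofReal_mul hΩ hcompact (contDiff_const.sub hψ : ContDiff ℝ 1 fun q => 1 - ψ q)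
      have hsum : B.defect v g = B.defect v (fun q => (ψ q : ℂ) * g q) +
          B.defect v (fun q => ((1 - ψ q : ℝ) : ℂ) * g q) := by
        rw [← B.defect_add hΩ hcompact hg1 hg2]
        congr 1
        ext q
        push_cast
        ring
      rw [hsum, h1 _ hg1, h2 _ hg2, add_zero]
      · intro x hx
        have hxg : x ∈ tsupport g := tsupport_mul_subset_right hx
        by_contra hxV
        have hev := eventually_nhdsSet_iff_forall.1 h1' x ⟨hxg, hxV⟩
        refine notMem_tsupport_iff_eventuallyEq.2 ?_ hx
        filter_upwards [hev] with z hz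
        simp [hz]
      · intro x hx
        have hxg : x ∈ tsupport g := tsupport_mul_subset_right hx
        by_contra hxU
        have hev := eventually_nhdsSet_iff_forall.1 h0 x ⟨hxg, hxU⟩
        refine notMem_tsupport_iff_eventuallyEq.2 ?_ hx
        filter_upwards [hev] with z hz
        simp [hz]
    · intro x hx
      obtain ⟨U, hU, hxU, h⟩ := hloc x hx
      exact ⟨U, mem_nhdsWithin_of_mem_nhds (hU.mem_nhds hxU), U, hU, subset_rfl, h⟩
  obtain ⟨U, -, hU, h⟩ := key
  exact h f hf hU

theorem defect_eq_zero_of_forall_ne_endpoint (hΩ : IsOpen Ω) (hcompact : IsCompact (closure Ω))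
    (v : ℝ × ℝ) {f : ℝ × ℝ → ℂ} (hf : IsC1UpToBoundary Ω f) (hcs : HasCompactSupport f)
    (hv : ∀ x ∈ tsupport f, ∀ i, x ≠ B.γ i (B.a i) ∧ x ≠ B.γ i (B.b i)) : B.defect v f = 0 := by
  refine B.defect_eq_zero_of_local hΩ hcompact v hf hcs fun x hx => ?_
  by_cases hxΩ : x ∈ Ω
  · exact ⟨Ω, hΩ, hxΩ, fun g hg hgs => B.defect_eq_zero_of_tsupport_subset hΩ hcompact hg hgs v⟩
  by_cases hxc : x ∈ closure Ω
  · have hfr : x ∈ frontier Ω := by rw [hΩ.frontier_eq]; exact ⟨hxc, hxΩ⟩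
    rw [B.frontier_eq] at hfr
    obtain ⟨i, t, ht, rfl⟩ := mem_iUnion.1 hfr
    refine B.exists_isOpen_defect_eq_zero_of_arc hΩ ⟨lt_of_le_of_ne ht.1 ?_,
      lt_of_le_of_ne ht.2 ?_⟩ v
    · rintro rfl
      exact (hv _ hx i).1 rfl
    · rintro rfl
      exact (hv _ hx i).2 rfl
  · refine ⟨(closure Ω)ᶜ, isClosed_closure.isOpen_compl, hxc, fun g _ hgs => ?_⟩
    rw [← B.defect_zero v]
    exact B.defect_congr hΩ
      (fun q hq => image_eq_zero_of_notMem_tsupport fun h => hgs h hq) v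

/-- The cutoffs are bounded and tend to 0 off `p`, while their gradients are O(n) on a set of area
O(1/n²). By `hp` the parameters mapped to `p` are ends of the parameter intervals, a null set. -/
theorem tendsto_defect_shrinking (hΩ : IsOpen Ω) (hcompact : IsCompact (closure Ω)) (v p : ℝ × ℝ)
    (hp : ∀ i, ∀ t ∈ Ioo (B.a i) (B.b i), B.γ i t ≠ p)
    {f : ℝ × ℝ → ℂ} (hf : IsC1UpToBoundary Ω f) {χ : ℝ × ℝ → ℝ} (hχ : ContDiff ℝ 1 χ)
    (hχs : HasCompactSupport χ) :
    Tendsto (fun n : ℕ => B.defect v fun q => (χ (((n : ℝ) + 1) • (q - p)) : ℂ) * f q) atTop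
      (𝓝 0) := by
  obtain ⟨M, hM0, hM⟩ : ∃ M, 0 ≤ M ∧ ∀ q ∈ closure Ω, ‖f q‖ ≤ M := by
    obtain ⟨M, hM⟩ := hcompact.exists_bound_of_continuousOn hf.continuousOn
    exact ⟨max M 0, le_max_right _ _, fun q hq => (hM q hq).trans (le_max_left _ _)⟩
  obtain ⟨K, hK⟩ := hχs.exists_bound_of_continuous hχ.continuous
  obtain ⟨K', hK'⟩ := (hχs.fderiv (𝕜 := ℝ)).exists_bound_of_continuous
    (hχ.continuous_fderiv one_ne_zero)
  obtain ⟨r, hr, hrs⟩ := hχs.isCompact.isBounded.subset_closedBall_lt 0 (0 : ℝ × ℝ)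
  have hK0 : 0 ≤ K := (norm_nonneg _).trans (hK 0)
  have hK'0 : 0 ≤ K' := (norm_nonneg _).trans (hK' 0)
  have hΩfin : volume Ω < ⊤ := (measure_mono subset_closure).trans_lt hcompact.measure_lt_top
  have hn1 : ∀ n : ℕ, (0 : ℝ) < (n : ℝ) + 1 := fun n => by positivity
  have hout : ∀ (n : ℕ) (q : ℝ × ℝ), r / ((n : ℝ) + 1) < ‖q - p‖ →
      ((n : ℝ) + 1) • (q - p) ∉ tsupport χ := by
    intro n q hq h
    have := hrs h
    rw [mem_closedBall_zero_iff, norm_smul, Real.norm_eq_abs, abs_of_pos (hn1 n)] at this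
    rw [div_lt_iff₀ (hn1 n)] at hq
    linarith
  have hlim : ∀ q : ℝ × ℝ, q ≠ p →
      Tendsto (fun n : ℕ => (χ (((n : ℝ) + 1) • (q - p)) : ℂ)) atTop (𝓝 0) := by
    intro q hq
    have hpos : 0 < ‖q - p‖ := norm_pos_iff.2 (sub_ne_zero.2 hq)
    refine tendsto_const_nhds.congr' ?_
    have h1 : Tendsto (fun n : ℕ => r / ((n : ℝ) + 1)) atTop (𝓝 0) :=
      tendsto_const_nhds.div_atTop (tendsto_natCast_atTop_atTop.atTop_add tendsto_const_nhds)
    filter_upwards [h1.eventually (gt_mem_nhds hpos)] with n hn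
    rw [image_eq_zero_of_notMem_tsupport (hout n q hn), Complex.ofReal_zero]
  have hχn : ∀ n : ℕ, ContDiff ℝ 1 fun q : ℝ × ℝ => χ (((n : ℝ) + 1) • (q - p)) := fun n =>
    hχ.comp ((contDiff_id.sub contDiff_const).const_smul _)
  have hDχ : ∀ (n : ℕ) (q : ℝ × ℝ),
      HasFDerivAt (fun q : ℝ × ℝ => (χ (((n : ℝ) + 1) • (q - p)) : ℂ))
        (Complex.ofRealCLM ∘L (((n : ℝ) + 1) • fderiv ℝ χ (((n : ℝ) + 1) • (q - p)))) q := by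
    intro n q
    have h1 : HasFDerivAt (fun q : ℝ × ℝ => ((n : ℝ) + 1) • (q - p))
        (((n : ℝ) + 1) • ContinuousLinearMap.id ℝ (ℝ × ℝ)) q :=
      ((hasFDerivAt_id q).sub_const p).const_smul ((n : ℝ) + 1)
    have h2 : HasFDerivAt χ (fderiv ℝ χ (((n : ℝ) + 1) • (q - p))) (((n : ℝ) + 1) • (q - p)) :=
      (hχ.differentiable one_ne_zero _).hasFDerivAt
    refine (Complex.ofRealCLM.hasFDerivAt.comp q (h2.comp q h1)).congr_fderiv ?_
    ext <;> simp
  have hfd : ∀ (n : ℕ), ∀ q ∈ Ω,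
      fderiv ℝ (fun q => (χ (((n : ℝ) + 1) • (q - p)) : ℂ) * f q) q v =
      (χ (((n : ℝ) + 1) • (q - p)) : ℂ) * fderiv ℝ f q v +
        f q * ((((n : ℝ) + 1) * fderiv ℝ χ (((n : ℝ) + 1) • (q - p)) v : ℝ) : ℂ) := by
    intro n q hq
    have h := ((hDχ n q).mul (hf.hasFDerivAt hΩ hq)).fderiv
    have h' : fderiv ℝ (fun q => (χ (((n : ℝ) + 1) • (q - p)) : ℂ) * f q) q = _ := h
    rw [h']
    simp
  have hint1 : ∀ n : ℕ, IntegrableOn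
      (fun q => (χ (((n : ℝ) + 1) • (q - p)) : ℂ) * fderiv ℝ f q v) Ω := fun n =>
    (hf.integrableOn_fderiv hΩ hcompact v).bdd_mul (c := K)
      (Complex.continuous_ofReal.comp (hχn n).continuous).aestronglyMeasurable
      (ae_of_all _ fun q => by simpa using hK _)
  have hcont2 : ∀ n : ℕ, Continuous fun q : ℝ × ℝ =>
      ((((n : ℝ) + 1) * fderiv ℝ χ (((n : ℝ) + 1) • (q - p)) v : ℝ) : ℂ) := fun n => by
    have := hχ.continuous_fderiv one_ne_zero
    fun_prop
  have hbound2 : ∀ (n : ℕ), ∀ q ∈ Ω,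
      ‖f q * ((((n : ℝ) + 1) * fderiv ℝ χ (((n : ℝ) + 1) • (q - p)) v : ℝ) : ℂ)‖ ≤
        M * (((n : ℝ) + 1) * (K' * ‖v‖)) := by
    intro n q hq
    have h1 := hM q (subset_closure hq)
    rw [norm_mul, Complex.norm_real, norm_mul, Real.norm_of_nonneg (hn1 n).le]
    refine mul_le_mul h1 (mul_le_mul_of_nonneg_left ?_ (hn1 n).le) (by positivity)
      ((norm_nonneg _).trans h1)
    exact (ContinuousLinearMap.le_opNorm _ _).trans
      (mul_le_mul_of_nonneg_right (hK' _) (norm_nonneg _))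
  have hint2 : ∀ n : ℕ, IntegrableOn (fun q =>
      f q * ((((n : ℝ) + 1) * fderiv ℝ χ (((n : ℝ) + 1) • (q - p)) v : ℝ) : ℂ)) Ω := fun n =>
    integrableOn_of_forall_norm_le hΩ.measurableSet hΩfin
      (((hf.continuousOn.mono subset_closure).mul
        (hcont2 n).continuousOn).aestronglyMeasurable hΩ.measurableSet) (hbound2 n)
  have hA : Tendsto (fun n : ℕ => ∫ q in Ω,
      (χ (((n : ℝ) + 1) • (q - p)) : ℂ) * fderiv ℝ f q v) atTop (𝓝 0) := by
    have h0 : (0 : ℂ) = ∫ q in Ω, (0 : ℂ) := by simp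
    rw [h0]
    refine tendsto_integral_of_dominated_convergence (fun q => K * ‖fderiv ℝ f q v‖)
      (fun n => (hint1 n).aestronglyMeasurable)
      ((hf.integrableOn_fderiv hΩ hcompact v).norm.const_mul K) (fun n => ae_of_all _ fun q => ?_) ?_
    · rw [norm_mul, Complex.norm_real]
      exact mul_le_mul_of_nonneg_right (hK _) (norm_nonneg _)
    · have hae : ∀ᵐ q ∂(volume.restrict Ω), q ≠ p :=
        ae_restrict_of_ae (compl_mem_ae_iff.2 (measure_singleton p))
      filter_upwards [hae] with q hq
      simpa using (hlim q hq).mul_const (fderiv ℝ f q v)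
  have hB : Tendsto (fun n : ℕ => ∫ q in Ω,
      f q * ((((n : ℝ) + 1) * fderiv ℝ χ (((n : ℝ) + 1) • (q - p)) v : ℝ) : ℂ)) atTop (𝓝 0) := by
    set c := (volume : Measure (ℝ × ℝ)).real (Metric.closedBall 0 1) with hc
    have hle : ∀ n : ℕ, ‖∫ q in Ω,
        f q * ((((n : ℝ) + 1) * fderiv ℝ χ (((n : ℝ) + 1) • (q - p)) v : ℝ) : ℂ)‖ ≤
        M * K' * ‖v‖ * r ^ 2 * c / ((n : ℝ) + 1) := by
      intro n
      have hrn : 0 ≤ r / ((n : ℝ) + 1) := (div_pos hr (hn1 n)).le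
      have hvol : volume (Metric.closedBall p (r / ((n : ℝ) + 1))) < ⊤ :=
        measure_closedBall_lt_top
      have heq : ∫ q in Ω,
          f q * ((((n : ℝ) + 1) * fderiv ℝ χ (((n : ℝ) + 1) • (q - p)) v : ℝ) : ℂ) =
          ∫ q in Ω ∩ Metric.closedBall p (r / ((n : ℝ) + 1)),
          f q * ((((n : ℝ) + 1) * fderiv ℝ χ (((n : ℝ) + 1) • (q - p)) v : ℝ) : ℂ) := by
        refine setIntegral_eq_of_subset_of_forall_sdiff_eq_zero hΩ.measurableSet
          inter_subset_left ?_
        rintro q ⟨hq, hq'⟩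
        have hfar : r / ((n : ℝ) + 1) < ‖q - p‖ := by
          by_contra h
          exact hq' ⟨hq, by rw [Metric.mem_closedBall, dist_eq_norm]; linarith⟩
        have : fderiv ℝ χ (((n : ℝ) + 1) • (q - p)) = 0 := by
          by_contra h
          exact hout n q hfar (support_fderiv_subset ℝ h)
        simp [this]
      rw [heq]
      have hfin : volume (Ω ∩ Metric.closedBall p (r / ((n : ℝ) + 1))) < ⊤ :=
        (measure_mono inter_subset_left).trans_lt hΩfin
      refine (norm_setIntegral_le_of_norm_le_const hfin fun q hq => hbound2 n q hq.1).trans ?_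
      have h2 : volume.real (Ω ∩ Metric.closedBall p (r / ((n : ℝ) + 1))) ≤
          (r / ((n : ℝ) + 1)) ^ 2 * c := by
        refine (measureReal_mono inter_subset_right hvol.ne).trans (le_of_eq ?_)
        have h3 := Measure.addHaar_closedBall' (volume : Measure (ℝ × ℝ)) p hrn
        rw [Measure.real, h3, ENNReal.toReal_mul, ENNReal.toReal_ofReal (by positivity)]
        simp [hc, Measure.real]
      refine (mul_le_mul_of_nonneg_left h2 (by positivity)).trans (le_of_eq ?_)
      have := (hn1 n).ne'
      field_simp
    refine squeeze_zero_norm hle ?_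
    exact tendsto_const_nhds.div_atTop (tendsto_natCast_atTop_atTop.atTop_add tendsto_const_nhds)
  have hC : ∀ i, Tendsto (fun n : ℕ => ∫ t in (B.a i)..(B.b i),
      (χ (((n : ℝ) + 1) • (B.γ i t - p)) : ℂ) * f (B.γ i t) *
        ((dot (B.normalDensity i t) v : ℝ) : ℂ)) atTop (𝓝 0) := by
    intro i
    have hint := B.intervalIntegrable_mul_normalDensity hΩ
      (B.continuousOn_comp_arc hf.continuousOn i) v
    have h0 : (0 : ℂ) = ∫ t in (B.a i)..(B.b i), (0 : ℂ) := by simp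
    rw [h0]
    refine intervalIntegral.tendsto_integral_filter_of_dominated_convergence
      (fun t => K * ‖f (B.γ i t) * ((dot (B.normalDensity i t) v : ℝ) : ℂ)‖)
      (Eventually.of_forall fun n => ?_) (Eventually.of_forall fun n => ae_of_all _ fun t _ => ?_)
      (hint.norm.const_mul K) ?_
    · rw [uIoc_of_le (B.a_lt_b i).le]
      have h1 := B.intervalIntegrable_mul_normalDensity hΩ (B.continuousOn_comp_arc
        (hf.ofReal_mul hΩ hcompact (hχn n)).continuousOn i) v
      rw [intervalIntegrable_iff_integrableOn_Ioc_of_le (B.a_lt_b i).le] at h1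
      exact h1.aestronglyMeasurable
    · rw [mul_assoc, norm_mul, Complex.norm_real]
      exact mul_le_mul_of_nonneg_right (hK _) (norm_nonneg _)
    · have hb : ∀ᵐ t : ℝ, t ≠ B.b i := compl_mem_ae_iff.2 (measure_singleton _)
      filter_upwards [hb] with t htb ht
      rw [uIoc_of_le (B.a_lt_b i).le] at ht
      have hne := hp i t ⟨ht.1, lt_of_le_of_ne ht.2 htb⟩
      simpa [mul_assoc] using (hlim _ hne).mul_const
        (f (B.γ i t) * ((dot (B.normalDensity i t) v : ℝ) : ℂ))
  have hsum := (hA.add hB).sub (tendsto_finsetSum Finset.univ fun i _ => hC i)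
  simp only [Finset.sum_const_zero, add_zero, sub_zero] at hsum
  refine hsum.congr fun n => ?_
  rw [defect, ← integral_add (hint1 n) (hint2 n)]
  congr 1
  exact (setIntegral_congr_fun hΩ.measurableSet fun q hq => hfd n q hq).symm

/-- **Divergence theorem** for the field `f • v` on a piecewise `C¹` domain. -/
theorem integral_fderiv_eq (hΩ : IsOpen Ω) (hcompact : IsCompact (closure Ω)) (v : ℝ × ℝ)
    {f : ℝ × ℝ → ℂ} (hf : IsC1UpToBoundary Ω f) :
    ∫ q in Ω, fderiv ℝ f q v =
      ∑ i, ∫ t in (B.a i)..(B.b i), f (B.γ i t) * ((dot (B.normalDensity i t) v : ℝ) : ℂ) := by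
  -- Induction on the finite set `S` of arc endpoints that the support of `f` is allowed to contain.
  have key : ∀ S : Finset (ℝ × ℝ), (∀ x ∈ S, ∀ i, ∀ t ∈ Ioo (B.a i) (B.b i), B.γ i t ≠ x) →
      ∀ f, IsC1UpToBoundary Ω f → HasCompactSupport f →
      (∀ x ∈ tsupport f, x ∉ S → ∀ i, x ≠ B.γ i (B.a i) ∧ x ≠ B.γ i (B.b i)) →
      B.defect v f = 0 := by
    intro S
    induction S using Finset.induction_on with
    | empty =>
      intro _ f hf hcs h
      exact B.defect_eq_zero_of_forall_ne_endpoint hΩ hcompact v hf hcs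
        fun x hx => h x hx (Finset.notMem_empty x)
    | insert p S hpS ih =>
      intro hS f hf hcs h
      set χ : ContDiffBump (0 : ℝ × ℝ) := ⟨1, 2, one_pos, by norm_num⟩ with hχdef
      have hχ : ContDiff ℝ 1 (χ : ℝ × ℝ → ℝ) := χ.contDiff
      have hlim := B.tendsto_defect_shrinking hΩ hcompact v p (hS p (Finset.mem_insert_self _ _))
        hf hχ χ.hasCompactSupport
      -- For each `n` the defect of `f` equals that of its part near `p`, the remainder being
      -- covered by `ih`; the former does not depend on `n` and the latter tends to 0.
      refine tendsto_nhds_unique (tendsto_const_nhds.congr fun n => ?_) hlim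
      have hχn : ContDiff ℝ 1 fun q : ℝ × ℝ => χ (((n : ℝ) + 1) • (q - p)) :=
        hχ.comp ((contDiff_id.sub contDiff_const).const_smul _)
      have hg1 := hf.ofReal_mul hΩ hcompact hχn
      have hg2 := hf.ofReal_mul hΩ hcompact
        (contDiff_const.sub hχn : ContDiff ℝ 1 fun q => 1 - χ (((n : ℝ) + 1) • (q - p)))
      have hsum : B.defect v f = B.defect v (fun q => (χ (((n : ℝ) + 1) • (q - p)) : ℂ) * f q) +
          B.defect v (fun q => ((1 - χ (((n : ℝ) + 1) • (q - p)) : ℝ) : ℂ) * f q) := by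
        rw [← B.defect_add hΩ hcompact hg1 hg2]
        congr 1
        ext q
        push_cast
        ring
      rw [hsum, ih (fun x hx => hS x (Finset.mem_insert_of_mem hx)) _ hg2 hcs.mul_left, add_zero]
      intro x hx hxS
      refine h x (tsupport_mul_subset_right hx) ?_
      rw [Finset.mem_insert, not_or]
      refine ⟨?_, hxS⟩
      rintro rfl
      refine notMem_tsupport_iff_eventuallyEq.2 ?_ hx
      have hc : ContinuousAt (fun q : ℝ × ℝ => ((n : ℝ) + 1) • (q - x)) x := by fun_prop
      have h1 : (χ : ℝ × ℝ → ℝ) =ᶠ[𝓝 (((n : ℝ) + 1) • (x - x))] 1 := by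
        rw [sub_self, smul_zero]
        exact χ.eventuallyEq_one
      filter_upwards [hc.eventually h1] with q hq
      simp only [hq, Pi.one_apply, sub_self, Complex.ofReal_zero, zero_mul, Pi.zero_apply]
  -- A cutoff equal to 1 on the closure makes the support compact without changing the defect.
  obtain ⟨R, hR, hsub⟩ := hcompact.isBounded.subset_closedBall_lt 0 (0 : ℝ × ℝ)
  set χ : ContDiffBump (0 : ℝ × ℝ) := ⟨R, R + 1, hR, by linarith⟩ with hχdef
  have hχ : ContDiff ℝ 1 (χ : ℝ × ℝ → ℝ) := χ.contDiff
  have heq : EqOn f (fun q => (χ q : ℂ) * f q) (closure Ω) := fun q hq => by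
    simp only [χ.one_of_mem_closedBall (hsub hq), Complex.ofReal_one, one_mul]
  refine sub_eq_zero.1 ((B.defect_congr hΩ heq v).trans ?_)
  refine key (Finset.univ.image (fun i => B.γ i (B.a i)) ∪ Finset.univ.image fun i => B.γ i (B.b i))
    ?_ _ (hf.ofReal_mul hΩ hcompact hχ) ?_ ?_
  · intro x hx i t ht hxt
    rw [Finset.mem_union, Finset.mem_image, Finset.mem_image] at hx
    rcases hx with ⟨j, -, rfl⟩ | ⟨j, -, rfl⟩
    · obtain ⟨rfl, h⟩ := B.simple i t ht j _ (left_mem_Icc.2 (B.a_lt_b j).le) hxt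
      exact ht.1.ne' h
    · obtain ⟨rfl, h⟩ := B.simple i t ht j _ (right_mem_Icc.2 (B.a_lt_b j).le) hxt
      exact ht.2.ne h
  · exact HasCompactSupport.mul_right (χ.hasCompactSupport.comp_left Complex.ofReal_zero)
  · intro x _ hx i
    constructor <;> rintro rfl <;> exact hx (by simp)

end PiecewiseC1Boundary
-- Partial derivatives and their continuous extensions.
theorem hasDerivAt_pd₁ {f : ℝ × ℝ → ℂ} {q : ℝ × ℝ} {f' : ℝ × ℝ →L[ℝ] ℂ} (h : HasFDerivAt f f' q) :
    HasDerivAt (fun t : ℝ => f (t, q.2)) (f' (1, 0)) q.1 :=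
  HasFDerivAt.comp_hasDerivAt (f := fun t : ℝ => (t, q.2)) q.1 (l := f) h
    ((hasDerivAt_id q.1).prodMk (hasDerivAt_const q.1 q.2))

theorem hasDerivAt_pd₂ {f : ℝ × ℝ → ℂ} {q : ℝ × ℝ} {f' : ℝ × ℝ →L[ℝ] ℂ} (h : HasFDerivAt f f' q) :
    HasDerivAt (fun t : ℝ => f (q.1, t)) (f' (0, 1)) q.2 :=
  HasFDerivAt.comp_hasDerivAt (f := fun t : ℝ => (q.1, t)) q.2 (l := f) h
    ((hasDerivAt_const q.2 q.1).prodMk (hasDerivAt_id q.2))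

theorem fderiv_apply_eq_pd₁ {f : ℝ × ℝ → ℂ} {q : ℝ × ℝ} (h : DifferentiableAt ℝ f q) :
    fderiv ℝ f q (1, 0) = pd₁ f q := (hasDerivAt_pd₁ h.hasFDerivAt).deriv.symm

theorem fderiv_apply_eq_pd₂ {f : ℝ × ℝ → ℂ} {q : ℝ × ℝ} (h : DifferentiableAt ℝ f q) :
    fderiv ℝ f q (0, 1) = pd₂ f q := (hasDerivAt_pd₂ h.hasFDerivAt).deriv.symm

theorem hasDerivAt_slice₁ {f : ℝ × ℝ → ℂ} {q : ℝ × ℝ} (h : DifferentiableAt ℝ f q) :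
    HasDerivAt (fun t : ℝ => f (t, q.2)) (pd₁ f q) q.1 :=
  fderiv_apply_eq_pd₁ h ▸ hasDerivAt_pd₁ h.hasFDerivAt

theorem hasDerivAt_slice₂ {f : ℝ × ℝ → ℂ} {q : ℝ × ℝ} (h : DifferentiableAt ℝ f q) :
    HasDerivAt (fun t : ℝ => f (q.1, t)) (pd₂ f q) q.2 :=
  fderiv_apply_eq_pd₂ h ▸ hasDerivAt_pd₂ h.hasFDerivAt

theorem contDiffOn_pd₁ {W : Set (ℝ × ℝ)} (hW : IsOpen W) {f : ℝ × ℝ → ℂ}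
    (hf : ContDiffOn ℝ 2 f W) : ContDiffOn ℝ 1 (pd₁ f) W :=
  ((hf.fderiv_of_isOpen hW (m := 1) (by norm_num)).clm_apply contDiffOn_const).congr fun q hq =>
    (fderiv_apply_eq_pd₁ ((hf.differentiableOn two_ne_zero).differentiableAt (hW.mem_nhds hq))).symm

theorem contDiffOn_pd₂ {W : Set (ℝ × ℝ)} (hW : IsOpen W) {f : ℝ × ℝ → ℂ}
    (hf : ContDiffOn ℝ 2 f W) : ContDiffOn ℝ 1 (pd₂ f) W :=
  ((hf.fderiv_of_isOpen hW (m := 1) (by norm_num)).clm_apply contDiffOn_const).congr fun q hq =>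
    (fderiv_apply_eq_pd₂ ((hf.differentiableOn two_ne_zero).differentiableAt (hW.mem_nhds hq))).symm

theorem norm_le_apply_basis (L : ℝ × ℝ →L[ℝ] ℂ) : ‖L‖ ≤ ‖L (1, 0)‖ + ‖L (0, 1)‖ := by
  refine L.opNorm_le_bound (by positivity) fun v => ?_
  have h : L v = v.1 • L (1, 0) + v.2 • L (0, 1) := by
    rw [← map_smul, ← map_smul, ← map_add]
    congr 1
    ext <;> simp
  rw [h, add_mul]
  refine (norm_add_le _ _).trans (add_le_add ?_ ?_) <;> rw [norm_smul, mul_comm] <;> gcongr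
  · exact norm_fst_le v
  · exact norm_snd_le v

theorem ExtendsToClosure.exists_bound {Ω : Set (ℝ × ℝ)} {f : ℝ × ℝ → ℂ}
    (h : ExtendsToClosure Ω f) (hcompact : IsCompact (closure Ω)) :
    ∃ C, ∀ q ∈ Ω, ‖f q‖ ≤ C := by
  obtain ⟨g, hg, hgf⟩ := h
  obtain ⟨C, hC⟩ := hcompact.exists_bound_of_continuousOn hg
  exact ⟨C, fun q hq => hgf hq ▸ hC q (subset_closure hq)⟩

theorem IsC1UpToBoundary.of_extends {Ω : Set (ℝ × ℝ)} (hΩ : IsOpen Ω)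
    (hcompact : IsCompact (closure Ω)) {f : ℝ × ℝ → ℂ} (hf : ContinuousOn f (closure Ω))
    (hd : ContDiffOn ℝ 1 f Ω) (h₁ : ExtendsToClosure Ω (pd₁ f)) (h₂ : ExtendsToClosure Ω (pd₂ f)) :
    IsC1UpToBoundary Ω f := by
  obtain ⟨C₁, hC₁⟩ := h₁.exists_bound hcompact
  obtain ⟨C₂, hC₂⟩ := h₂.exists_bound hcompact
  refine ⟨hf, hd, C₁ + C₂, fun q hq => (norm_le_apply_basis _).trans ?_⟩
  have hdq := (hd.differentiableOn one_ne_zero).differentiableAt (hΩ.mem_nhds hq)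
  rw [fderiv_apply_eq_pd₁ hdq, fderiv_apply_eq_pd₂ hdq]
  exact add_le_add (hC₁ q hq) (hC₂ q hq)

theorem ExtendsToClosure.continuousOn_extendFrom {Ω : Set (ℝ × ℝ)} {f : ℝ × ℝ → ℂ}
    (h : ExtendsToClosure Ω f) : ContinuousOn (extendFrom Ω f) (closure Ω) := by
  obtain ⟨g, hg, hgf⟩ := h
  refine _root_.continuousOn_extendFrom subset_rfl fun x hx => ⟨g x, ?_⟩
  exact ((hg x hx).mono subset_closure).tendsto.congr' (eventually_nhdsWithin_of_forall hgf)

theorem eqOn_extendFrom {Ω : Set (ℝ × ℝ)} {f : ℝ × ℝ → ℂ} (hf : ContinuousOn f Ω) :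
    EqOn (extendFrom Ω f) f Ω := fun x hx =>
  extendFrom_eq (subset_closure hx) (hf x hx)

theorem EqOn.eventuallyEq_of_isOpen {Ω : Set (ℝ × ℝ)} (hΩ : IsOpen Ω) {f g : ℝ × ℝ → ℂ}
    (h : EqOn f g Ω) {q : ℝ × ℝ} (hq : q ∈ Ω) : f =ᶠ[𝓝 q] g := by
  filter_upwards [hΩ.mem_nhds hq] with z hz using h hz

theorem pd₁_congr {f g : ℝ × ℝ → ℂ} {q : ℝ × ℝ} (h : f =ᶠ[𝓝 q] g) : pd₁ f q = pd₁ g q := by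
  refine Filter.EventuallyEq.deriv_eq ?_
  have hc : Tendsto (fun t : ℝ => (t, q.2)) (𝓝 q.1) (𝓝 q) :=
    Continuous.tendsto' (by fun_prop) _ _ rfl
  exact hc.eventually h

theorem pd₂_congr {f g : ℝ × ℝ → ℂ} {q : ℝ × ℝ} (h : f =ᶠ[𝓝 q] g) : pd₂ f q = pd₂ g q := by
  refine Filter.EventuallyEq.deriv_eq ?_
  have hc : Tendsto (fun t : ℝ => (q.1, t)) (𝓝 q.2) (𝓝 q) :=
    Continuous.tendsto' (by fun_prop) _ _ rfl
  exact hc.eventually h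

theorem ExtendsToClosure.congr {Ω : Set (ℝ × ℝ)} {f g : ℝ × ℝ → ℂ}
    (h : ExtendsToClosure Ω f) (hfg : EqOn f g Ω) : ExtendsToClosure Ω g := by
  obtain ⟨k, hk, hkf⟩ := h
  exact ⟨k, hk, hkf.trans hfg⟩

/-- Makes the extended first derivatives of `u`, which enter `greenField`, admissible in the
divergence theorem. -/
theorem IsC1UpToBoundary.extendFrom {Ω : Set (ℝ × ℝ)} (hΩ : IsOpen Ω)
    (hcompact : IsCompact (closure Ω)) {f : ℝ × ℝ → ℂ} (hf : ExtendsToClosure Ω f)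
    (hd : ContDiffOn ℝ 1 f Ω) (h₁ : ExtendsToClosure Ω (pd₁ f)) (h₂ : ExtendsToClosure Ω (pd₂ f)) :
    IsC1UpToBoundary Ω (extendFrom Ω f) := by
  have heq := eqOn_extendFrom hd.continuousOn
  exact of_extends hΩ hcompact hf.continuousOn_extendFrom (hd.congr heq)
    (h₁.congr fun q hq => (pd₁_congr (EqOn.eventuallyEq_of_isOpen hΩ heq hq)).symm)
    (h₂.congr fun q hq => (pd₂_congr (EqOn.eventuallyEq_of_isOpen hΩ heq hq)).symm)

namespace IsC2OnClosure

variable {Ω : Set (ℝ × ℝ)} {u : ℝ × ℝ → ℂ}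

theorem isC1UpToBoundary (hu : IsC2OnClosure Ω u) (hΩ : IsOpen Ω)
    (hcompact : IsCompact (closure Ω)) : IsC1UpToBoundary Ω u :=
  .of_extends hΩ hcompact hu.continuousOn (hu.contDiffOn.of_le (by norm_num)) hu.ext₁ hu.ext₂

theorem isC1UpToBoundary_pd₁ (hu : IsC2OnClosure Ω u) (hΩ : IsOpen Ω)
    (hcompact : IsCompact (closure Ω)) : IsC1UpToBoundary Ω (extendFrom Ω (pd₁ u)) :=
  .extendFrom hΩ hcompact hu.ext₁ (contDiffOn_pd₁ hΩ hu.contDiffOn) hu.ext₁₁ hu.ext₂₁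

theorem isC1UpToBoundary_pd₂ (hu : IsC2OnClosure Ω u) (hΩ : IsOpen Ω)
    (hcompact : IsCompact (closure Ω)) : IsC1UpToBoundary Ω (extendFrom Ω (pd₂ u)) :=
  .extendFrom hΩ hcompact hu.ext₂ (contDiffOn_pd₂ hΩ hu.contDiffOn) hu.ext₁₂ hu.ext₂₂

end IsC2OnClosure

/-! ### Green's identity for the Weinstein operator. -/

/-- The formal adjoint of the Weinstein operator. -/
noncomputable def weinsteinAdj (m : ℂ) (k : ℝ × ℝ → ℂ) (q : ℝ × ℝ) : ℂ :=
  pd₁ (pd₁ k) q + pd₂ (pd₂ k) q - m * pd₁ (fun z => k z / (z.1 : ℂ)) q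

theorem isOpen_rightHalfPlane : IsOpen rightHalfPlane :=
  isOpen_lt continuous_const continuous_fst

theorem ofReal_fst_ne_zero {q : ℝ × ℝ} (hq : q ∈ rightHalfPlane) : (q.1 : ℂ) ≠ 0 :=
  Complex.ofReal_ne_zero.2 (ne_of_gt hq)

theorem contDiff_ofReal_fst {n : WithTop ℕ∞} : ContDiff ℝ n fun q : ℝ × ℝ => (q.1 : ℂ) :=
  Complex.ofRealCLM.contDiff.comp contDiff_fst

namespace PiecewiseC1Boundary

variable {Ω : Set (ℝ × ℝ)} (B : PiecewiseC1Boundary Ω)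

theorem fluxDensity_eq (X : ℝ × ℝ → ℂ × ℂ) (i : Fin B.N) (t : ℝ) :
    B.fluxDensity X i t =
      (X (B.γ i t)).1 * ((dot (B.normalDensity i t) (1, 0) : ℝ) : ℂ) +
      (X (B.γ i t)).2 * ((dot (B.normalDensity i t) (0, 1) : ℝ) : ℂ) := by
  simp only [fluxDensity, normalDensity, dot, tangent, Prod.smul_fst, Prod.smul_snd, smul_eq_mul]
  push_cast
  ring

/-- The divergence theorem for a vector field. -/
theorem integral_divergence_eq_flux (hΩ : IsOpen Ω) (hcompact : IsCompact (closure Ω))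
    {X : ℝ × ℝ → ℂ × ℂ} (h₁ : IsC1UpToBoundary Ω fun q => (X q).1)
    (h₂ : IsC1UpToBoundary Ω fun q => (X q).2) :
    ∫ q in Ω, (pd₁ (fun q => (X q).1) q + pd₂ (fun q => (X q).2) q) = B.flux X := by
  have hv : ∫ q in Ω, (pd₁ (fun q => (X q).1) q + pd₂ (fun q => (X q).2) q) =
      (∫ q in Ω, fderiv ℝ (fun q => (X q).1) q (1, 0)) +
        ∫ q in Ω, fderiv ℝ (fun q => (X q).2) q (0, 1) := by
    rw [← integral_add (h₁.integrableOn_fderiv hΩ hcompact _)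
      (h₂.integrableOn_fderiv hΩ hcompact _)]
    refine setIntegral_congr_fun hΩ.measurableSet fun q hq => ?_
    simp only [fderiv_apply_eq_pd₁ (h₁.hasFDerivAt hΩ hq).differentiableAt,
      fderiv_apply_eq_pd₂ (h₂.hasFDerivAt hΩ hq).differentiableAt]
  rw [hv, B.integral_fderiv_eq hΩ hcompact _ h₁, B.integral_fderiv_eq hΩ hcompact _ h₂,
    ← Finset.sum_add_distrib, flux]
  refine Finset.sum_congr rfl fun i _ => ?_
  rw [← intervalIntegral.integral_add
    (B.intervalIntegrable_mul_normalDensity hΩ (B.continuousOn_comp_arc h₁.continuousOn i) _)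
    (B.intervalIntegrable_mul_normalDensity hΩ (B.continuousOn_comp_arc h₂.continuousOn i) _)]
  simp only [fluxDensity_eq]

/-- **Green's identity** for the Weinstein operator. -/
theorem green (hΩ : IsOpen Ω) (hcompact : IsCompact (closure Ω))
    (hsub : closure Ω ⊆ rightHalfPlane) (m : ℂ) {u k : ℝ × ℝ → ℂ} (hu : IsC2OnClosure Ω u)
    (hk : ContDiffOn ℝ 2 k rightHalfPlane) :
    ∫ q in Ω, (weinsteinOp m u q * k q - u q * weinsteinAdj m k q) =
      B.flux (greenField m Ω u k) := by
  have hW := isOpen_rightHalfPlane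
  have hk1 : ContDiffOn ℝ 1 k rightHalfPlane := hk.of_le (by norm_num)
  have Ck := IsC1UpToBoundary.of_contDiffOn hcompact hW hsub hk1
  have Ck1 := IsC1UpToBoundary.of_contDiffOn hcompact hW hsub (contDiffOn_pd₁ hW hk)
  have Ck2 := IsC1UpToBoundary.of_contDiffOn hcompact hW hsub (contDiffOn_pd₂ hW hk)
  have hneg : ContDiffOn ℝ 1 (fun _ : ℝ × ℝ => (-1 : ℂ)) rightHalfPlane := contDiffOn_const
  have Cneg := IsC1UpToBoundary.of_contDiffOn hcompact hW hsub hneg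
  have hmx : ContDiffOn ℝ 1 (fun q : ℝ × ℝ => m / (q.1 : ℂ)) rightHalfPlane := by
    simp only [div_eq_mul_inv]
    exact contDiffOn_const.mul (contDiff_ofReal_fst.contDiffOn.inv fun q hq => ofReal_fst_ne_zero hq)
  have Cmx := IsC1UpToBoundary.of_contDiffOn hcompact hW hsub hmx
  have Cu := hu.isC1UpToBoundary hΩ hcompact
  have Cu1 := hu.isC1UpToBoundary_pd₁ hΩ hcompact
  have Cu2 := hu.isC1UpToBoundary_pd₂ hΩ hcompact
  -- Only sums and products are available for `IsC1UpToBoundary`; differences are formed with the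
  -- constant -1.
  have h₁ : IsC1UpToBoundary Ω fun q => (greenField m Ω u k q).1 := by
    have := ((Cu1.mul hΩ hcompact Ck).add hΩ (Cneg.mul hΩ hcompact (Cu.mul hΩ hcompact Ck1))).add hΩ
      ((Cmx.mul hΩ hcompact Cu).mul hΩ hcompact Ck)
    refine (funext fun q => ?_ : (fun q => _) = (fun q => (greenField m Ω u k q).1)) ▸ this
    simp only [greenField]; ring
  have h₂ : IsC1UpToBoundary Ω fun q => (greenField m Ω u k q).2 := by
    have := (Cu2.mul hΩ hcompact Ck).add hΩ (Cneg.mul hΩ hcompact (Cu.mul hΩ hcompact Ck2))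
    refine (funext fun q => ?_ : (fun q => _) = (fun q => (greenField m Ω u k q).2)) ▸ this
    simp only [greenField]; ring
  rw [← B.integral_divergence_eq_flux hΩ hcompact h₁ h₂]
  refine setIntegral_congr_fun hΩ.measurableSet fun q hq => ?_
  have hqW : q ∈ rightHalfPlane := hsub (subset_closure hq)
  have hx := ofReal_fst_ne_zero hqW
  have E1 := eqOn_extendFrom (contDiffOn_pd₁ hΩ hu.contDiffOn).continuousOn
  have E2 := eqOn_extendFrom (contDiffOn_pd₂ hΩ hu.contDiffOn).continuousOn
  have D1 := hasDerivAt_slice₁ (Cu1.hasFDerivAt hΩ hq).differentiableAt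
  have D2 := hasDerivAt_slice₂ (Cu2.hasFDerivAt hΩ hq).differentiableAt
  rw [pd₁_congr (EqOn.eventuallyEq_of_isOpen hΩ E1 hq)] at D1
  rw [pd₂_congr (EqOn.eventuallyEq_of_isOpen hΩ E2 hq)] at D2
  have dk := (Ck.hasFDerivAt hΩ hq).differentiableAt
  have du := (Cu.hasFDerivAt hΩ hq).differentiableAt
  have dk1 := (Ck1.hasFDerivAt hΩ hq).differentiableAt
  have dk2 := (Ck2.hasFDerivAt hΩ hq).differentiableAt
  have dx : HasDerivAt (fun t : ℝ => (t : ℂ)) 1 q.1 := Complex.ofRealCLM.hasDerivAt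
  have hkx : pd₁ (fun z => k z / (z.1 : ℂ)) q =
      (pd₁ k q * (q.1 : ℂ) - k q * 1) / (q.1 : ℂ) ^ 2 :=
    ((hasDerivAt_slice₁ dk).div dx hx).deriv
  have e1 : pd₁ (fun q => (greenField m Ω u k q).1) q =
      (pd₁ (pd₁ u) q * k q + extendFrom Ω (pd₁ u) q * pd₁ k q) -
      (pd₁ u q * pd₁ k q + u q * pd₁ (pd₁ k) q) +
      (((0 * (q.1 : ℂ) - m * 1) / (q.1 : ℂ) ^ 2 * u q + m / (q.1 : ℂ) * pd₁ u q) * k q +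
        m / (q.1 : ℂ) * u q * pd₁ k q) :=
    (((D1.mul (hasDerivAt_slice₁ dk)).sub ((hasDerivAt_slice₁ du).mul (hasDerivAt_slice₁ dk1))).add
      ((((hasDerivAt_const q.1 m).div dx hx).mul (hasDerivAt_slice₁ du)).mul
        (hasDerivAt_slice₁ dk))).deriv
  have e2 : pd₂ (fun q => (greenField m Ω u k q).2) q =
      (pd₂ (pd₂ u) q * k q + extendFrom Ω (pd₂ u) q * pd₂ k q) -
      (pd₂ u q * pd₂ k q + u q * pd₂ (pd₂ k) q) :=
    ((D2.mul (hasDerivAt_slice₂ dk)).sub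
      ((hasDerivAt_slice₂ du).mul (hasDerivAt_slice₂ dk2))).deriv
  -- The products of first derivatives cancel, and the terms in `m` add up to `m ∂_ξ (u k / ξ)`.
  simp only [e1, e2, E1 hq, E2 hq, weinsteinOp, weinsteinAdj, hkx]
  field_simp
  ring

end PiecewiseC1Boundary
-- Complex powers, the regularized kernel and its adjoint equation.
theorem hasDerivAt_ofReal_cpow {φ : ℝ → ℝ} {φ' t : ℝ} (hφ : HasDerivAt φ φ' t) (h0 : 0 < φ t)
    (s : ℂ) : HasDerivAt (fun t => (φ t : ℂ) ^ s) (s * (φ t : ℂ) ^ (s - 1) * (φ' : ℂ)) t := by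
  have h1 : HasDerivAt (fun z : ℂ => z ^ s) (s * (φ t : ℂ) ^ (s - 1)) (φ t : ℂ) := by
    simpa using (hasDerivAt_id (φ t : ℂ)).cpow_const (c := s) (Complex.ofReal_mem_slitPlane.2 h0)
  exact h1.comp t hφ.ofReal_comp

theorem cpow_add_one' {z : ℂ} (hz : z ≠ 0) (s : ℂ) : z ^ (s + 1) = z ^ s * z := by
  rw [Complex.cpow_add _ _ hz, Complex.cpow_one]

theorem cpow_sub_one' {z : ℂ} (hz : z ≠ 0) (s : ℂ) : z ^ (s - 1) = z ^ s / z := by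
  rw [Complex.cpow_sub _ _ hz, Complex.cpow_one]

theorem contDiffOn_ofReal_cpow {E : Type*} [NormedAddCommGroup E] [NormedSpace ℝ E] {φ : E → ℝ}
    {W : Set E} {n : WithTop ℕ∞} (hφ : ContDiffOn ℝ n φ W) (h0 : ∀ x ∈ W, 0 < φ x) (s : ℂ) :
    ContDiffOn ℝ n (fun x => (φ x : ℂ) ^ s) W := by
  have h1 : ContDiffOn ℝ n (fun x => Complex.exp (((Real.log (φ x) : ℝ) : ℂ) * s)) W :=
    ((Complex.ofRealCLM.contDiff.comp_contDiffOn (hφ.log fun x hx => (h0 x hx).ne')).mul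
      contDiffOn_const).cexp
  refine h1.congr fun x hx => ?_
  rw [Complex.cpow_def_of_ne_zero (Complex.ofReal_ne_zero.2 (h0 x hx).ne'),
    Complex.ofReal_log (h0 x hx).le]

theorem continuousOn_ofReal_cpow {X : Type*} [TopologicalSpace X] {φ : X → ℝ} {W : Set X}
    (hφ : ContinuousOn φ W) (h0 : ∀ x ∈ W, 0 < φ x) (s : ℂ) :
    ContinuousOn (fun x => (φ x : ℂ) ^ s) W := fun x hx =>
  (Complex.continuous_ofReal.comp_continuousOn hφ x hx).cpow continuousWithinAt_const
    (Complex.ofReal_mem_slitPlane.2 (h0 x hx))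

/-- The law-of-cosines form, convenient for differentiating in `ξ` and in `θ`. -/
theorem kernelBase_eq (p q : ℝ × ℝ) (θ : ℝ) :
    kernelBase p q θ =
      (p.1 - q.1) ^ 2 + 2 * p.1 * q.1 * (1 - Real.cos θ) + (p.2 - q.2) ^ 2 := by
  have h := Real.cos_sq' (θ / 2)
  have h2 := Real.cos_two_mul (θ / 2)
  rw [mul_div_cancel₀ θ two_ne_zero] at h2
  rw [kernelBase, h2, h]
  ring

theorem dist_sq_le_kernelBase {p q : ℝ × ℝ} (hp : 0 < p.1) (hq : 0 < q.1) (θ : ℝ) :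
    (p.1 - q.1) ^ 2 + (p.2 - q.2) ^ 2 ≤ kernelBase p q θ := by
  have : 0 ≤ 4 * p.1 * q.1 * Real.sin (θ / 2) ^ 2 := by positivity
  rw [kernelBase]
  linarith

theorem kernelBase_nonneg {p q : ℝ × ℝ} (hp : 0 < p.1) (hq : 0 < q.1) (θ : ℝ) :
    0 ≤ kernelBase p q θ :=
  le_trans (by positivity) (dist_sq_le_kernelBase hp hq θ)

theorem dist_sq_pos {p q : ℝ × ℝ} (hne : q ≠ p) : 0 < (p.1 - q.1) ^ 2 + (p.2 - q.2) ^ 2 := by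
  by_contra h
  push Not at h
  refine hne (Prod.ext ?_ ?_) <;> nlinarith [sq_nonneg (p.1 - q.1), sq_nonneg (p.2 - q.2)]

/-- The power `(D + h)ˢ` of the regularized kernel base. -/
noncomputable def basePow (p : ℝ × ℝ) (s : ℂ) (h θ : ℝ) (q : ℝ × ℝ) : ℂ :=
  ((kernelBase p q θ + h : ℝ) : ℂ) ^ s

/-- The integrand of the fundamental solution, regularized, without the power of `sin θ`. -/
noncomputable def kern (p : ℝ × ℝ) (μ α : ℂ) (h θ : ℝ) (q : ℝ × ℝ) : ℂ :=
  (q.1 : ℂ) ^ α * basePow p (-μ / 2) h θ q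

/-- `∂_ξ` of the kernel base. -/
noncomputable def base₁ (p : ℝ × ℝ) (θ : ℝ) (q : ℝ × ℝ) : ℝ := 2 * (q.1 - p.1 * Real.cos θ)

/-- `∂_η` of the kernel base. -/
def base₂ (p : ℝ × ℝ) (q : ℝ × ℝ) : ℝ := 2 * (q.2 - p.2)

/-- `∂_ξ` of `kern`. -/
noncomputable def kern₁ (p : ℝ × ℝ) (μ α : ℂ) (h θ : ℝ) (q : ℝ × ℝ) : ℂ :=
  α * (q.1 : ℂ) ^ (α - 1) * basePow p (-μ / 2) h θ q +
    (q.1 : ℂ) ^ α * (-μ / 2 * basePow p (-μ / 2 - 1) h θ q * (base₁ p θ q : ℂ))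

/-- `∂_η` of `kern`. -/
noncomputable def kern₂ (p : ℝ × ℝ) (μ α : ℂ) (h θ : ℝ) (q : ℝ × ℝ) : ℂ :=
  (q.1 : ℂ) ^ α * (-μ / 2 * basePow p (-μ / 2 - 1) h θ q * (base₂ p q : ℂ))

section deriv

variable {p q : ℝ × ℝ} {h θ : ℝ}

theorem hasDerivAt_fst_cpow (hq : 0 < q.1) (α : ℂ) :
    HasDerivAt (fun t : ℝ => ((t, q.2).1 : ℂ) ^ α) (α * (q.1 : ℂ) ^ (α - 1)) q.1 := by
  simpa using hasDerivAt_ofReal_cpow (hasDerivAt_id q.1) hq α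

theorem hasDerivAt_basePow₁ (h0 : 0 < kernelBase p q θ + h) (s : ℂ) :
    HasDerivAt (fun t : ℝ => basePow p s h θ (t, q.2))
      (s * basePow p (s - 1) h θ q * (base₁ p θ q : ℂ)) q.1 := by
  have hb : HasDerivAt (fun t : ℝ => kernelBase p (t, q.2) θ + h) (base₁ p θ q) q.1 := by
    simp only [kernelBase_eq, base₁]
    have h1 := ((((hasDerivAt_id q.1).const_sub p.1).pow 2).add
      (((hasDerivAt_id q.1).const_mul (2 * p.1)).mul_const (1 - Real.cos θ))).add_const
      ((p.2 - q.2) ^ 2) |>.add_const h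
    refine h1.congr_deriv ?_
    simp
    ring
  exact hasDerivAt_ofReal_cpow hb h0 s

theorem hasDerivAt_basePow₂ (h0 : 0 < kernelBase p q θ + h) (s : ℂ) :
    HasDerivAt (fun t : ℝ => basePow p s h θ (q.1, t))
      (s * basePow p (s - 1) h θ q * (base₂ p q : ℂ)) q.2 := by
  have hb : HasDerivAt (fun t : ℝ => kernelBase p (q.1, t) θ + h) (base₂ p q) q.2 := by
    simp only [kernelBase_eq, base₂]
    have h1 := (((hasDerivAt_id q.2).const_sub p.2).pow 2).const_add
      ((p.1 - q.1) ^ 2 + 2 * p.1 * q.1 * (1 - Real.cos θ)) |>.add_const h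
    refine h1.congr_deriv ?_
    simp
    ring
  exact hasDerivAt_ofReal_cpow hb h0 s

theorem hasDerivAt_base₁ :
    HasDerivAt (fun t : ℝ => (base₁ p θ (t, q.2) : ℂ)) 2 q.1 := by
  have h1 : HasDerivAt (fun t : ℝ => base₁ p θ (t, q.2)) (2 * 1) q.1 :=
    ((hasDerivAt_id q.1).sub_const _).const_mul 2
  simpa using h1.ofReal_comp

theorem hasDerivAt_base₂ :
    HasDerivAt (fun t : ℝ => (base₂ p (q.1, t) : ℂ)) 2 q.2 := by
  have h1 : HasDerivAt (fun t : ℝ => base₂ p (q.1, t)) (2 * 1) q.2 :=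
    ((hasDerivAt_id q.2).sub_const _).const_mul 2
  simpa using h1.ofReal_comp

theorem hasDerivAt_kern₁ (hq : 0 < q.1) (h0 : 0 < kernelBase p q θ + h) (μ α : ℂ) :
    HasDerivAt (fun t : ℝ => kern p μ α h θ (t, q.2)) (kern₁ p μ α h θ q) q.1 :=
  (hasDerivAt_fst_cpow hq α).mul (hasDerivAt_basePow₁ h0 _)

theorem hasDerivAt_kern₂ (h0 : 0 < kernelBase p q θ + h) (μ α : ℂ) :
    HasDerivAt (fun t : ℝ => kern p μ α h θ (q.1, t)) (kern₂ p μ α h θ q) q.2 :=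
  (hasDerivAt_basePow₂ h0 (-μ / 2)).const_mul ((q.1 : ℂ) ^ α)

end deriv

theorem contDiff_kernelBase {n : WithTop ℕ∞} (p : ℝ × ℝ) (θ : ℝ) :
    ContDiff ℝ n fun q => kernelBase p q θ := by
  unfold kernelBase; fun_prop

theorem contDiffOn_kern {p : ℝ × ℝ} (hp : 0 < p.1) {h : ℝ} (hh : 0 < h) (μ α : ℂ) (θ : ℝ) :
    ContDiffOn ℝ 2 (kern p μ α h θ) rightHalfPlane :=
  (contDiffOn_ofReal_cpow contDiff_fst.contDiffOn (fun _ hx => hx) α).mul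
    (contDiffOn_ofReal_cpow ((contDiff_kernelBase p θ).add contDiff_const).contDiffOn
      (fun _ hx => add_pos_of_nonneg_of_pos (kernelBase_nonneg hp hx θ) hh) _)

/-- The coefficient of ξ^(α-2) is (α - 1)(α - m) = 0, the mixed first-order term carries the factor
2α - m = μ, and |∇D|² = 4 (D - x² sin² θ); then the terms in ξ^α (D + h)^(-μ/2-1) cancel. Times the
weight sin^(μ-1) θ, the first group on the right is a θ-derivative (see
`integral_sinPow_mul_eq_zero`); the last term becomes the point mass. -/
theorem weinsteinAdj_kern {p q : ℝ × ℝ} (hp : 0 < p.1) (hq : 0 < q.1) {h : ℝ} (hh : 0 < h)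
    {m μ α : ℂ} (hα : (α - 1) * (α - m) = 0) (hμ : μ = 2 * α - m) (θ : ℝ) :
    weinsteinAdj m (kern p μ α h θ) q =
      μ * p.1 * (q.1 : ℂ) ^ (α - 1) * (basePow p (-μ / 2 - 2) h θ q *
        (μ * Real.cos θ * ((kernelBase p q θ + h : ℝ) : ℂ) -
          (μ + 2) * p.1 * q.1 * (Real.sin θ : ℂ) ^ 2)) -
      μ * (μ + 2) * h * (q.1 : ℂ) ^ α * basePow p (-μ / 2 - 2) h θ q := by
  have hpos : ∀ z : ℝ × ℝ, z ∈ rightHalfPlane → 0 < kernelBase p z θ + h := fun z hz =>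
    add_pos_of_nonneg_of_pos (kernelBase_nonneg hp hz θ) hh
  have hb := hpos q hq
  have hqW : q ∈ rightHalfPlane := hq
  have hx := ofReal_fst_ne_zero hqW
  have hbc : ((kernelBase p q θ + h : ℝ) : ℂ) ≠ 0 := Complex.ofReal_ne_zero.2 hb.ne'
  have k1 : EqOn (pd₁ (kern p μ α h θ)) (kern₁ p μ α h θ) rightHalfPlane := fun z hz =>
    (hasDerivAt_kern₁ hz (hpos z hz) μ α).deriv
  have k2 : EqOn (pd₂ (kern p μ α h θ)) (kern₂ p μ α h θ) rightHalfPlane := fun z hz =>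
    (hasDerivAt_kern₂ (hpos z hz) μ α).deriv
  have dx : HasDerivAt (fun t : ℝ => (t : ℂ)) 1 q.1 := Complex.ofRealCLM.hasDerivAt
  have e0 : pd₁ (fun z => kern p μ α h θ z / (z.1 : ℂ)) q =
      (kern₁ p μ α h θ q * (q.1 : ℂ) - kern p μ α h θ q * 1) / (q.1 : ℂ) ^ 2 :=
    ((hasDerivAt_kern₁ hq hb μ α).div dx hx).deriv
  have e1 : pd₁ (kern₁ p μ α h θ) q = _ :=
    ((((hasDerivAt_fst_cpow hq (α - 1)).const_mul α).mul (hasDerivAt_basePow₁ hb (-μ / 2))).add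
      ((hasDerivAt_fst_cpow hq α).mul (((hasDerivAt_basePow₁ hb (-μ / 2 - 1)).const_mul
        (-μ / 2)).mul hasDerivAt_base₁))).deriv
  have e2 : pd₂ (kern₂ p μ α h θ) q = _ :=
    ((((hasDerivAt_basePow₂ hb (-μ / 2 - 1)).const_mul
        (-μ / 2)).mul hasDerivAt_base₂).const_mul ((q.1 : ℂ) ^ α)).deriv
  rw [weinsteinAdj, pd₁_congr (EqOn.eventuallyEq_of_isOpen isOpen_rightHalfPlane k1 hqW),
    pd₂_congr (EqOn.eventuallyEq_of_isOpen isOpen_rightHalfPlane k2 hqW), e0, e1, e2]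
  have hP1 : basePow p (-μ / 2 - 1) h θ q =
      basePow p (-μ / 2 - 2) h θ q * ((kernelBase p q θ + h : ℝ) : ℂ) := by
    unfold basePow
    rw [← cpow_add_one' hbc]
    congr 1
    ring
  have hP0 : basePow p (-μ / 2) h θ q = basePow p (-μ / 2 - 2) h θ q *
      ((kernelBase p q θ + h : ℝ) : ℂ) * ((kernelBase p q θ + h : ℝ) : ℂ) := by
    rw [← hP1]
    unfold basePow
    rw [← cpow_add_one' hbc]
    congr 1
    ring
  have hP2 : basePow p (-μ / 2 - 1 - 1) h θ q = basePow p (-μ / 2 - 2) h θ q := by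
    congr 1; ring
  have hX1 : (q.1 : ℂ) ^ (α - 1) = (q.1 : ℂ) ^ α / q.1 := cpow_sub_one' hx _
  have hX2 : (q.1 : ℂ) ^ (α - 1 - 1) = (q.1 : ℂ) ^ α / q.1 / q.1 := by
    rw [cpow_sub_one' hx, hX1]
  have hs : (Real.sin θ : ℂ) ^ 2 = 1 - (Real.cos θ : ℂ) ^ 2 := by
    have := Real.sin_sq θ
    exact_mod_cast this
  have hD : ((kernelBase p q θ + h : ℝ) : ℂ) = ((p.1 : ℂ) - q.1) ^ 2 +
      2 * p.1 * q.1 * (1 - Real.cos θ) + ((p.2 : ℂ) - q.2) ^ 2 + h := by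
    rw [kernelBase_eq]; push_cast; ring
  simp only [Pi.mul_apply, kern, kern₁, hP0, hP1, hP2, hX1, hX2, hs, hD, base₁, base₂]
  push_cast
  subst hμ
  generalize (q.1 : ℂ) ^ α = X
  generalize basePow p (-(2 * α - m) / 2 - 2) h θ q = Q
  generalize hbb : ((p.1 : ℂ) - q.1) ^ 2 + 2 * p.1 * q.1 * (1 - Complex.cos θ) +
    ((p.2 : ℂ) - q.2) ^ 2 + h = b
  have hη : ((p.2 : ℂ) - q.2) ^ 2 = b - h - ((p.1 : ℂ) - q.1) ^ 2 -
      2 * p.1 * q.1 * (1 - Complex.cos θ) := by rw [← hbb]; ring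
  generalize Complex.cos θ = c at *
  generalize (q.1 : ℂ) = ξ at *
  field_simp
  -- The relation `hα` removes the ξ^(α-2) term; `hη` eliminates (y - η)² in favour of the base.
  linear_combination X * Q * b ^ 2 * hα +
    X * ξ ^ 2 * Q * (2 * α - m) * (2 * α - m + 2) * hη

/-! ### The weight in θ: Fubini and dominated convergence. -/

/-- The weight `sin^(μ - 1) θ`. -/
noncomputable def sinPow (μ : ℂ) (θ : ℝ) : ℂ := (Real.sin θ : ℂ) ^ (μ - 1)

/-- The regularized fundamental solution, up to a constant factor. -/
noncomputable def regSol (p : ℝ × ℝ) (μ α : ℂ) (h : ℝ) (q : ℝ × ℝ) : ℂ :=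
  ∫ θ in Ioo 0 Real.pi, sinPow μ θ * kern p μ α h θ q

theorem sin_pos_of_mem {θ : ℝ} (hθ : θ ∈ Ioo 0 Real.pi) : 0 < Real.sin θ :=
  Real.sin_pos_of_pos_of_lt_pi hθ.1 hθ.2

theorem norm_sinPow {μ : ℂ} {θ : ℝ} (hθ : θ ∈ Ioo 0 Real.pi) :
    ‖sinPow μ θ‖ = Real.sin θ ^ (μ.re - 1) := by
  rw [sinPow, Complex.norm_cpow_eq_rpow_re_of_pos (sin_pos_of_mem hθ), Complex.sub_re,
    Complex.one_re]

theorem norm_sinPow_le_one {μ : ℂ} (hμ : 1 ≤ μ.re) {θ : ℝ} (hθ : θ ∈ Ioo 0 Real.pi) :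
    ‖sinPow μ θ‖ ≤ 1 := by
  rw [norm_sinPow hθ]
  exact Real.rpow_le_one (sin_pos_of_mem hθ).le (Real.sin_le_one θ) (by linarith)

theorem continuousOn_sinPow (μ : ℂ) : ContinuousOn (sinPow μ) (Ioo 0 Real.pi) :=
  continuousOn_ofReal_cpow Real.continuous_sin.continuousOn (fun _ hθ => sin_pos_of_mem hθ) _

theorem integrableOn_sinPow {μ : ℂ} (hμ : 1 ≤ μ.re) : IntegrableOn (sinPow μ) (Ioo 0 Real.pi) :=
  integrableOn_of_forall_norm_le (C := 1) measurableSet_Ioo (by simp)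
    ((continuousOn_sinPow μ).aestronglyMeasurable measurableSet_Ioo)
    fun _ hθ => norm_sinPow_le_one hμ hθ

section Fubini

variable {X : Type*} [TopologicalSpace X] [MeasurableSpace X] [BorelSpace X] {ν : Measure X}
  [SFinite ν] {s K : Set X} {μ : ℂ} {g : X → ℂ}

theorem integrable_mul_sinPow_mul (hμ : 1 ≤ μ.re) (hs : MeasurableSet s) (hsK : s ⊆ K)
    (hg : IntegrableOn g s ν) {F : X × ℝ → ℂ} {C : ℝ}
    (hF : ContinuousOn F (K ×ˢ Icc 0 Real.pi)) (hC : ∀ z ∈ K ×ˢ Icc 0 Real.pi, ‖F z‖ ≤ C) :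
    Integrable (fun z : X × ℝ => g z.1 * (sinPow μ z.2 * F z))
      ((ν.restrict s).prod (volume.restrict (Ioo 0 Real.pi))) := by
  have hsub : s ×ˢ Ioo 0 Real.pi ⊆ K ×ˢ Icc 0 Real.pi := prod_mono hsK Ioo_subset_Icc_self
  have hm : MeasurableSet (s ×ˢ Ioo 0 Real.pi) := hs.prod measurableSet_Ioo
  have h1 : Integrable (fun z : X × ℝ => g z.1 * sinPow μ z.2)
      ((ν.restrict s).prod (volume.restrict (Ioo 0 Real.pi))) :=
    Integrable.mul_prod hg (integrableOn_sinPow hμ)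
  have h2 := h1.mul_bdd (g := F) (c := C) ?_ ?_
  · simpa only [mul_assoc] using h2
  · rw [Measure.prod_restrict]
    exact (hF.mono hsub).aestronglyMeasurable hm
  · rw [Measure.prod_restrict]
    exact (ae_restrict_mem hm).mono fun z hz => hC z (hsub hz)

/-- Used over `Ω` and over the arcs alike: `F` is bounded by compactness, and `g` and the weight are
integrable. -/
theorem integral_sinPow_swap (hμ : 1 ≤ μ.re) (hs : MeasurableSet s) (hK : IsCompact K)
    (hsK : s ⊆ K) (hg : IntegrableOn g s ν) {F : X × ℝ → ℂ}
    (hF : ContinuousOn F (K ×ˢ Icc 0 Real.pi)) :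
    IntegrableOn (fun θ => ∫ x in s, g x * (sinPow μ θ * F (x, θ)) ∂ν) (Ioo 0 Real.pi) ∧
    IntegrableOn (fun x => g x * ∫ θ in Ioo 0 Real.pi, sinPow μ θ * F (x, θ)) s ν ∧
    ∫ θ in Ioo 0 Real.pi, ∫ x in s, g x * (sinPow μ θ * F (x, θ)) ∂ν =
      ∫ x in s, g x * (∫ θ in Ioo 0 Real.pi, sinPow μ θ * F (x, θ)) ∂ν := by
  obtain ⟨C, hC⟩ := (hK.prod isCompact_Icc).exists_bound_of_continuousOn hF
  have hint := integrable_mul_sinPow_mul hμ hs hsK hg hF hC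
  refine ⟨hint.integral_prod_right, ?_, ?_⟩
  · have := hint.integral_prod_left
    simp only [integral_const_mul] at this
    exact this
  · rw [← integral_prod_symm _ hint, integral_prod _ hint]
    simp only [integral_const_mul]

/-- Continuity of `F` is required up to `h = 0`, so this serves the boundary integrals, which stay
away from the singularity, and not the integral over `Ω`. -/
theorem tendsto_integral_sinPow (hμ : 1 ≤ μ.re) (hs : MeasurableSet s) (hK : IsCompact K)
    (hsK : s ⊆ K) (hg : IntegrableOn g s ν) {F : ℝ → X → ℝ → ℂ}
    (hF : ContinuousOn (fun z : ℝ × X × ℝ => F z.1 z.2.1 z.2.2)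
      (Icc 0 1 ×ˢ K ×ˢ Icc 0 Real.pi)) :
    Tendsto (fun h => ∫ x in s, g x * (∫ θ in Ioo 0 Real.pi, sinPow μ θ * F h x θ) ∂ν) (𝓝[>] 0)
      (𝓝 (∫ x in s, g x * (∫ θ in Ioo 0 Real.pi, sinPow μ θ * F 0 x θ) ∂ν)) := by
  obtain ⟨C, hC⟩ := (isCompact_Icc.prod (hK.prod isCompact_Icc)).exists_bound_of_continuousOn hF
  have hsl : ∀ h ∈ Icc (0 : ℝ) 1,
      ContinuousOn (fun z : X × ℝ => F h z.1 z.2) (K ×ˢ Icc 0 Real.pi) := fun h hh =>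
    hF.comp (f := fun z : X × ℝ => (h, z)) (Continuous.continuousOn (by fun_prop))
      fun z hz => ⟨hh, hz⟩
  have hint : ∀ h ∈ Icc (0 : ℝ) 1, Integrable
      (fun z : X × ℝ => g z.1 * (sinPow μ z.2 * F h z.1 z.2))
      ((ν.restrict s).prod (volume.restrict (Ioo 0 Real.pi))) := fun h hh =>
    integrable_mul_sinPow_mul hμ hs hsK hg (hsl h hh) fun z hz => hC (h, z) ⟨hh, hz⟩
  have heq : ∀ h ∈ Icc (0 : ℝ) 1,
      ∫ z, g z.1 * (sinPow μ z.2 * F h z.1 z.2) ∂((ν.restrict s).prod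
        (volume.restrict (Ioo 0 Real.pi))) =
      ∫ x in s, g x * (∫ θ in Ioo 0 Real.pi, sinPow μ θ * F h x θ) ∂ν := fun h hh => by
    rw [integral_prod _ (hint h hh)]
    simp only [integral_const_mul]
  have hev : ∀ᶠ h in 𝓝[>] (0 : ℝ), h ∈ Icc (0 : ℝ) 1 := by
    filter_upwards [Ioc_mem_nhdsGT (zero_lt_one' ℝ)] with h hh using ⟨hh.1.le, hh.2⟩
  rw [← heq 0 ⟨le_rfl, zero_le_one⟩]
  refine Tendsto.congr' (hev.mono heq) ?_
  have hm : MeasurableSet (s ×ˢ Ioo 0 Real.pi) := hs.prod measurableSet_Ioo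
  have hgS : Integrable (fun z : X × ℝ => g z.1 * sinPow μ z.2)
      ((ν.restrict s).prod (volume.restrict (Ioo 0 Real.pi))) :=
    Integrable.mul_prod hg (integrableOn_sinPow hμ)
  refine tendsto_integral_filter_of_dominated_convergence
    (fun z => ‖g z.1 * sinPow μ z.2‖ * C) (hev.mono fun h hh => (hint h hh).aestronglyMeasurable)
    (hev.mono fun h hh => ?_) (hgS.norm.mul_const C) ?_
  · rw [Measure.prod_restrict]
    refine (ae_restrict_mem hm).mono fun z hz => ?_
    rw [← mul_assoc, norm_mul]
    exact mul_le_mul_of_nonneg_left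
      (hC (h, z) ⟨hh, hsK hz.1, Ioo_subset_Icc_self hz.2⟩) (norm_nonneg _)
  · rw [Measure.prod_restrict]
    refine (ae_restrict_mem hm).mono fun z hz => ?_
    have hc : ContinuousWithinAt (fun h => F h z.1 z.2) (Icc 0 1) 0 := by
      have h1 : ContinuousOn (fun h : ℝ => F h z.1 z.2) (Icc 0 1) :=
        hF.comp (f := fun h : ℝ => (h, z)) (Continuous.continuousOn (by fun_prop))
          fun h hh => ⟨hh, hsK hz.1, Ioo_subset_Icc_self hz.2⟩
      exact h1 0 ⟨le_rfl, zero_le_one⟩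
    have h2 : Tendsto (fun h => F h z.1 z.2) (𝓝[>] 0) (𝓝 (F 0 z.1 z.2)) :=
      hc.tendsto.mono_left (nhdsWithin_le_of_mem hev)
    exact (h2.const_mul _).const_mul _

end Fubini

/-! ### Joint continuity of the kernels; the adjoint equation after integration in θ. -/

theorem continuous_kernelBase (p : ℝ × ℝ) :
    Continuous fun z : ℝ × (ℝ × ℝ) × ℝ => kernelBase p z.2.1 z.2.2 + z.1 := by
  unfold kernelBase; fun_prop

theorem continuousOn_basePow (p : ℝ × ℝ) (s : ℂ) : ContinuousOn
    (fun z : ℝ × (ℝ × ℝ) × ℝ => basePow p s z.1 z.2.2 z.2.1)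
    {z | 0 < kernelBase p z.2.1 z.2.2 + z.1} :=
  continuousOn_ofReal_cpow (continuous_kernelBase p).continuousOn (fun _ hz => hz) s

theorem continuousOn_fst_cpow (α : ℂ) :
    ContinuousOn (fun q : ℝ × ℝ => (q.1 : ℂ) ^ α) rightHalfPlane :=
  continuousOn_ofReal_cpow continuous_fst.continuousOn (fun _ hq => hq) α

/-- The points where the regularized kernels are smooth. -/
def kernDomain (p : ℝ × ℝ) : Set (ℝ × (ℝ × ℝ) × ℝ) :=
  {z | z.2.1 ∈ rightHalfPlane ∧ 0 < kernelBase p z.2.1 z.2.2 + z.1}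

theorem continuousOn_kern (p : ℝ × ℝ) (μ α : ℂ) : ContinuousOn
    (fun z : ℝ × (ℝ × ℝ) × ℝ => kern p μ α z.1 z.2.2 z.2.1) (kernDomain p) :=
  ((continuousOn_fst_cpow α).comp (by fun_prop) fun _ hz => hz.1).mul
    ((continuousOn_basePow p _).mono fun _ hz => hz.2)

theorem continuousOn_kern₁ (p : ℝ × ℝ) (μ α : ℂ) : ContinuousOn
    (fun z : ℝ × (ℝ × ℝ) × ℝ => kern₁ p μ α z.1 z.2.2 z.2.1) (kernDomain p) := by
  have h1 : ∀ α : ℂ, ContinuousOn (fun z : ℝ × (ℝ × ℝ) × ℝ => (z.2.1.1 : ℂ) ^ α) (kernDomain p) :=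
    fun α => (continuousOn_fst_cpow α).comp (f := fun z : ℝ × (ℝ × ℝ) × ℝ => z.2.1)
      (by fun_prop) fun _ hz => hz.1
  have h2 : ∀ s : ℂ, ContinuousOn
      (fun z : ℝ × (ℝ × ℝ) × ℝ => basePow p s z.1 z.2.2 z.2.1) (kernDomain p) :=
    fun s => (continuousOn_basePow p s).mono fun _ hz => hz.2
  have h3 : Continuous fun z : ℝ × (ℝ × ℝ) × ℝ => (base₁ p z.2.2 z.2.1 : ℂ) := by
    unfold base₁; fun_prop
  exact ((continuousOn_const.mul (h1 _)).mul (h2 _)).add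
    ((h1 _).mul ((continuousOn_const.mul (h2 _)).mul h3.continuousOn))

theorem continuousOn_kern₂ (p : ℝ × ℝ) (μ α : ℂ) : ContinuousOn
    (fun z : ℝ × (ℝ × ℝ) × ℝ => kern₂ p μ α z.1 z.2.2 z.2.1) (kernDomain p) := by
  have h1 : ContinuousOn (fun z : ℝ × (ℝ × ℝ) × ℝ => (z.2.1.1 : ℂ) ^ α) (kernDomain p) :=
    (continuousOn_fst_cpow α).comp (f := fun z : ℝ × (ℝ × ℝ) × ℝ => z.2.1)
      (by fun_prop) fun _ hz => hz.1
  have h2 : ContinuousOn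
      (fun z : ℝ × (ℝ × ℝ) × ℝ => basePow p (-μ / 2 - 1) z.1 z.2.2 z.2.1) (kernDomain p) :=
    (continuousOn_basePow p _).mono fun _ hz => hz.2
  have h3 : Continuous fun z : ℝ × (ℝ × ℝ) × ℝ => (base₂ p z.2.1 : ℂ) := by
    unfold base₂; fun_prop
  exact h1.mul ((continuousOn_const.mul h2).mul h3.continuousOn)

theorem mem_kernDomain_of_pos {p q : ℝ × ℝ} (hp : 0 < p.1) (hq : 0 < q.1) {h : ℝ} (hh : 0 < h)
    (θ : ℝ) : (h, q, θ) ∈ kernDomain p :=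
  ⟨hq, add_pos_of_nonneg_of_pos (kernelBase_nonneg hp hq θ) hh⟩

theorem mem_kernDomain_of_ne {p q : ℝ × ℝ} (hp : 0 < p.1) (hq : 0 < q.1) (hne : q ≠ p) {h : ℝ}
    (hh : 0 ≤ h) (θ : ℝ) : (h, q, θ) ∈ kernDomain p :=
  ⟨hq, add_pos_of_pos_of_nonneg ((dist_sq_pos hne).trans_le (dist_sq_le_kernelBase hp hq θ)) hh⟩

/-- The integrand is the θ-derivative of sin^μ θ (D + h)^(-μ/2-1), a function that vanishes at 0 and
π because Re μ > 0. -/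
theorem integral_sinPow_mul_eq_zero {p q : ℝ × ℝ} (hp : 0 < p.1) (hq : 0 < q.1) {h : ℝ}
    (hh : 0 < h) {μ : ℂ} (hμ : 1 ≤ μ.re) :
    ∫ θ in Ioo 0 Real.pi, sinPow μ θ * (basePow p (-μ / 2 - 2) h θ q *
        (μ * Real.cos θ * ((kernelBase p q θ + h : ℝ) : ℂ) -
          (μ + 2) * p.1 * q.1 * (Real.sin θ : ℂ) ^ 2)) = 0 := by
  have hpos : ∀ θ, 0 < kernelBase p q θ + h := fun θ =>
    add_pos_of_nonneg_of_pos (kernelBase_nonneg hp hq θ) hh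
  have hcB : ∀ s : ℂ, Continuous fun θ : ℝ => basePow p s h θ q := fun s => by
    rw [← continuousOn_univ]
    exact (continuousOn_basePow p s).comp (f := fun θ : ℝ => (h, q, θ))
      (Continuous.continuousOn (by fun_prop)) fun θ _ => hpos θ
  have hcD : Continuous fun θ : ℝ => kernelBase p q θ := by unfold kernelBase; fun_prop
  set f : ℝ → ℂ := fun θ => (Real.sin θ : ℂ) ^ μ * basePow p (-μ / 2 - 1) h θ q with hf
  have hμ0 : μ ≠ 0 := by rintro rfl; simp at hμ; linarith
  have hftc := intervalIntegral.integral_eq_sub_of_hasDerivAt_of_le (f := f)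
    (f' := fun θ => sinPow μ θ * (basePow p (-μ / 2 - 2) h θ q *
        (μ * Real.cos θ * ((kernelBase p q θ + h : ℝ) : ℂ) -
          (μ + 2) * p.1 * q.1 * (Real.sin θ : ℂ) ^ 2))) Real.pi_pos.le ?_ ?_ ?_
  · rw [intervalIntegral.integral_of_le Real.pi_pos.le, integral_Ioc_eq_integral_Ioo] at hftc
    rw [hftc]
    simp [hf, Complex.zero_cpow hμ0]
  · exact (((Complex.continuous_ofReal_cpow_const (by linarith)).comp Real.continuous_sin).mul
      (hcB _)).continuousOn
  · intro θ hθ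
    have hs := sin_pos_of_mem hθ
    have hsc : (Real.sin θ : ℂ) ≠ 0 := Complex.ofReal_ne_zero.2 hs.ne'
    have hbc : ((kernelBase p q θ + h : ℝ) : ℂ) ≠ 0 := Complex.ofReal_ne_zero.2 (hpos θ).ne'
    have hb : HasDerivAt (fun θ : ℝ => kernelBase p q θ + h) (2 * p.1 * q.1 * Real.sin θ) θ := by
      simp only [kernelBase_eq]
      have h1 := (((Real.hasDerivAt_cos θ).const_sub 1).const_mul (2 * p.1 * q.1)).const_add
        ((p.1 - q.1) ^ 2) |>.add_const ((p.2 - q.2) ^ 2) |>.add_const h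
      refine h1.congr_deriv ?_
      ring
    refine ((hasDerivAt_ofReal_cpow (Real.hasDerivAt_sin θ) hs μ).mul
      (hasDerivAt_ofReal_cpow hb (hpos θ) (-μ / 2 - 1))).congr_deriv ?_
    have e1 : (Real.sin θ : ℂ) ^ μ = sinPow μ θ * Real.sin θ := by
      rw [sinPow, ← cpow_add_one' hsc]; ring_nf
    have e2 : ((kernelBase p q θ + h : ℝ) : ℂ) ^ (-μ / 2 - 1) =
        basePow p (-μ / 2 - 2) h θ q * ((kernelBase p q θ + h : ℝ) : ℂ) := by
      rw [basePow, ← cpow_add_one' hbc]; ring_nf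
    have e3 : ((kernelBase p q θ + h : ℝ) : ℂ) ^ (-μ / 2 - 1 - 1) =
        basePow p (-μ / 2 - 2) h θ q := by
      rw [basePow]; ring_nf
    rw [e1, e2, e3]
    change μ * sinPow μ θ * _ * _ + _ = _
    push_cast
    ring
  · rw [intervalIntegrable_iff_integrableOn_Ioo_of_le Real.pi_pos.le]
    refine (integrableOn_sinPow hμ).mul_continuousOn_of_subset ?_ measurableSet_Ioo isCompact_Icc
      Ioo_subset_Icc_self
    have := hcB (-μ / 2 - 2)
    exact Continuous.continuousOn (by fun_prop)

/-- Of `weinsteinAdj_kern` only the term with the factor `h` outlives the integration in θ. -/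
theorem integral_sinPow_mul_weinsteinAdj {p q : ℝ × ℝ} (hp : 0 < p.1) (hq : 0 < q.1) {h : ℝ}
    (hh : 0 < h) {m μ α : ℂ} (hμ1 : 1 ≤ μ.re) (hα : (α - 1) * (α - m) = 0) (hμ : μ = 2 * α - m) :
    ∫ θ in Ioo 0 Real.pi, sinPow μ θ * weinsteinAdj m (kern p μ α h θ) q =
      -(μ * (μ + 2) * (q.1 : ℂ) ^ α *
        ∫ θ in Ioo 0 Real.pi, h * (sinPow μ θ * basePow p (-μ / 2 - 2) h θ q)) := by
  have hpos : ∀ θ, 0 < kernelBase p q θ + h := fun θ =>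
    add_pos_of_nonneg_of_pos (kernelBase_nonneg hp hq θ) hh
  have hcB : ∀ s : ℂ, Continuous fun θ : ℝ => basePow p s h θ q := fun s => by
    rw [← continuousOn_univ]
    exact (continuousOn_basePow p s).comp (f := fun θ : ℝ => (h, q, θ))
      (Continuous.continuousOn (by fun_prop)) fun θ _ => hpos θ
  have hcD : Continuous fun θ : ℝ => kernelBase p q θ := by unfold kernelBase; fun_prop
  have hB := hcB (-μ / 2 - 2)
  have hI : ∀ F : ℝ → ℂ, Continuous F →
      IntegrableOn (fun θ => sinPow μ θ * F θ) (Ioo 0 Real.pi) := fun F hF =>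
    (integrableOn_sinPow hμ1).mul_continuousOn_of_subset hF.continuousOn measurableSet_Ioo
      isCompact_Icc Ioo_subset_Icc_self
  have hz := integral_sinPow_mul_eq_zero hp hq hh hμ1
  have hpt : ∀ θ, sinPow μ θ * weinsteinAdj m (kern p μ α h θ) q =
      μ * p.1 * (q.1 : ℂ) ^ (α - 1) * (sinPow μ θ * (basePow p (-μ / 2 - 2) h θ q *
        (μ * Real.cos θ * ((kernelBase p q θ + h : ℝ) : ℂ) -
          (μ + 2) * p.1 * q.1 * (Real.sin θ : ℂ) ^ 2))) -
      μ * (μ + 2) * (q.1 : ℂ) ^ α * (h * (sinPow μ θ * basePow p (-μ / 2 - 2) h θ q)) := by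
    intro θ
    rw [weinsteinAdj_kern hp hq hh hα hμ]
    ring
  simp only [hpt]
  rw [integral_sub, integral_const_mul, hz, integral_const_mul, mul_zero, zero_sub]
  · exact (hI _ (by fun_prop)).const_mul _
  · exact ((hI _ hB).const_mul _).const_mul _

/-! ### The basic power bound and the mass of the limit kernel. -/

/-- From S ≤ (b/κ)^(1/2), the weight S^(a-1) absorbs (a-1)/2 powers of the base and leaves the
exponent -c - 1/2, which is free of `a`. The cases c = 0, c = Re σ and c = 2 give the integrable
majorants of the singular and of the rescaled kernels. -/
theorem rpow_mul_rpow_le {a c κ S τ b W : ℝ} (ha : 1 ≤ a) (hc : 0 ≤ c) (hκ : 0 < κ) (hS : 0 ≤ S)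
    (hSτ : S ≤ τ) (hW : 0 < W) (hWb : κ * W ≤ b) (hτb : κ * τ ^ 2 ≤ b) :
    S ^ (a - 1) * b ^ (-a / 2 - c) ≤ κ⁻¹ ^ ((a - 1) / 2) * κ ^ (-c - 1 / 2) * W ^ (-c - 1 / 2) := by
  have hb : 0 < b := (mul_pos hκ hW).trans_le hWb
  have h1 : S ≤ (κ⁻¹ * b) ^ (1 / 2 : ℝ) := by
    rw [← Real.sqrt_eq_rpow]
    refine Real.le_sqrt_of_sq_le ?_
    rw [inv_mul_eq_div, le_div_iff₀ hκ]
    have : S ^ 2 ≤ τ ^ 2 := by gcongr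
    nlinarith
  have h2 : S ^ (a - 1) ≤ κ⁻¹ ^ ((a - 1) / 2) * b ^ ((a - 1) / 2) := by
    refine (Real.rpow_le_rpow hS h1 (by linarith)).trans (le_of_eq ?_)
    rw [← Real.rpow_mul (by positivity), Real.mul_rpow (by positivity) hb.le]
    congr 2 <;> ring
  calc S ^ (a - 1) * b ^ (-a / 2 - c)
      ≤ κ⁻¹ ^ ((a - 1) / 2) * b ^ ((a - 1) / 2) * b ^ (-a / 2 - c) := by gcongr
    _ = κ⁻¹ ^ ((a - 1) / 2) * b ^ (-c - 1 / 2) := by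
        rw [mul_assoc, ← Real.rpow_add hb]
        congr 2
        ring
    _ ≤ κ⁻¹ ^ ((a - 1) / 2) * (κ * W) ^ (-c - 1 / 2) := by
        gcongr ?_ * ?_
        exact Real.rpow_le_rpow_of_nonpos (by positivity) hWb (by linarith)
    _ = κ⁻¹ ^ ((a - 1) / 2) * κ ^ (-c - 1 / 2) * W ^ (-c - 1 / 2) := by
        rw [Real.mul_rpow hκ.le hW.le, mul_assoc]

theorem integrableOn_Ioi_cpow_mul {x : ℝ} (hx : 0 < x) {μ σ : ℂ} (hμ : 1 ≤ μ.re)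
    (hσ : 0 < σ.re) {A : ℝ} (hA : 0 < A) :
    IntegrableOn (fun t : ℝ => (t : ℂ) ^ (μ - 1) * ((A + x ^ 2 * t ^ 2 : ℝ) : ℂ) ^ (-μ / 2 - σ))
      (Ioi 0) := by
  have hpos : ∀ t : ℝ, 0 < A + x ^ 2 * t ^ 2 := fun t => by positivity
  set κ : ℝ := min A (x ^ 2) with hκ
  have hκ0 : 0 < κ := by positivity
  have hi : Integrable fun t : ℝ => (1 + ‖t‖ ^ 2) ^ (-(2 * σ.re + 1) / 2) :=
    integrable_rpow_neg_one_add_norm_sq (by simp; linarith)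
  refine Integrable.mono' (hi.const_mul
    (κ⁻¹ ^ ((μ.re - 1) / 2) * κ ^ (-σ.re - 1 / 2))).integrableOn ?_ ?_
  · refine ContinuousOn.aestronglyMeasurable ?_ measurableSet_Ioi
    exact (continuousOn_ofReal_cpow continuousOn_id (fun t ht => ht) _).mul
      (continuousOn_ofReal_cpow (Continuous.continuousOn (by fun_prop)) (fun t _ => hpos t) _)
  · filter_upwards [ae_restrict_mem measurableSet_Ioi] with t ht
    have ht : 0 < t := ht
    rw [norm_mul, Complex.norm_cpow_eq_rpow_re_of_pos ht,
      Complex.norm_cpow_eq_rpow_re_of_pos (hpos t)]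
    have e1 : (μ - 1).re = μ.re - 1 := by simp
    have e2 : (-μ / 2 - σ).re = -μ.re / 2 - σ.re := by simp
    have e3 : -(2 * σ.re + 1) / 2 = -σ.re - 1 / 2 := by ring
    have h1 : κ ≤ A := min_le_left _ _
    have h2 : κ ≤ x ^ 2 := min_le_right _ _
    rw [e1, e2, e3]
    refine rpow_mul_rpow_le hμ hσ.le hκ0 ht.le le_rfl (by positivity) ?_ ?_
    · rw [Real.norm_eq_abs, sq_abs]
      nlinarith [sq_nonneg t]
    · nlinarith [sq_nonneg t]

theorem ofReal_sq_cpow {a : ℝ} (ha : 0 < a) (s : ℂ) : ((a ^ 2 : ℝ) : ℂ) ^ s = (a : ℂ) ^ (2 * s) := by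
  rw [Complex.cpow_def_of_ne_zero (Complex.ofReal_ne_zero.2 (pow_pos ha 2).ne'),
    Complex.cpow_def_of_ne_zero (Complex.ofReal_ne_zero.2 ha.ne'),
    ← Complex.ofReal_log (by positivity), ← Complex.ofReal_log ha.le, Real.log_pow]
  push_cast
  ring_nf

/-- A primitive is t^μ (1 + x² t²)^(-μ/2) / μ, which tends to x^(-μ) / μ at infinity. -/
theorem integral_Ioi_cpow_mul {x : ℝ} (hx : 0 < x) {μ : ℂ} (hμ : 1 ≤ μ.re) :
    ∫ t in Ioi (0 : ℝ), (t : ℂ) ^ (μ - 1) * ((1 + x ^ 2 * t ^ 2 : ℝ) : ℂ) ^ (-μ / 2 - 1) =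
      (x : ℂ) ^ (-μ) / μ := by
  have hμ0 : μ ≠ 0 := by rintro rfl; simp at hμ; linarith
  have hpos : ∀ t : ℝ, 0 < 1 + x ^ 2 * t ^ 2 := fun t => by positivity
  set F : ℝ → ℂ := fun t => (t : ℂ) ^ μ * ((1 + x ^ 2 * t ^ 2 : ℝ) : ℂ) ^ (-μ / 2) / μ with hF
  have hcont : ContinuousWithinAt F (Ici 0) 0 := by
    refine Continuous.continuousWithinAt ?_
    have h1 : Continuous fun t : ℝ => ((1 + x ^ 2 * t ^ 2 : ℝ) : ℂ) ^ (-μ / 2) := by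
      rw [← continuousOn_univ]
      exact continuousOn_ofReal_cpow (Continuous.continuousOn (by fun_prop)) (fun t _ => hpos t) _
    exact ((Complex.continuous_ofReal_cpow_const (by linarith)).mul h1).div_const _
  have hderiv : ∀ t ∈ Ioi (0 : ℝ), HasDerivAt F
      ((t : ℂ) ^ (μ - 1) * ((1 + x ^ 2 * t ^ 2 : ℝ) : ℂ) ^ (-μ / 2 - 1)) t := by
    intro t ht
    have ht : 0 < t := ht
    have hb : HasDerivAt (fun t : ℝ => 1 + x ^ 2 * t ^ 2) (x ^ 2 * (2 * t)) t := by
      have := ((hasDerivAt_pow 2 t).const_mul (x ^ 2)).const_add 1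
      refine this.congr_deriv ?_
      simp
    refine (((hasDerivAt_ofReal_cpow (hasDerivAt_id t) ht μ).mul
      (hasDerivAt_ofReal_cpow hb (hpos t) (-μ / 2))).div_const μ).congr_deriv ?_
    have htc : (t : ℂ) ≠ 0 := Complex.ofReal_ne_zero.2 ht.ne'
    have hbc : ((1 + x ^ 2 * t ^ 2 : ℝ) : ℂ) ≠ 0 := Complex.ofReal_ne_zero.2 (hpos t).ne'
    have e1 : (t : ℂ) ^ μ = (t : ℂ) ^ (μ - 1) * t := by rw [← cpow_add_one' htc]; ring_nf
    have e2 : ((1 + x ^ 2 * t ^ 2 : ℝ) : ℂ) ^ (-μ / 2) =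
        ((1 + x ^ 2 * t ^ 2 : ℝ) : ℂ) ^ (-μ / 2 - 1) * ((1 + x ^ 2 * t ^ 2 : ℝ) : ℂ) := by
      rw [← cpow_add_one' hbc]; ring_nf
    simp only [id]
    rw [e1, e2]
    field_simp
    push_cast
    ring
  have hlim : Tendsto F atTop (𝓝 ((x : ℂ) ^ (-μ) / μ)) := by
    have h1 : Tendsto (fun t : ℝ => (t⁻¹) ^ 2 + x ^ 2) atTop (𝓝 (x ^ 2)) := by
      simpa using (tendsto_inv_atTop_zero.pow 2).add_const (x ^ 2)
    have h2 : Tendsto (fun t : ℝ => (((t⁻¹) ^ 2 + x ^ 2 : ℝ) : ℂ) ^ (-μ / 2) / μ) atTop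
        (𝓝 (((x ^ 2 : ℝ) : ℂ) ^ (-μ / 2) / μ)) := by
      refine Tendsto.div_const ?_ μ
      have hc : ContinuousAt (fun z : ℂ => z ^ (-μ / 2)) ((x ^ 2 : ℝ) : ℂ) :=
        continuousAt_id.cpow continuousAt_const (Complex.ofReal_mem_slitPlane.2 (by positivity))
      exact hc.tendsto.comp ((Complex.continuous_ofReal.tendsto _).comp h1)
    rw [ofReal_sq_cpow hx, mul_div_cancel₀ (-μ) two_ne_zero] at h2
    refine h2.congr' ?_
    filter_upwards [eventually_gt_atTop 0] with t ht
    have e1 : (1 + x ^ 2 * t ^ 2 : ℝ) = t ^ 2 * ((t⁻¹) ^ 2 + x ^ 2) := by field_simp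
    have htc : (t : ℂ) ≠ 0 := Complex.ofReal_ne_zero.2 ht.ne'
    rw [hF]
    simp only
    rw [e1, Complex.ofReal_mul, Complex.mul_cpow_ofReal_nonneg (by positivity) (by positivity),
      ofReal_sq_cpow ht, mul_div_cancel₀ (-μ) two_ne_zero, ← mul_assoc, Complex.cpow_neg,
      mul_inv_cancel₀ (by simp [Complex.cpow_eq_zero_iff, htc]), one_mul]
  have hint := integrableOn_Ioi_cpow_mul hx hμ (σ := 1) (by simp) one_pos
  rw [integral_Ioi_of_hasDerivAt_of_tendsto hcont hderiv hint hlim]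
  simp [hF, Complex.zero_cpow hμ0]

theorem integral_Ioi_mul_cpow {A : ℝ} (hA : 0 < A) {σ : ℂ} (hσ : 0 < σ.re) :
    ∫ r in Ioi (0 : ℝ), (r : ℂ) * ((A + r ^ 2 : ℝ) : ℂ) ^ (-1 - σ) =
      (A : ℂ) ^ (-σ) / (2 * σ) := by
  have hσ0 : σ ≠ 0 := by rintro rfl; simp at hσ
  have hpos : ∀ t : ℝ, 0 < A + t ^ 2 := fun t => by positivity
  set F : ℝ → ℂ := fun t => ((A + t ^ 2 : ℝ) : ℂ) ^ (-σ) * (-(1 / (2 * σ))) with hF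
  have hderiv : ∀ t : ℝ, HasDerivAt F ((t : ℂ) * ((A + t ^ 2 : ℝ) : ℂ) ^ (-1 - σ)) t := by
    intro t
    have hb : HasDerivAt (fun t : ℝ => A + t ^ 2) (2 * t) t := by
      simpa using (hasDerivAt_pow 2 t).const_add A
    refine ((hasDerivAt_ofReal_cpow hb (hpos t) (-σ)).mul_const _).congr_deriv ?_
    have : -σ - 1 = -1 - σ := by ring
    rw [this]
    push_cast
    field_simp
  have hlim : Tendsto F atTop (𝓝 0) := by
    have h1 : Tendsto (fun t : ℝ => A + t ^ 2) atTop atTop :=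
      tendsto_atTop_add_const_left _ _ (tendsto_pow_atTop two_ne_zero)
    have h2 : Tendsto (fun t : ℝ => ((A + t ^ 2 : ℝ) : ℂ) ^ (-σ)) atTop (𝓝 0) := by
      rw [tendsto_zero_iff_norm_tendsto_zero]
      refine ((tendsto_rpow_neg_atTop hσ).comp h1).congr fun t => ?_
      rw [Complex.norm_cpow_eq_rpow_re_of_pos (hpos t), Complex.neg_re, Function.comp_apply]
    have h3 := h2.mul_const (-(1 / (2 * σ)))
    rw [zero_mul] at h3
    exact h3
  have hint : IntegrableOn (fun t : ℝ => (t : ℂ) * ((A + t ^ 2 : ℝ) : ℂ) ^ (-1 - σ)) (Ioi 0) := by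
    -- With `μ = 2` and `x = 1` the weight t^(μ-1) is the polar Jacobian.
    have := integrableOn_Ioi_cpow_mul one_pos (μ := 2) (by simp) hσ hA
    refine this.congr_fun (fun t ht => ?_) measurableSet_Ioi
    have e1 : (2 : ℂ) - 1 = 1 := by norm_num
    have e2 : -(2 : ℂ) / 2 = -1 := by norm_num
    simp only [e1, e2, Complex.cpow_one, one_pow, one_mul]
  rw [integral_Ioi_of_hasDerivAt_of_tendsto (hderiv 0).continuousAt.continuousWithinAt
    (fun t _ => hderiv t) hint hlim]
  simp only [hF]
  rw [zero_pow two_ne_zero, add_zero]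
  ring

theorem integral_plane_cpow {A : ℝ} (hA : 0 < A) {σ : ℂ} (hσ : 0 < σ.re) :
    ∫ z : ℝ × ℝ, ((A + (z.1 ^ 2 + z.2 ^ 2) : ℝ) : ℂ) ^ (-1 - σ) =
      Real.pi * (A : ℂ) ^ (-σ) / σ := by
  have hσ0 : σ ≠ 0 := by rintro rfl; simp at hσ
  rw [← integral_comp_polarCoord_symm]
  have h1 : ∀ z : ℝ × ℝ, z.1 • ((A + ((polarCoord.symm z).1 ^ 2 + (polarCoord.symm z).2 ^ 2) : ℝ) :
      ℂ) ^ (-1 - σ) = ((z.1 : ℂ) * ((A + z.1 ^ 2 : ℝ) : ℂ) ^ (-1 - σ)) * (fun _ => 1) z.2 := by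
    intro z
    have : (polarCoord.symm z).1 ^ 2 + (polarCoord.symm z).2 ^ 2 = z.1 ^ 2 := by
      simp only [polarCoord_symm_apply]
      linear_combination z.1 ^ 2 * Real.cos_sq_add_sin_sq z.2
    rw [this, Complex.real_smul, mul_one]
  simp only [h1]
  rw [polarCoord_target, Measure.volume_eq_prod, setIntegral_prod_mul
    (f := fun r : ℝ => (r : ℂ) * ((A + r ^ 2 : ℝ) : ℂ) ^ (-1 - σ)) (g := fun _ : ℝ => (1 : ℂ)),
    integral_Ioi_mul_cpow hA hσ]
  simp only [integral_const, MeasurableSet.univ, measureReal_restrict_apply, univ_inter,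
    Real.volume_real_Ioo, sub_neg_eq_add]
  rw [max_eq_left (by positivity), Complex.real_smul]
  push_cast
  field_simp
  ring

/-- The limit of the rescaled kernels. -/
noncomputable def limitKernel (x : ℝ) (μ : ℂ) (w : (ℝ × ℝ) × ℝ) : ℂ :=
  indicator (Ioi (0 : ℝ)) (fun t => (t : ℂ) ^ (μ - 1) *
    ((1 + x ^ 2 * t ^ 2 + (w.1.1 ^ 2 + w.1.2 ^ 2) : ℝ) : ℂ) ^ (-μ / 2 - 2)) w.2

theorem norm_sq_le_sum_sq (w : (ℝ × ℝ) × ℝ) : ‖w‖ ^ 2 ≤ w.1.1 ^ 2 + w.1.2 ^ 2 + w.2 ^ 2 := by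
  rw [Prod.norm_def, Prod.norm_def, Real.norm_eq_abs, Real.norm_eq_abs, Real.norm_eq_abs]
  have h1 := sq_abs w.1.1
  have h2 := sq_abs w.1.2
  have h3 := sq_abs w.2
  rcases max_choice (max |w.1.1| |w.1.2|) |w.2| with h | h <;> rw [h]
  · rcases max_choice |w.1.1| |w.1.2| with h' | h' <;> rw [h'] <;> nlinarith
  · nlinarith

instance isAddHaarMeasure_volume_prod_prod :
    (volume : Measure ((ℝ × ℝ) × ℝ)).IsAddHaarMeasure :=
  Measure.prod.instIsAddHaarMeasure (volume : Measure (ℝ × ℝ)) (volume : Measure ℝ)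

/-- The exponent 5/2 is c + 1/2 with c = 2 in `rpow_mul_rpow_le`; it suffices because it exceeds
3/2, half the dimension. -/
theorem integrable_japanese : Integrable fun w : (ℝ × ℝ) × ℝ => (1 + ‖w‖ ^ 2) ^ (-2 - 1 / 2 : ℝ) := by
  have h : Integrable fun w : (ℝ × ℝ) × ℝ => (1 + ‖w‖ ^ 2) ^ (-(5 : ℝ) / 2) :=
    integrable_rpow_neg_one_add_norm_sq (by simp; norm_num)
  have e : (-2 - 1 / 2 : ℝ) = -5 / 2 := by norm_num
  rwa [e]

theorem integrable_limitKernel {x : ℝ} (hx : 0 < x) {μ : ℂ} (hμ : 1 ≤ μ.re) :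
    Integrable (limitKernel x μ) := by
  set κ : ℝ := min 1 (x ^ 2) with hκ
  have hκ0 : 0 < κ := by positivity
  refine Integrable.mono' (integrable_japanese.const_mul
    (κ⁻¹ ^ ((μ.re - 1) / 2) * κ ^ (-2 - 1 / 2 : ℝ))) ?_ (ae_of_all _ fun w => ?_)
  · refine Measurable.aestronglyMeasurable ?_
    have h1 : Measurable fun w : (ℝ × ℝ) × ℝ => (w.2 : ℂ) ^ (μ - 1) *
      ((1 + x ^ 2 * w.2 ^ 2 + (w.1.1 ^ 2 + w.1.2 ^ 2) : ℝ) : ℂ) ^ (-μ / 2 - 2) :=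
      ((Complex.measurable_ofReal.comp measurable_snd).pow_const _).mul
        ((Complex.measurable_ofReal.comp (Continuous.measurable (by fun_prop))).pow_const _)
    exact h1.indicator (measurable_snd measurableSet_Ioi)
  · by_cases ht : w.2 ∈ Ioi (0 : ℝ)
    · have ht' : 0 < w.2 := ht
      have hb : 0 < 1 + x ^ 2 * w.2 ^ 2 + (w.1.1 ^ 2 + w.1.2 ^ 2) := by positivity
      rw [limitKernel, indicator_of_mem ht, norm_mul, Complex.norm_cpow_eq_rpow_re_of_pos ht',
        Complex.norm_cpow_eq_rpow_re_of_pos hb]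
      have e1 : (μ - 1).re = μ.re - 1 := by simp
      have e2 : (-μ / 2 - 2).re = -μ.re / 2 - 2 := by simp
      rw [e1, e2]
      have h1 : κ ≤ 1 := min_le_left _ _
      have h2 : κ ≤ x ^ 2 := min_le_right _ _
      refine rpow_mul_rpow_le hμ zero_le_two hκ0 ht'.le le_rfl (by positivity) ?_ ?_
      · have := norm_sq_le_sum_sq w
        nlinarith [sq_nonneg w.2, sq_nonneg w.1.1, sq_nonneg w.1.2]
      · nlinarith [sq_nonneg w.2, sq_nonneg w.1.1, sq_nonneg w.1.2]
    · rw [limitKernel, indicator_of_notMem ht, norm_zero]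
      positivity

/-- Integrating over the plane first is `integral_plane_cpow` with σ = μ/2 + 1; it lowers the
exponent by one and leaves `integral_Ioi_cpow_mul`. -/
theorem integral_limitKernel {x : ℝ} (hx : 0 < x) {μ : ℂ} (hμ : 1 ≤ μ.re) :
    ∫ w, limitKernel x μ w = 2 * Real.pi * (x : ℂ) ^ (-μ) / (μ * (μ + 2)) := by
  have hμ0 : μ ≠ 0 := by rintro rfl; simp at hμ; linarith
  have hμ2 : μ + 2 ≠ 0 := by
    intro h
    have := congrArg Complex.re h
    simp at this
    linarith
  have hint := integrable_limitKernel hx hμ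
  rw [Measure.volume_eq_prod] at hint ⊢
  rw [integral_prod_symm _ hint]
  have hinner : ∀ t : ℝ, ∫ z : ℝ × ℝ, limitKernel x μ (z, t) =
      indicator (Ioi (0 : ℝ)) (fun t => Real.pi / (μ / 2 + 1) * ((t : ℂ) ^ (μ - 1) *
        ((1 + x ^ 2 * t ^ 2 : ℝ) : ℂ) ^ (-μ / 2 - 1))) t := by
    intro t
    by_cases ht : t ∈ Ioi (0 : ℝ)
    · simp only [limitKernel, indicator_of_mem ht]
      have hσ : 0 < (μ / 2 + 1).re := by simp; linarith
      have h1 := integral_plane_cpow (show 0 < 1 + x ^ 2 * t ^ 2 by positivity) hσ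
      have e1 : -1 - (μ / 2 + 1) = -μ / 2 - 2 := by ring
      have e2 : -(μ / 2 + 1) = -μ / 2 - 1 := by ring
      rw [e1, e2] at h1
      rw [integral_const_mul, h1]
      ring
    · simp only [limitKernel, indicator_of_notMem ht, integral_zero]
  simp only [hinner]
  rw [integral_indicator measurableSet_Ioi, integral_const_mul, integral_Ioi_cpow_mul hx hμ]
  have : μ / 2 + 1 ≠ 0 := fun h => hμ2 (by linear_combination 2 * h)
  field_simp

/-! ### The approximate identity. -/

/-- The regularized delta kernel, as a function on `ℝ² × ℝ`. -/
noncomputable def deltaKernel (p : ℝ × ℝ) (μ : ℂ) (ε : ℝ) (w : (ℝ × ℝ) × ℝ) : ℂ :=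
  indicator (Ioo 0 Real.pi) (fun θ => ((ε ^ 2 : ℝ) : ℂ) *
    (sinPow μ θ * basePow p (-μ / 2 - 2) (ε ^ 2) θ w.1)) w.2

theorem measurable_deltaKernel (p : ℝ × ℝ) (μ : ℂ) (ε : ℝ) : Measurable (deltaKernel p μ ε) := by
  have h1 : Measurable fun w : (ℝ × ℝ) × ℝ => ((ε ^ 2 : ℝ) : ℂ) *
      (sinPow μ w.2 * basePow p (-μ / 2 - 2) (ε ^ 2) w.2 w.1) := by
    unfold sinPow basePow kernelBase
    exact measurable_const.mul
      (((Complex.measurable_ofReal.comp (Continuous.measurable (by fun_prop))).pow_const _).mul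
        ((Complex.measurable_ofReal.comp (Continuous.measurable (by fun_prop))).pow_const _))
  exact h1.indicator (measurable_snd measurableSet_Ioo)

/-- The rescaled kernel base. -/
noncomputable def scaledBase (p : ℝ × ℝ) (ε : ℝ) (w : (ℝ × ℝ) × ℝ) : ℝ :=
  1 + (w.1.1 ^ 2 + w.1.2 ^ 2) +
    4 * p.1 * (p.1 + ε * w.1.1) * (Real.sin (ε * w.2 / 2) / ε) ^ 2

/-- The powers of ε are 3 from the volume, 2 from `h = ε²`, μ - 1 from the sine and -μ - 4 from the
base; they add up to 0. -/
theorem deltaKernel_scaled {p : ℝ × ℝ} (hp : 0 < p.1) {μ : ℂ} {ε : ℝ} (hε : 0 < ε)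
    {w : (ℝ × ℝ) × ℝ} (hw : 0 < p.1 + ε * w.1.1) (hθ : ε * w.2 ∈ Ioo 0 Real.pi) :
    ((ε ^ 3 : ℝ) : ℂ) * deltaKernel p μ ε ((p, 0) + ε • w) =
      ((Real.sin (ε * w.2) / ε : ℝ) : ℂ) ^ (μ - 1) *
        (scaledBase p ε w : ℂ) ^ (-μ / 2 - 2) := by
  have hθ' : ((p, (0 : ℝ)) + ε • w).2 = ε * w.2 := by simp
  have hq : ((p, (0 : ℝ)) + ε • w).1 = (p.1 + ε * w.1.1, p.2 + ε * w.1.2) := by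
    ext <;> simp
  rw [deltaKernel, hθ', indicator_of_mem hθ, hq]
  have hB : kernelBase p (p.1 + ε * w.1.1, p.2 + ε * w.1.2) (ε * w.2) + ε ^ 2 =
      ε ^ 2 * scaledBase p ε w := by
    unfold kernelBase scaledBase
    field_simp
    ring
  have hBpos : 0 ≤ scaledBase p ε w := by unfold scaledBase; positivity
  have hS : Real.sin (ε * w.2) = ε * (Real.sin (ε * w.2) / ε) := by field_simp
  have hSpos : 0 ≤ Real.sin (ε * w.2) / ε := div_nonneg (sin_pos_of_mem hθ).le hε.le
  have hεc : (ε : ℂ) ≠ 0 := Complex.ofReal_ne_zero.2 hε.ne'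
  rw [sinPow, basePow, hB]
  conv_lhs => rw [hS]
  rw [Complex.ofReal_mul, Complex.ofReal_mul, Complex.mul_cpow_ofReal_nonneg hε.le hSpos,
    Complex.mul_cpow_ofReal_nonneg (by positivity) hBpos, ofReal_sq_cpow hε]
  have h5 : ((ε ^ 3 : ℝ) : ℂ) * ((ε ^ 2 : ℝ) : ℂ) * (ε : ℂ) ^ (μ - 1) *
      (ε : ℂ) ^ (2 * (-μ / 2 - 2)) = 1 := by
    rw [mul_assoc, ← Complex.cpow_add _ _ hεc]
    have e : μ - 1 + 2 * (-μ / 2 - 2) = -((5 : ℕ) : ℂ) := by push_cast; ring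
    rw [e, Complex.cpow_neg, Complex.cpow_natCast]
    push_cast
    field_simp
  linear_combination (((Real.sin (ε * w.2) / ε : ℝ) : ℂ) ^ (μ - 1) *
        (scaledBase p ε w : ℂ) ^ (-μ / 2 - 2)) * h5

/-- Jordan's inequality sin s ≥ 2s/π on [0, π/2], together with ξ ≥ ξ₀, bounds `scaledBase` below by
κ (1 + ‖w‖²) uniformly in ε. -/
theorem norm_deltaKernel_scaled_le {p : ℝ × ℝ} (hp : 0 < p.1) {μ : ℂ} (hμ : 1 ≤ μ.re) {ξ₀ κ ε : ℝ}
    (hξ₀ : 0 < ξ₀) (hκ : κ = min 1 (4 * p.1 * ξ₀ / Real.pi ^ 2)) (hε : 0 < ε)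
    {w : (ℝ × ℝ) × ℝ} (hw : ξ₀ ≤ p.1 + ε * w.1.1) :
    ‖((ε ^ 3 : ℝ) : ℂ) * deltaKernel p μ ε ((p, 0) + ε • w)‖ ≤
      κ⁻¹ ^ ((μ.re - 1) / 2) * κ ^ (-2 - 1 / 2 : ℝ) * (1 + ‖w‖ ^ 2) ^ (-2 - 1 / 2 : ℝ) := by
  have hπ := Real.pi_pos
  have hκ0 : 0 < κ := by rw [hκ]; positivity
  by_cases hθ : ε * w.2 ∈ Ioo 0 Real.pi
  · have hτ : 0 < w.2 := pos_of_mul_pos_right hθ.1 hε.le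
    have hxpos : 0 < p.1 + ε * w.1.1 := hξ₀.trans_le hw
    rw [deltaKernel_scaled hp hε hxpos hθ, norm_mul]
    have hS : 0 < Real.sin (ε * w.2) / ε := div_pos (sin_pos_of_mem hθ) hε
    have hSτ : Real.sin (ε * w.2) / ε ≤ w.2 := by
      rw [div_le_iff₀ hε, mul_comm w.2]
      exact Real.sin_le hθ.1.le
    have hB : 0 < scaledBase p ε w := by unfold scaledBase; positivity
    have hhalf : w.2 / Real.pi ≤ Real.sin (ε * w.2 / 2) / ε := by
      rw [le_div_iff₀ hε]
      have := Real.mul_le_sin (x := ε * w.2 / 2) (by linarith [hθ.1]) (by linarith [hθ.2])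
      refine le_trans (le_of_eq ?_) this
      field_simp
    have hsq : w.2 ^ 2 / Real.pi ^ 2 ≤ (Real.sin (ε * w.2 / 2) / ε) ^ 2 := by
      rw [← div_pow]
      gcongr
    have hlow : 1 + (w.1.1 ^ 2 + w.1.2 ^ 2) + 4 * p.1 * ξ₀ / Real.pi ^ 2 * w.2 ^ 2 ≤
        scaledBase p ε w := by
      unfold scaledBase
      refine add_le_add le_rfl ?_
      calc 4 * p.1 * ξ₀ / Real.pi ^ 2 * w.2 ^ 2 = 4 * p.1 * ξ₀ * (w.2 ^ 2 / Real.pi ^ 2) := by ring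
        _ ≤ _ := by gcongr
    have h1 : κ ≤ 1 := hκ ▸ min_le_left _ _
    have h2 : κ ≤ 4 * p.1 * ξ₀ / Real.pi ^ 2 := hκ ▸ min_le_right _ _
    rw [Complex.norm_cpow_eq_rpow_re_of_pos hS, Complex.norm_cpow_eq_rpow_re_of_pos hB]
    have e1 : (μ - 1).re = μ.re - 1 := by simp
    have e2 : (-μ / 2 - 2).re = -μ.re / 2 - 2 := by simp
    rw [e1, e2]
    refine rpow_mul_rpow_le hμ zero_le_two hκ0 hS.le hSτ (by positivity) (le_trans ?_ hlow)
      (le_trans ?_ hlow)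
    · have := norm_sq_le_sum_sq w
      nlinarith [sq_nonneg w.2, sq_nonneg w.1.1, sq_nonneg w.1.2]
    · nlinarith [sq_nonneg w.2, sq_nonneg w.1.1, sq_nonneg w.1.2]
  · have hθ' : ((p, (0 : ℝ)) + ε • w).2 = ε * w.2 := by simp
    rw [deltaKernel, hθ', indicator_of_notMem hθ, mul_zero, norm_zero]
    positivity

theorem tendsto_sin_mul_div (c : ℝ) :
    Tendsto (fun ε : ℝ => Real.sin (ε * c) / ε) (𝓝[>] 0) (𝓝 c) := by
  have h : HasDerivAt (fun ε : ℝ => Real.sin (ε * c)) c 0 := by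
    simpa using ((hasDerivAt_id (0 : ℝ)).mul_const c).sin
  have h1 := (hasDerivAt_iff_tendsto_slope.1 h).mono_left
    (nhdsWithin_mono (0 : ℝ) fun x (hx : 0 < x) => hx.ne')
  refine h1.congr fun ε => ?_
  simp [slope, div_eq_inv_mul]

theorem tendsto_deltaKernel_scaled {p : ℝ × ℝ} (hp : 0 < p.1) (μ : ℂ) (w : (ℝ × ℝ) × ℝ) :
    Tendsto (fun ε : ℝ => ((ε ^ 3 : ℝ) : ℂ) * deltaKernel p μ ε ((p, 0) + ε • w)) (𝓝[>] 0)
      (𝓝 (limitKernel p.1 μ w)) := by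
  have hpos : ∀ᶠ ε : ℝ in 𝓝[>] 0, 0 < ε := self_mem_nhdsWithin
  have hid : Tendsto (fun ε : ℝ => ε) (𝓝[>] 0) (𝓝 0) := nhdsWithin_le_nhds
  by_cases hτ : 0 < w.2
  · rw [limitKernel, indicator_of_mem (show w.2 ∈ Ioi (0 : ℝ) from hτ)]
    have hx : Tendsto (fun ε : ℝ => p.1 + ε * w.1.1) (𝓝[>] 0) (𝓝 p.1) := by
      simpa using (hid.mul_const w.1.1).const_add p.1
    have hθ : Tendsto (fun ε : ℝ => ε * w.2) (𝓝[>] 0) (𝓝 0) := by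
      simpa using hid.mul_const w.2
    have hev : ∀ᶠ ε : ℝ in 𝓝[>] 0, ((Real.sin (ε * w.2) / ε : ℝ) : ℂ) ^ (μ - 1) *
        (scaledBase p ε w : ℂ) ^ (-μ / 2 - 2) =
        ((ε ^ 3 : ℝ) : ℂ) * deltaKernel p μ ε ((p, 0) + ε • w) := by
      filter_upwards [hpos, hx.eventually (lt_mem_nhds hp),
        hθ.eventually (gt_mem_nhds Real.pi_pos)] with ε h1 h2 h3
      exact (deltaKernel_scaled hp h1 h2 ⟨mul_pos h1 hτ, h3⟩).symm
    refine Tendsto.congr' hev (Tendsto.mul ?_ ?_)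
    · have hc : ContinuousAt (fun z : ℂ => z ^ (μ - 1)) (w.2 : ℂ) :=
        continuousAt_id.cpow continuousAt_const (Complex.ofReal_mem_slitPlane.2 hτ)
      exact hc.tendsto.comp ((Complex.continuous_ofReal.tendsto _).comp (tendsto_sin_mul_div w.2))
    · have hb : 0 < 1 + p.1 ^ 2 * w.2 ^ 2 + (w.1.1 ^ 2 + w.1.2 ^ 2) := by positivity
      have hc : ContinuousAt (fun z : ℂ => z ^ (-μ / 2 - 2))
          ((1 + p.1 ^ 2 * w.2 ^ 2 + (w.1.1 ^ 2 + w.1.2 ^ 2) : ℝ) : ℂ) :=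
        continuousAt_id.cpow continuousAt_const (Complex.ofReal_mem_slitPlane.2 hb)
      have hB : Tendsto (fun ε => scaledBase p ε w) (𝓝[>] 0)
          (𝓝 (1 + p.1 ^ 2 * w.2 ^ 2 + (w.1.1 ^ 2 + w.1.2 ^ 2))) := by
        have h1 := ((hx.const_mul (4 * p.1)).mul ((tendsto_sin_mul_div (w.2 / 2)).pow 2)).const_add
          (1 + (w.1.1 ^ 2 + w.1.2 ^ 2))
        have e : 1 + (w.1.1 ^ 2 + w.1.2 ^ 2) + 4 * p.1 * p.1 * (w.2 / 2) ^ 2 =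
          1 + p.1 ^ 2 * w.2 ^ 2 + (w.1.1 ^ 2 + w.1.2 ^ 2) := by ring
        rw [e] at h1
        refine h1.congr fun ε => ?_
        rw [scaledBase, mul_div_assoc]
      exact hc.tendsto.comp ((Complex.continuous_ofReal.tendsto _).comp hB)
  · rw [limitKernel, indicator_of_notMem (show w.2 ∉ Ioi (0 : ℝ) from hτ)]
    refine tendsto_const_nhds.congr' ?_
    filter_upwards [hpos] with ε hε
    have hθ' : ((p, (0 : ℝ)) + ε • w).2 = ε * w.2 := by simp
    rw [deltaKernel, hθ', indicator_of_notMem, mul_zero]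
    exact fun h => hτ (pos_of_mul_pos_right h.1 hε.le)

/-- The regularized delta kernels form an approximate identity. -/
theorem tendsto_integral_deltaKernel {p : ℝ × ℝ} (hp : 0 < p.1) {μ : ℂ} (hμ : 1 ≤ μ.re)
    {U : ℝ × ℝ → ℂ} {M ξ₀ : ℝ} (hξ₀ : 0 < ξ₀) (hU : Measurable U) (hM : ∀ q, ‖U q‖ ≤ M)
    (hU0 : ∀ q : ℝ × ℝ, q.1 < ξ₀ → U q = 0) (hUc : ContinuousAt U p) :
    Tendsto (fun ε : ℝ => ∫ q, U q * ∫ θ in Ioo 0 Real.pi, ((ε ^ 2 : ℝ) : ℂ) *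
        (sinPow μ θ * basePow p (-μ / 2 - 2) (ε ^ 2) θ q)) (𝓝[>] 0)
      (𝓝 (U p * (2 * Real.pi * (p.1 : ℂ) ^ (-μ) / (μ * (μ + 2))))) := by
  have hM0 : 0 ≤ M := (norm_nonneg _).trans (hM p)
  set κ : ℝ := min 1 (4 * p.1 * ξ₀ / Real.pi ^ 2) with hκ
  set Φ : ℝ → (ℝ × ℝ) × ℝ → ℂ := fun ε w => U w.1 * deltaKernel p μ ε w with hΦ
  -- The integrand in the coordinates (q, θ) = (p, 0) + ε w, with the Jacobian ε³.
  set G : ℝ → (ℝ × ℝ) × ℝ → ℂ :=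
    fun ε w => ((ε ^ 3 : ℝ) : ℂ) * Φ ε ((p, 0) + ε • w) with hG
  have hΦm : ∀ ε, Measurable (Φ ε) := fun ε =>
    (hU.comp measurable_fst).mul (measurable_deltaKernel p μ ε)
  have hGm : ∀ ε, Measurable (G ε) := fun ε =>
    measurable_const.mul ((hΦm ε).comp (Continuous.measurable (by fun_prop)))
  set bd : (ℝ × ℝ) × ℝ → ℝ := fun w => M * (κ⁻¹ ^ ((μ.re - 1) / 2) * κ ^ (-2 - 1 / 2 : ℝ) *
    (1 + ‖w‖ ^ 2) ^ (-2 - 1 / 2 : ℝ)) with hbd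
  have hbdi : Integrable bd := (integrable_japanese.const_mul _).const_mul M
  have hGle : ∀ ε > 0, ∀ w, ‖G ε w‖ ≤ bd w := by
    intro ε hε w
    have hκ0 : 0 < κ := by positivity
    have e : G ε w = U ((p, (0 : ℝ)) + ε • w).1 *
        (((ε ^ 3 : ℝ) : ℂ) * deltaKernel p μ ε ((p, 0) + ε • w)) := by
      simp only [hG, hΦ]; ring
    have e1 : ((p, (0 : ℝ)) + ε • w).1.1 = p.1 + ε * w.1.1 := by simp
    by_cases hw : ξ₀ ≤ p.1 + ε * w.1.1
    · rw [e, norm_mul]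
      exact mul_le_mul (hM _) (norm_deltaKernel_scaled_le hp hμ hξ₀ hκ hε hw) (norm_nonneg _) hM0
    -- For ξ < ξ₀ the bound on the kernel is not available, but `U` vanishes.
    · rw [e, hU0 _ (by rw [e1]; exact not_le.1 hw), zero_mul, norm_zero]
      positivity
  have hGi : ∀ ε > 0, Integrable (G ε) := fun ε hε =>
    hbdi.mono' (hGm ε).aestronglyMeasurable (ae_of_all _ (hGle ε hε))
  -- Integrability is carried back from `G ε` by undoing the dilation and the translation.
  have hΦi : ∀ ε > 0, Integrable (Φ ε) := by
    intro ε hε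
    have hε3 : ((ε ^ 3 : ℝ) : ℂ) ≠ 0 := Complex.ofReal_ne_zero.2 (pow_pos hε 3).ne'
    have h1 : Integrable fun w => Φ ε ((p, 0) + ε • w) := by
      refine ((hGi ε hε).const_mul (((ε ^ 3 : ℝ) : ℂ)⁻¹)).congr (ae_of_all _ fun w => ?_)
      simp only [hG]
      rw [inv_mul_cancel_left₀ hε3]
    have h2 : Integrable fun w => Φ ε ((p, 0) + w) :=
      (integrable_comp_smul_iff volume (fun w => Φ ε ((p, 0) + w)) hε.ne').1 h1
    refine (h2.comp_add_left (-(p, (0 : ℝ)))).congr (ae_of_all _ fun w => ?_)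
    simp only [add_neg_cancel_left]
  have hint : ∀ ε > 0, ∫ w, G ε w = ∫ q, U q * ∫ θ in Ioo 0 Real.pi, ((ε ^ 2 : ℝ) : ℂ) *
        (sinPow μ θ * basePow p (-μ / 2 - 2) (ε ^ 2) θ q) := by
    intro ε hε
    have h1 : ∫ w, G ε w = ∫ w, Φ ε w := by
      simp only [hG]
      rw [integral_const_mul,
        Measure.integral_comp_smul volume (fun w => Φ ε ((p, (0 : ℝ)) + w)) ε,
        integral_add_left_eq_self (Φ ε) (p, (0 : ℝ))]
      have h3 : Module.finrank ℝ ((ℝ × ℝ) × ℝ) = 3 := by simp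
      rw [h3, abs_of_pos (by positivity), Complex.real_smul, ← mul_assoc, ← Complex.ofReal_mul,
        mul_inv_cancel₀ (pow_pos hε 3).ne', Complex.ofReal_one, one_mul]
    have h4 := hΦi ε hε
    rw [h1, Measure.volume_eq_prod] at *
    rw [integral_prod _ h4]
    refine integral_congr_ae (ae_of_all _ fun q => ?_)
    simp only [hΦ, deltaKernel]
    rw [integral_const_mul, integral_indicator measurableSet_Ioo]
  have hpos : ∀ᶠ ε : ℝ in 𝓝[>] 0, 0 < ε := self_mem_nhdsWithin
  have hlim : Tendsto (fun ε => ∫ w, G ε w) (𝓝[>] 0) (𝓝 (∫ w, U p * limitKernel p.1 μ w)) := by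
    refine tendsto_integral_filter_of_dominated_convergence bd
      (Eventually.of_forall fun ε => (hGm ε).aestronglyMeasurable)
      (hpos.mono fun ε hε => ae_of_all _ (hGle ε hε)) hbdi (ae_of_all _ fun w => ?_)
    have h1 : Tendsto (fun ε : ℝ => ((p, (0 : ℝ)) + ε • w).1) (𝓝[>] 0) (𝓝 p) := by
      have hc : Continuous fun ε : ℝ => ((p, (0 : ℝ)) + ε • w).1 := by fun_prop
      exact (hc.tendsto' 0 p (by simp)).mono_left nhdsWithin_le_nhds
    refine ((hUc.tendsto.comp h1).mul (tendsto_deltaKernel_scaled hp μ w)).congr fun ε => ?_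
    simp only [hG, hΦ, Function.comp_apply]
    ring
  rw [integral_const_mul, integral_limitKernel hp hμ] at hlim
  exact hlim.congr' (hpos.mono hint)

/-! ### The unregularized kernel: integrable majorant and first derivatives. -/

theorem intervalIntegrable_abs_sub_rpow (x a b : ℝ) :
    IntervalIntegrable (fun t : ℝ => |x - t| ^ (-(1 / 2) : ℝ)) volume a b := by
  have h : IntervalIntegrable (fun t : ℝ => |t| ^ (-(1 / 2) : ℝ)) volume (x - a) (x - b) := by
    have h1 := (intervalIntegral.intervalIntegrable_cpow' (a := x - a) (b := x - b)
      (r := ((-(1 / 2) : ℝ) : ℂ)) (by rw [Complex.ofReal_re]; norm_num)).norm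
    refine h1.congr fun t _ => ?_
    simp only [Complex.norm_cpow_real, Complex.norm_real, Real.norm_eq_abs]
  have h2 := h.comp_sub_left x
  simpa using h2

/-- Since 2|a||b| ≤ a² + b², this function dominates the inverse distance to `p`; being a product,
it reduces to |t|^(-1/2) on intervals. The exponent has the form `-c - 1/2` of `rpow_mul_rpow_le`,
with `c = 0`. -/
theorem integrableOn_singular {Ω : Set (ℝ × ℝ)} (hcompact : IsCompact (closure Ω))
    (p : ℝ × ℝ) : IntegrableOn
      (fun q : ℝ × ℝ => (2 * |p.1 - q.1| * |p.2 - q.2|) ^ (-0 - 1 / 2 : ℝ)) Ω := by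
  obtain ⟨R, hR⟩ := (hcompact.isBounded.subset_closedBall (0 : ℝ × ℝ))
  have hsub : Ω ⊆ Icc (-R) R ×ˢ Icc (-R) R := by
    intro q hq
    have := hR (subset_closure hq)
    rw [mem_closedBall_zero_iff] at this
    exact ⟨abs_le.1 ((norm_fst_le q).trans this), abs_le.1 ((norm_snd_le q).trans this)⟩
  have h1 : ∀ x : ℝ, IntegrableOn (fun t : ℝ => |x - t| ^ (-(1 / 2) : ℝ)) (Icc (-R) R) := by
    intro x
    by_cases hRR : -R ≤ R
    · exact (intervalIntegrable_iff_integrableOn_Icc_of_le hRR).1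
        (intervalIntegrable_abs_sub_rpow x _ _)
    · rw [Icc_eq_empty hRR]; exact integrableOn_empty
  have h2 : IntegrableOn (fun q : ℝ × ℝ => |p.1 - q.1| ^ (-(1 / 2) : ℝ) *
      |p.2 - q.2| ^ (-(1 / 2) : ℝ)) (Icc (-R) R ×ˢ Icc (-R) R) := by
    rw [IntegrableOn, Measure.volume_eq_prod, ← Measure.prod_restrict]
    exact Integrable.mul_prod (h1 p.1) (h1 p.2)
  refine ((h2.mono_set hsub).const_mul ((2 : ℝ) ^ (-(1 / 2) : ℝ))).congr (ae_of_all _ fun q => ?_)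
  have e : (-0 - 1 / 2 : ℝ) = -(1 / 2) := by norm_num
  simp only [e]
  rw [Real.mul_rpow (by positivity) (abs_nonneg _), Real.mul_rpow (by norm_num) (abs_nonneg _)]
  ring

/-- The case `c = 0` of `rpow_mul_rpow_le`, with sin² θ ≤ 4 sin² (θ/2) comparing the weight with the
base. The bound is uniform in `h ≥ 0` and in θ. -/
theorem norm_sinPow_mul_kern_le {p q : ℝ × ℝ} (hp : 0 < p.1) {μ α : ℂ} (hμ : 1 ≤ μ.re) {ξ₀ κ h θ : ℝ}
    (hξ₀ : 0 < ξ₀) (hκ : κ = min 1 (p.1 * ξ₀)) (hq : ξ₀ ≤ q.1) (h1 : q.1 ≠ p.1) (h2 : q.2 ≠ p.2)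
    (hh : 0 ≤ h) (hθ : θ ∈ Ioo 0 Real.pi) :
    ‖sinPow μ θ * kern p μ α h θ q‖ ≤ ‖(q.1 : ℂ) ^ α‖ * (κ⁻¹ ^ ((μ.re - 1) / 2) *
      κ ^ (-0 - 1 / 2 : ℝ) * (2 * |p.1 - q.1| * |p.2 - q.2|) ^ (-0 - 1 / 2 : ℝ)) := by
  have hq0 : 0 < q.1 := hξ₀.trans_le hq
  have hκ0 : 0 < κ := by rw [hκ]; positivity
  have hκ1 : κ ≤ 1 := hκ ▸ min_le_left _ _
  have hκ2 : κ ≤ p.1 * ξ₀ := hκ ▸ min_le_right _ _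
  have a1 : 0 < |p.1 - q.1| := abs_pos.2 (sub_ne_zero.2 h1.symm)
  have a2 : 0 < |p.2 - q.2| := abs_pos.2 (sub_ne_zero.2 h2.symm)
  have hD := dist_sq_le_kernelBase hp hq0 θ
  have hW : 2 * |p.1 - q.1| * |p.2 - q.2| ≤ kernelBase p q θ + h := by
    have := sq_nonneg (|p.1 - q.1| - |p.2 - q.2|)
    have e1 := sq_abs (p.1 - q.1)
    have e2 := sq_abs (p.2 - q.2)
    nlinarith
  have hW0 : 0 < 2 * |p.1 - q.1| * |p.2 - q.2| := by positivity
  have hb := hW0.trans_le hW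
  have hS := sin_pos_of_mem hθ
  have hτ : κ * Real.sin θ ^ 2 ≤ kernelBase p q θ + h := by
    have e3 : Real.sin θ ^ 2 ≤ 4 * Real.sin (θ / 2) ^ 2 := by
      have e4 := Real.sin_two_mul (θ / 2)
      rw [mul_div_cancel₀ θ two_ne_zero] at e4
      rw [e4]
      nlinarith [Real.cos_sq_le_one (θ / 2), sq_nonneg (Real.sin (θ / 2))]
    have e5 : κ ≤ p.1 * q.1 := hκ2.trans (by gcongr)
    calc κ * Real.sin θ ^ 2 ≤ p.1 * q.1 * (4 * Real.sin (θ / 2) ^ 2) := by gcongr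
      _ ≤ kernelBase p q θ + h := by
        unfold kernelBase
        nlinarith [sq_nonneg (p.1 - q.1), sq_nonneg (p.2 - q.2)]
  rw [kern, mul_left_comm, norm_mul]
  refine mul_le_mul_of_nonneg_left ?_ (norm_nonneg _)
  rw [norm_mul, norm_sinPow hθ, basePow, Complex.norm_cpow_eq_rpow_re_of_pos hb]
  have e2 : (-μ / 2).re = -μ.re / 2 - 0 := by simp
  rw [e2]
  exact rpow_mul_rpow_le hμ le_rfl hκ0 hS.le le_rfl hW0
    ((mul_le_of_le_one_left hW0.le hκ1).trans hW) hτ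

theorem tendsto_regSol {p q : ℝ × ℝ} (hp : 0 < p.1) {μ α : ℂ} (hμ : 1 ≤ μ.re) (hq : 0 < q.1)
    (hne : q ≠ p) : Tendsto (fun h => regSol p μ α h q) (𝓝[>] 0) (𝓝 (regSol p μ α 0 q)) := by
  have hc : ContinuousOn (fun z : ℝ × ℝ => kern p μ α z.1 z.2 q) (Icc 0 1 ×ˢ Icc 0 Real.pi) :=
    (continuousOn_kern p μ α).comp (f := fun z : ℝ × ℝ => (z.1, q, z.2))
      (Continuous.continuousOn (by fun_prop)) fun z hz => mem_kernDomain_of_ne hp hq hne hz.1.1 _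
  obtain ⟨C, hC⟩ := (isCompact_Icc.prod isCompact_Icc).exists_bound_of_continuousOn hc
  have hev : ∀ᶠ h in 𝓝[>] (0 : ℝ), h ∈ Icc (0 : ℝ) 1 := by
    filter_upwards [Ioc_mem_nhdsGT (zero_lt_one' ℝ)] with h hh using ⟨hh.1.le, hh.2⟩
  refine tendsto_integral_filter_of_dominated_convergence (fun θ => ‖sinPow μ θ‖ * C)
    (hev.mono fun h hh => ?_) (hev.mono fun h hh => ?_)
    ((integrableOn_sinPow hμ).norm.mul_const C) ?_
  · refine ContinuousOn.aestronglyMeasurable ((continuousOn_sinPow μ).mul ?_) measurableSet_Ioo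
    exact hc.comp (f := fun θ => (h, θ)) (Continuous.continuousOn (by fun_prop))
      fun θ hθ => ⟨hh, Ioo_subset_Icc_self hθ⟩
  · filter_upwards [ae_restrict_mem measurableSet_Ioo] with θ hθ
    rw [norm_mul]
    exact mul_le_mul_of_nonneg_left (hC (h, θ) ⟨hh, Ioo_subset_Icc_self hθ⟩) (norm_nonneg _)
  · filter_upwards [ae_restrict_mem measurableSet_Ioo] with θ hθ
    have h1 : ContinuousOn (fun h : ℝ => kern p μ α h θ q) (Icc 0 1) :=
      hc.comp (f := fun h => (h, θ)) (Continuous.continuousOn (by fun_prop))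
        fun h hh => ⟨hh, Ioo_subset_Icc_self hθ⟩
    exact ((h1 0 ⟨le_rfl, zero_le_one⟩).tendsto.mono_left
      (nhdsWithin_le_of_mem hev)).const_mul _

theorem hasDerivAt_integral_sinPow {μ : ℂ} (hμ : 1 ≤ μ.re) {F F' : ℝ → ℝ → ℂ} {t₀ : ℝ} {s : Set ℝ}
    (hs : s ∈ 𝓝 t₀) (hsc : IsCompact s)
    (hF : ContinuousOn (fun z : ℝ × ℝ => F z.1 z.2) (s ×ˢ Icc 0 Real.pi))
    (hF' : ContinuousOn (fun z : ℝ × ℝ => F' z.1 z.2) (s ×ˢ Icc 0 Real.pi))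
    (hd : ∀ t ∈ s, ∀ θ, HasDerivAt (fun t => F t θ) (F' t θ) t) :
    HasDerivAt (fun t => ∫ θ in Ioo 0 Real.pi, sinPow μ θ * F t θ)
      (∫ θ in Ioo 0 Real.pi, sinPow μ θ * F' t₀ θ) t₀ := by
  obtain ⟨C, hC⟩ := (hsc.prod isCompact_Icc).exists_bound_of_continuousOn hF'
  have hsl : ∀ {G : ℝ → ℝ → ℂ}, ContinuousOn (fun z : ℝ × ℝ => G z.1 z.2) (s ×ˢ Icc 0 Real.pi) →
      ∀ t ∈ s, IntegrableOn (fun θ => sinPow μ θ * G t θ) (Ioo 0 Real.pi) := fun hG t ht =>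
    (integrableOn_sinPow hμ).mul_continuousOn_of_subset
      (hG.comp (f := fun θ => (t, θ)) (Continuous.continuousOn (by fun_prop)) fun θ hθ => ⟨ht, hθ⟩)
      measurableSet_Ioo isCompact_Icc Ioo_subset_Icc_self
  refine (hasDerivAt_integral_of_dominated_loc_of_deriv_le (μ := volume.restrict (Ioo 0 Real.pi))
    (F := fun t θ => sinPow μ θ * F t θ) (F' := fun t θ => sinPow μ θ * F' t θ)
    (bound := fun θ => ‖sinPow μ θ‖ * C) hs ?_ (hsl hF t₀ (mem_of_mem_nhds hs))
    (hsl hF' t₀ (mem_of_mem_nhds hs)).aestronglyMeasurable ?_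
    ((integrableOn_sinPow hμ).norm.mul_const C) ?_).2
  · filter_upwards [hs] with t ht using (hsl hF t ht).aestronglyMeasurable
  · filter_upwards [ae_restrict_mem measurableSet_Ioo] with θ hθ t ht
    rw [norm_mul]
    exact mul_le_mul_of_nonneg_left (hC (t, θ) ⟨ht, Ioo_subset_Icc_self hθ⟩) (norm_nonneg _)
  · exact ae_of_all _ fun θ t ht => (hd t ht θ).const_mul _

theorem pd₁_regSol {p q : ℝ × ℝ} (hp : 0 < p.1) {μ : ℂ} (hμ : 1 ≤ μ.re) (α : ℂ) (hq : 0 < q.1)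
    (hne : q ≠ p) : pd₁ (regSol p μ α 0) q =
      ∫ θ in Ioo 0 Real.pi, sinPow μ θ * kern₁ p μ α 0 θ q := by
  have hopen : IsOpen {t : ℝ | 0 < t ∧ (t, q.2) ≠ p} :=
    (isOpen_lt continuous_const continuous_id).inter
      (isOpen_ne_fun (by fun_prop) continuous_const)
  obtain ⟨s, hs, hsub, hsc⟩ := local_compact_nhds (hopen.mem_nhds (x := q.1) ⟨hq, hne⟩)
  have hmem : ∀ z ∈ s ×ˢ Icc 0 Real.pi, ((0 : ℝ), (z.1, q.2), z.2) ∈ kernDomain p := fun z hz =>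
    mem_kernDomain_of_ne (q := (z.1, q.2)) hp (hsub hz.1).1 (hsub hz.1).2 le_rfl _
  exact (hasDerivAt_integral_sinPow hμ (F := fun t θ => kern p μ α 0 θ (t, q.2))
    (F' := fun t θ => kern₁ p μ α 0 θ (t, q.2)) hs hsc
    ((continuousOn_kern p μ α).comp (f := fun z : ℝ × ℝ => ((0 : ℝ), (z.1, q.2), z.2))
      (Continuous.continuousOn (by fun_prop)) hmem)
    ((continuousOn_kern₁ p μ α).comp (f := fun z : ℝ × ℝ => ((0 : ℝ), (z.1, q.2), z.2))
      (Continuous.continuousOn (by fun_prop)) hmem)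
    fun t ht θ => hasDerivAt_kern₁ (q := (t, q.2)) (hsub ht).1
      (mem_kernDomain_of_ne (q := (t, q.2)) hp (hsub ht).1 (hsub ht).2 le_rfl θ).2 μ α).deriv

theorem pd₂_regSol {p q : ℝ × ℝ} (hp : 0 < p.1) {μ : ℂ} (hμ : 1 ≤ μ.re) (α : ℂ) (hq : 0 < q.1)
    (hne : q ≠ p) : pd₂ (regSol p μ α 0) q =
      ∫ θ in Ioo 0 Real.pi, sinPow μ θ * kern₂ p μ α 0 θ q := by
  have hopen : IsOpen {t : ℝ | (q.1, t) ≠ p} := isOpen_ne_fun (by fun_prop) continuous_const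
  obtain ⟨s, hs, hsub, hsc⟩ := local_compact_nhds (hopen.mem_nhds (x := q.2) hne)
  have hmem : ∀ z ∈ s ×ˢ Icc 0 Real.pi, ((0 : ℝ), (q.1, z.1), z.2) ∈ kernDomain p := fun z hz =>
    mem_kernDomain_of_ne (q := (q.1, z.1)) hp hq (hsub hz.1) le_rfl _
  exact (hasDerivAt_integral_sinPow hμ (F := fun t θ => kern p μ α 0 θ (q.1, t))
    (F' := fun t θ => kern₂ p μ α 0 θ (q.1, t)) hs hsc
    ((continuousOn_kern p μ α).comp (f := fun z : ℝ × ℝ => ((0 : ℝ), (q.1, z.1), z.2))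
      (Continuous.continuousOn (by fun_prop)) hmem)
    ((continuousOn_kern₂ p μ α).comp (f := fun z : ℝ × ℝ => ((0 : ℝ), (q.1, z.1), z.2))
      (Continuous.continuousOn (by fun_prop)) hmem)
    fun t ht θ => hasDerivAt_kern₂ (q := (q.1, t))
      (mem_kernDomain_of_ne (q := (q.1, t)) hp hq (hsub ht) le_rfl θ).2 μ α).deriv

theorem setIntegral_add_add {s : Set ℝ} {f g k : ℝ → ℂ} (hf : IntegrableOn f s)
    (hg : IntegrableOn g s) (hk : IntegrableOn k s) :
    ∫ x in s, (f x + g x + k x) = (∫ x in s, f x) + (∫ x in s, g x) + ∫ x in s, k x := by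
  have h : IntegrableOn (fun x => f x + g x) s := hf.add hg
  rw [integral_add h hk, integral_add hf hg]

/-! ### Boundary integrals of the regularized kernels and their limit. -/

namespace PiecewiseC1Boundary

variable {Ω : Set (ℝ × ℝ)} (B : PiecewiseC1Boundary Ω)

/-- The coefficient of `k` in the flux density of `greenField m Ω u k`. -/
noncomputable def coeff₀ (m : ℂ) (u : ℝ × ℝ → ℂ) (i : Fin B.N) (t : ℝ) : ℂ :=
  (extendFrom Ω (pd₁ u) (B.γ i t) + m / ((B.γ i t).1 : ℂ) * u (B.γ i t)) *
      ((dot (B.normalDensity i t) (1, 0) : ℝ) : ℂ) +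
    extendFrom Ω (pd₂ u) (B.γ i t) * ((dot (B.normalDensity i t) (0, 1) : ℝ) : ℂ)

/-- The coefficient of `-∇ k` in the flux density of `greenField m Ω u k`. -/
noncomputable def coeffGrad (u : ℝ × ℝ → ℂ) (v : ℝ × ℝ) (i : Fin B.N) (t : ℝ) : ℂ :=
  -(u (B.γ i t) * ((dot (B.normalDensity i t) v : ℝ) : ℂ))

theorem fluxDensity_greenField (m : ℂ) (u k : ℝ × ℝ → ℂ) (i : Fin B.N) (t : ℝ) :
    B.fluxDensity (greenField m Ω u k) i t =
      B.coeff₀ m u i t * k (B.γ i t) + B.coeffGrad u (1, 0) i t * pd₁ k (B.γ i t) +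
        B.coeffGrad u (0, 1) i t * pd₂ k (B.γ i t) := by
  rw [fluxDensity_eq]
  simp only [greenField, coeff₀, coeffGrad]
  ring

theorem integrableOn_coeff₀ (hΩ : IsOpen Ω) (hsub : closure Ω ⊆ rightHalfPlane) (m : ℂ)
    {u : ℝ × ℝ → ℂ} (hu : IsC2OnClosure Ω u) (i : Fin B.N) :
    IntegrableOn (B.coeff₀ m u i) (Ioc (B.a i) (B.b i)) := by
  have hmx : ContinuousOn (fun q : ℝ × ℝ => m / (q.1 : ℂ)) (closure Ω) :=
    continuousOn_const.div (Continuous.continuousOn (by fun_prop)) fun q hq =>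
      ofReal_fst_ne_zero (hsub hq)
  exact ((B.intervalIntegrable_mul_normalDensity hΩ (B.continuousOn_comp_arc
    (hu.ext₁.continuousOn_extendFrom.add (hmx.mul hu.continuousOn)) i) _).add
    (B.intervalIntegrable_mul_normalDensity hΩ (B.continuousOn_comp_arc
      hu.ext₂.continuousOn_extendFrom i) _)).1

theorem integrableOn_coeffGrad (hΩ : IsOpen Ω) {u : ℝ × ℝ → ℂ} (hu : ContinuousOn u (closure Ω))
    (v : ℝ × ℝ) (i : Fin B.N) : IntegrableOn (B.coeffGrad u v i) (Ioc (B.a i) (B.b i)) :=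
  (B.intervalIntegrable_mul_normalDensity hΩ (B.continuousOn_comp_arc hu i) v).neg.1

/-- The boundary integral in the Green identity for the regularized fundamental solution. -/
noncomputable def boundaryTerm (m : ℂ) (u : ℝ × ℝ → ℂ) (p : ℝ × ℝ) (μ α : ℂ) (h : ℝ) : ℂ :=
  ∑ i, ((∫ t in Ioc (B.a i) (B.b i), B.coeff₀ m u i t *
      ∫ θ in Ioo 0 Real.pi, sinPow μ θ * kern p μ α h θ (B.γ i t)) +
    (∫ t in Ioc (B.a i) (B.b i), B.coeffGrad u (1, 0) i t *
      ∫ θ in Ioo 0 Real.pi, sinPow μ θ * kern₁ p μ α h θ (B.γ i t)) +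
    ∫ t in Ioc (B.a i) (B.b i), B.coeffGrad u (0, 1) i t *
      ∫ θ in Ioo 0 Real.pi, sinPow μ θ * kern₂ p μ α h θ (B.γ i t))

theorem continuousOn_kernDomain_arc {p : ℝ × ℝ} {f : ℝ × (ℝ × ℝ) × ℝ → ℂ}
    (hf : ContinuousOn f (kernDomain p)) (i : Fin B.N) {h : ℝ}
    (hh : ∀ t ∈ Icc (B.a i) (B.b i), ∀ θ, (h, B.γ i t, θ) ∈ kernDomain p) :
    ContinuousOn (fun z : ℝ × ℝ => f (h, B.γ i z.1, z.2))
      (Icc (B.a i) (B.b i) ×ˢ Icc 0 Real.pi) :=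
  hf.comp (f := fun z : ℝ × ℝ => (h, B.γ i z.1, z.2)) (continuousOn_const.prodMk
    (((B.continuousOn_arc i).comp continuousOn_fst fun _ hz => hz.1).prodMk continuousOn_snd))
    fun z hz => hh z.1 hz.1 z.2

/-- Fubini on each arc puts the θ-integral inside, in a form that still makes sense at `h = 0`. -/
theorem integral_sinPow_mul_flux (hΩ : IsOpen Ω) (hsub : closure Ω ⊆ rightHalfPlane) (m : ℂ)
    {u : ℝ × ℝ → ℂ} (hu : IsC2OnClosure Ω u) {p : ℝ × ℝ} (hp : 0 < p.1) {μ : ℂ} (hμ : 1 ≤ μ.re)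
    (α : ℂ) {h : ℝ} (hh : 0 < h) :
    ∫ θ in Ioo 0 Real.pi, sinPow μ θ * B.flux (greenField m Ω u (kern p μ α h θ)) =
      B.boundaryTerm m u p μ α h := by
  have hdom : ∀ i, ∀ t ∈ Icc (B.a i) (B.b i), ∀ θ, (h, B.γ i t, θ) ∈ kernDomain p :=
    fun i t ht θ => mem_kernDomain_of_pos hp (hsub (B.arc_mem_closure ht)) hh θ
  have C0 := fun i => B.continuousOn_kernDomain_arc (continuousOn_kern p μ α) i (hdom i)
  have C1 := fun i => B.continuousOn_kernDomain_arc (continuousOn_kern₁ p μ α) i (hdom i)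
  have C2 := fun i => B.continuousOn_kernDomain_arc (continuousOn_kern₂ p μ α) i (hdom i)
  have I0 := fun i => B.integrableOn_coeff₀ hΩ hsub m hu i
  have I1 := fun i => B.integrableOn_coeffGrad hΩ hu.continuousOn (1, 0) i
  have I2 := fun i => B.integrableOn_coeffGrad hΩ hu.continuousOn (0, 1) i
  have S0 := fun i => integral_sinPow_swap hμ measurableSet_Ioc isCompact_Icc Ioc_subset_Icc_self
    (I0 i) (C0 i)
  have S1 := fun i => integral_sinPow_swap hμ measurableSet_Ioc isCompact_Icc Ioc_subset_Icc_self
    (I1 i) (C1 i)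
  have S2 := fun i => integral_sinPow_swap hμ measurableSet_Ioc isCompact_Icc Ioc_subset_Icc_self
    (I2 i) (C2 i)
  have hI : ∀ {g : ℝ → ℂ} {F : ℝ × ℝ → ℂ} (i : Fin B.N), IntegrableOn g (Ioc (B.a i) (B.b i)) →
      ContinuousOn F (Icc (B.a i) (B.b i) ×ˢ Icc 0 Real.pi) → ∀ θ ∈ Ioo 0 Real.pi,
      IntegrableOn (fun t => g t * (sinPow μ θ * F (t, θ))) (Ioc (B.a i) (B.b i)) := by
    intro g F i hg hF θ hθ
    refine hg.mul_continuousOn_of_subset (continuousOn_const.mul (hF.comp (f := fun t => (t, θ))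
      (Continuous.continuousOn (by fun_prop)) fun t ht => ⟨ht, Ioo_subset_Icc_self hθ⟩))
      measurableSet_Ioc isCompact_Icc Ioc_subset_Icc_self
  have hpt : ∀ θ ∈ Ioo 0 Real.pi,
      sinPow μ θ * B.flux (greenField m Ω u (kern p μ α h θ)) =
      ∑ i, ((∫ t in Ioc (B.a i) (B.b i), B.coeff₀ m u i t *
          (sinPow μ θ * kern p μ α h θ (B.γ i t))) +
        (∫ t in Ioc (B.a i) (B.b i), B.coeffGrad u (1, 0) i t *
          (sinPow μ θ * kern₁ p μ α h θ (B.γ i t))) +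
        ∫ t in Ioc (B.a i) (B.b i), B.coeffGrad u (0, 1) i t *
          (sinPow μ θ * kern₂ p μ α h θ (B.γ i t))) := by
    intro θ hθ
    rw [flux, Finset.mul_sum]
    refine Finset.sum_congr rfl fun i _ => ?_
    refine Eq.trans ?_ (setIntegral_add_add (hI i (I0 i) (C0 i) θ hθ) (hI i (I1 i) (C1 i) θ hθ)
      (hI i (I2 i) (C2 i) θ hθ))
    rw [intervalIntegral.integral_of_le (B.a_lt_b i).le, ← integral_const_mul]
    refine setIntegral_congr_fun measurableSet_Ioc fun t ht => ?_
    have hd := hdom i t (Ioc_subset_Icc_self ht) θ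
    have e1 : pd₁ (kern p μ α h θ) (B.γ i t) = kern₁ p μ α h θ (B.γ i t) :=
      (hasDerivAt_kern₁ hd.1 hd.2 μ α).deriv
    have e2 : pd₂ (kern p μ α h θ) (B.γ i t) = kern₂ p μ α h θ (B.γ i t) :=
      (hasDerivAt_kern₂ hd.2 μ α).deriv
    simp only [fluxDensity_greenField, e1, e2]
    ring
  rw [setIntegral_congr_fun measurableSet_Ioo hpt]
  refine (integral_finsetSum _ fun i _ => ((S0 i).1.add (S1 i).1).add (S2 i).1).trans ?_
  refine Finset.sum_congr rfl fun i _ => ?_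
  refine (setIntegral_add_add (S0 i).1 (S1 i).1 (S2 i).1).trans ?_
  rw [(S0 i).2.2, (S1 i).2.2, (S2 i).2.2]

theorem arc_ne (hΩ : IsOpen Ω) {p : ℝ × ℝ} (hp : p ∈ Ω) (i : Fin B.N) {t : ℝ}
    (ht : t ∈ Icc (B.a i) (B.b i)) : B.γ i t ≠ p := fun h =>
  (hΩ.frontier_eq.subset (B.arc_mem_frontier ht)).2 (h ▸ hp)

/-- The arcs avoid `p`, so along them the kernels are jointly continuous up to `h = 0`. -/
theorem tendsto_boundaryTerm (hΩ : IsOpen Ω) (hsub : closure Ω ⊆ rightHalfPlane) (m : ℂ)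
    {u : ℝ × ℝ → ℂ} (hu : IsC2OnClosure Ω u) {p : ℝ × ℝ} (hp : p ∈ Ω) {μ : ℂ} (hμ : 1 ≤ μ.re)
    (α : ℂ) : Tendsto (B.boundaryTerm m u p μ α) (𝓝[>] 0) (𝓝 (B.boundaryTerm m u p μ α 0)) := by
  have hp0 : 0 < p.1 := hsub (subset_closure hp)
  have hC : ∀ {f : ℝ × (ℝ × ℝ) × ℝ → ℂ}, ContinuousOn f (kernDomain p) → ∀ i : Fin B.N,
      ContinuousOn (fun z : ℝ × ℝ × ℝ => f (z.1, B.γ i z.2.1, z.2.2))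
        (Icc 0 1 ×ˢ Icc (B.a i) (B.b i) ×ˢ Icc 0 Real.pi) := fun hf i =>
    hf.comp (f := fun z : ℝ × ℝ × ℝ => (z.1, B.γ i z.2.1, z.2.2)) (continuousOn_fst.prodMk
      (((B.continuousOn_arc i).comp (f := fun z : ℝ × ℝ × ℝ => z.2.1)
        (Continuous.continuousOn (by fun_prop)) fun _ hz => hz.2.1).prodMk
        (Continuous.continuousOn (by fun_prop))))
      fun z hz => mem_kernDomain_of_ne hp0 (hsub (B.arc_mem_closure hz.2.1))
        (B.arc_ne hΩ hp i hz.2.1) hz.1.1 _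
  refine tendsto_finsetSum _ fun i _ => ((?_ : Tendsto _ _ _).add ?_).add ?_
  · exact tendsto_integral_sinPow hμ measurableSet_Ioc isCompact_Icc Ioc_subset_Icc_self
      (B.integrableOn_coeff₀ hΩ hsub m hu i) (F := fun h t θ => kern p μ α h θ (B.γ i t))
      (hC (continuousOn_kern p μ α) i)
  · exact tendsto_integral_sinPow hμ measurableSet_Ioc isCompact_Icc Ioc_subset_Icc_self
      (B.integrableOn_coeffGrad hΩ hu.continuousOn _ i)
      (F := fun h t θ => kern₁ p μ α h θ (B.γ i t)) (hC (continuousOn_kern₁ p μ α) i)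
  · exact tendsto_integral_sinPow hμ measurableSet_Ioc isCompact_Icc Ioc_subset_Icc_self
      (B.integrableOn_coeffGrad hΩ hu.continuousOn _ i)
      (F := fun h t θ => kern₂ p μ α h θ (B.γ i t)) (hC (continuousOn_kern₂ p μ α) i)

/-- Off `p`, hence on the boundary, the derivatives of `regSol` at `h = 0` may be taken under the
θ-integral. -/
theorem flux_regSol (hΩ : IsOpen Ω) (hsub : closure Ω ⊆ rightHalfPlane) (m : ℂ)
    {u : ℝ × ℝ → ℂ} (hu : IsC2OnClosure Ω u) {p : ℝ × ℝ} (hp : p ∈ Ω) {μ : ℂ} (hμ : 1 ≤ μ.re)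
    (α : ℂ) :
    (∀ i, IntervalIntegrable (B.fluxDensity (greenField m Ω u (regSol p μ α 0)) i) volume
      (B.a i) (B.b i)) ∧
    B.flux (greenField m Ω u (regSol p μ α 0)) = B.boundaryTerm m u p μ α 0 := by
  have hp0 : 0 < p.1 := hsub (subset_closure hp)
  have hdom : ∀ i, ∀ t ∈ Icc (B.a i) (B.b i), ∀ θ, ((0 : ℝ), B.γ i t, θ) ∈ kernDomain p :=
    fun i t ht θ => mem_kernDomain_of_ne hp0 (hsub (B.arc_mem_closure ht))
      (B.arc_ne hΩ hp i ht) le_rfl θ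
  have S0 := fun i => (integral_sinPow_swap hμ measurableSet_Ioc isCompact_Icc
    Ioc_subset_Icc_self (B.integrableOn_coeff₀ hΩ hsub m hu i)
    (B.continuousOn_kernDomain_arc (continuousOn_kern p μ α) i (hdom i))).2.1
  have S1 := fun i => (integral_sinPow_swap hμ measurableSet_Ioc isCompact_Icc
    Ioc_subset_Icc_self (B.integrableOn_coeffGrad hΩ hu.continuousOn (1, 0) i)
    (B.continuousOn_kernDomain_arc (continuousOn_kern₁ p μ α) i (hdom i))).2.1
  have S2 := fun i => (integral_sinPow_swap hμ measurableSet_Ioc isCompact_Icc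
    Ioc_subset_Icc_self (B.integrableOn_coeffGrad hΩ hu.continuousOn (0, 1) i)
    (B.continuousOn_kernDomain_arc (continuousOn_kern₂ p μ α) i (hdom i))).2.1
  have heq : ∀ i, EqOn (fun t => (B.coeff₀ m u i t *
        ∫ θ in Ioo 0 Real.pi, sinPow μ θ * kern p μ α 0 θ (B.γ i t)) +
      (B.coeffGrad u (1, 0) i t *
        ∫ θ in Ioo 0 Real.pi, sinPow μ θ * kern₁ p μ α 0 θ (B.γ i t)) +
      B.coeffGrad u (0, 1) i t *
        ∫ θ in Ioo 0 Real.pi, sinPow μ θ * kern₂ p μ α 0 θ (B.γ i t))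
      (B.fluxDensity (greenField m Ω u (regSol p μ α 0)) i) (Ioc (B.a i) (B.b i)) := by
    intro i t ht
    have ht' := Ioc_subset_Icc_self ht
    have hq : 0 < (B.γ i t).1 := hsub (B.arc_mem_closure ht')
    have hne := B.arc_ne hΩ hp i ht'
    rw [fluxDensity_greenField, pd₁_regSol hp0 hμ α hq hne, pd₂_regSol hp0 hμ α hq hne, regSol]
  refine ⟨fun i => ?_, ?_⟩
  · rw [intervalIntegrable_iff_integrableOn_Ioc_of_le (B.a_lt_b i).le]
    exact (((S0 i).add (S1 i)).add (S2 i)).congr_fun (heq i) measurableSet_Ioc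
  · refine Finset.sum_congr rfl fun i _ => ?_
    rw [intervalIntegral.integral_of_le (B.a_lt_b i).le,
      ← setIntegral_congr_fun measurableSet_Ioc (heq i)]
    exact setIntegral_add_add (S0 i) (S1 i) (S2 i)

end PiecewiseC1Boundary

/-! ### Passage to the limit in Green's identity. -/

variable {Ω : Set (ℝ × ℝ)} {u : ℝ × ℝ → ℂ}

theorem exists_pos_le_fst (hcompact : IsCompact (closure Ω)) (hsub : closure Ω ⊆ rightHalfPlane) :
    ∃ ξ₀ > 0, ∀ q ∈ closure Ω, ξ₀ ≤ q.1 := by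
  rcases (closure Ω).eq_empty_or_nonempty with h | h
  · exact ⟨1, one_pos, fun q hq => absurd hq (h ▸ notMem_empty q)⟩
  · obtain ⟨q₀, hq₀, hmin⟩ := hcompact.exists_isMinOn h continuous_fst.continuousOn
    exact ⟨q₀.1, hsub hq₀, fun q hq => hmin hq⟩

theorem measure_lt_top_of_isCompact_closure (hcompact : IsCompact (closure Ω)) :
    volume Ω < ⊤ := (measure_mono subset_closure).trans_lt hcompact.measure_lt_top

theorem IsC2OnClosure.exists_weinsteinOp_bound (hu : IsC2OnClosure Ω u)
    (hcompact : IsCompact (closure Ω)) (hsub : closure Ω ⊆ rightHalfPlane) (m : ℂ) :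
    ∃ C, ∀ q ∈ Ω, ‖weinsteinOp m u q‖ ≤ C := by
  obtain ⟨g₁, hg₁, e₁⟩ := hu.ext₁
  obtain ⟨g₁₁, hg₁₁, e₁₁⟩ := hu.ext₁₁
  obtain ⟨g₂₂, hg₂₂, e₂₂⟩ := hu.ext₂₂
  have hmx : ContinuousOn (fun q : ℝ × ℝ => m / (q.1 : ℂ)) (closure Ω) :=
    continuousOn_const.div (Continuous.continuousOn (by fun_prop)) fun q hq =>
      ofReal_fst_ne_zero (hsub hq)
  exact ExtendsToClosure.exists_bound ⟨_, (hg₁₁.add hg₂₂).add (hmx.mul hg₁), fun q hq => by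
    simp only [weinsteinOp, e₁ hq, e₁₁ hq, e₂₂ hq, Pi.add_apply, Pi.mul_apply]⟩ hcompact

theorem IsC2OnClosure.continuousOn_weinsteinOp (hu : IsC2OnClosure Ω u)
    (hsub : closure Ω ⊆ rightHalfPlane) (m : ℂ) : ContinuousOn (weinsteinOp m u) Ω := by
  have hc : ∀ {f : ℝ × ℝ → ℂ}, ExtendsToClosure Ω f → ContinuousOn f Ω := by
    rintro f ⟨g, hg, e⟩
    exact (hg.mono subset_closure).congr e.symm
  have hmx : ContinuousOn (fun q : ℝ × ℝ => m / (q.1 : ℂ)) Ω :=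
    continuousOn_const.div (Continuous.continuousOn (by fun_prop)) fun q hq =>
      ofReal_fst_ne_zero (hsub (subset_closure hq))
  exact ((hc hu.ext₁₁).add (hc hu.ext₂₂)).add (hmx.mul (hc hu.ext₁))

theorem IsC2OnClosure.integrableOn_weinsteinOp (hu : IsC2OnClosure Ω u) (hΩ : IsOpen Ω)
    (hcompact : IsCompact (closure Ω)) (hsub : closure Ω ⊆ rightHalfPlane) (m : ℂ) :
    IntegrableOn (weinsteinOp m u) Ω := by
  obtain ⟨C, hC⟩ := hu.exists_weinsteinOp_bound hcompact hsub m
  exact integrableOn_of_forall_norm_le hΩ.measurableSet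
    (measure_lt_top_of_isCompact_closure hcompact)
    ((hu.continuousOn_weinsteinOp hsub m).aestronglyMeasurable hΩ.measurableSet) hC

theorem continuousOn_kernDomain_prod (hsub : closure Ω ⊆ rightHalfPlane) {p : ℝ × ℝ}
    (hp : 0 < p.1) {h : ℝ} (hh : 0 < h) {f : ℝ × (ℝ × ℝ) × ℝ → ℂ}
    (hf : ContinuousOn f (kernDomain p)) :
    ContinuousOn (fun z : (ℝ × ℝ) × ℝ => f (h, z)) (closure Ω ×ˢ Icc 0 Real.pi) :=
  hf.comp (f := fun z : (ℝ × ℝ) × ℝ => (h, z)) (Continuous.continuousOn (by fun_prop))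
    fun z hz => mem_kernDomain_of_pos hp (hsub hz.1) hh z.2

/-- Green's identity for the regularized fundamental solution. -/
theorem green_regSol (hΩ : IsOpen Ω) (hcompact : IsCompact (closure Ω))
    (hsub : closure Ω ⊆ rightHalfPlane) (B : PiecewiseC1Boundary Ω) (hu : IsC2OnClosure Ω u)
    {p : ℝ × ℝ} (hp : 0 < p.1) {m μ α : ℂ} (hμ1 : 1 ≤ μ.re) (hα : (α - 1) * (α - m) = 0)
    (hμ : μ = 2 * α - m) {h : ℝ} (hh : 0 < h) :
    (∫ q in Ω, weinsteinOp m u q * regSol p μ α h q) +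
      μ * (μ + 2) * (∫ q in Ω, u q * (q.1 : ℂ) ^ α * ∫ θ in Ioo 0 Real.pi,
        (h : ℂ) * (sinPow μ θ * basePow p (-μ / 2 - 2) h θ q)) =
      B.boundaryTerm m u p μ α h := by
  have hfst : ∀ s : ℂ, ContinuousOn (fun z : ℝ × (ℝ × ℝ) × ℝ => (z.2.1.1 : ℂ) ^ s)
      (kernDomain p) := fun s => (continuousOn_fst_cpow s).comp
    (f := fun z : ℝ × (ℝ × ℝ) × ℝ => z.2.1) (by fun_prop) fun _ hz => hz.1
  have hbase : ContinuousOn (fun z : ℝ × (ℝ × ℝ) × ℝ => basePow p (-μ / 2 - 2) z.1 z.2.2 z.2.1)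
      (kernDomain p) := (continuousOn_basePow p _).mono fun _ hz => hz.2
  have hK := continuousOn_kernDomain_prod hsub hp hh (continuousOn_kern p μ α)
  -- The explicit formula gives joint continuity in `(q, θ)`, which the definition through `deriv`
  -- does not show.
  have hA : ContinuousOn (fun z : (ℝ × ℝ) × ℝ => weinsteinAdj m (kern p μ α h z.2) z.1)
      (closure Ω ×ˢ Icc 0 Real.pi) := by
    have h1 : Continuous fun z : ℝ × (ℝ × ℝ) × ℝ =>
        μ * (Real.cos z.2.2 : ℂ) * ((kernelBase p z.2.1 z.2.2 + z.1 : ℝ) : ℂ) -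
          (μ + 2) * p.1 * (z.2.1.1 : ℂ) * (Real.sin z.2.2 : ℂ) ^ 2 := by
      unfold kernelBase; fun_prop
    have h2 : Continuous fun z : ℝ × (ℝ × ℝ) × ℝ => μ * (μ + 2) * (z.1 : ℂ) := by fun_prop
    refine (continuousOn_kernDomain_prod hsub hp hh
      (((continuousOn_const (c := μ * p.1)).mul (hfst (α - 1))).mul (hbase.mul h1.continuousOn)
        |>.sub ((h2.continuousOn.mul (hfst α)).mul hbase))).congr fun z hz => ?_
    exact weinsteinAdj_kern hp (hsub hz.1) hh hα hμ z.2
  have hL := hu.integrableOn_weinsteinOp hΩ hcompact hsub m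
  have hui : IntegrableOn u Ω :=
    (hu.continuousOn.integrableOn_compact hcompact).mono_set subset_closure
  have S1 := integral_sinPow_swap hμ1 hΩ.measurableSet hcompact subset_closure hL hK
  have S2 := integral_sinPow_swap hμ1 hΩ.measurableSet hcompact subset_closure hui hA
  have hI : ∀ {g : ℝ × ℝ → ℂ} {F : (ℝ × ℝ) × ℝ → ℂ}, IntegrableOn g Ω →
      ContinuousOn F (closure Ω ×ˢ Icc 0 Real.pi) → ∀ θ ∈ Ioo 0 Real.pi,
      IntegrableOn (fun q => g q * (sinPow μ θ * F (q, θ))) Ω := by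
    intro g F hg hF θ hθ
    refine hg.mul_continuousOn_of_subset (continuousOn_const.mul (hF.comp (f := fun q => (q, θ))
      (Continuous.continuousOn (by fun_prop)) fun t ht => ⟨ht, Ioo_subset_Icc_self hθ⟩))
      hΩ.measurableSet hcompact subset_closure
  rw [← B.integral_sinPow_mul_flux hΩ hsub m hu hp hμ1 α hh]
  have hpt : ∀ θ ∈ Ioo 0 Real.pi,
      sinPow μ θ * B.flux (greenField m Ω u (kern p μ α h θ)) =
      (∫ q in Ω, weinsteinOp m u q * (sinPow μ θ * kern p μ α h θ q)) -
      ∫ q in Ω, u q * (sinPow μ θ * weinsteinAdj m (kern p μ α h θ) q) := by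
    intro θ hθ
    rw [← integral_sub (hI hL hK θ hθ) (hI hui hA θ hθ),
      ← B.green hΩ hcompact hsub m hu (contDiffOn_kern hp hh μ α θ), ← integral_const_mul]
    refine integral_congr_ae (ae_of_all _ fun q => ?_)
    ring
  rw [setIntegral_congr_fun measurableSet_Ioo hpt, integral_sub S1.1 S2.1, S1.2.2, S2.2.2]
  refine (congrArg₂ (· + ·) rfl ?_).trans (sub_eq_add_neg _ _).symm
  rw [← integral_neg, ← integral_const_mul]
  refine setIntegral_congr_fun hΩ.measurableSet fun q hq => ?_
  simp only
  rw [integral_sinPow_mul_weinsteinAdj hp (hsub (subset_closure hq)) hh hμ1 hα hμ]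
  ring

/-- Off the null lines ξ = x and η = y, the integrand is dominated, uniformly in `h ≥ 0`, by a
multiple of the function in `integrableOn_singular`. -/
theorem tendsto_integral_mul_regSol (hΩ : IsOpen Ω) (hcompact : IsCompact (closure Ω))
    (hsub : closure Ω ⊆ rightHalfPlane) {g : ℝ × ℝ → ℂ} (hg : ContinuousOn g Ω) {M : ℝ}
    (hM : ∀ q ∈ Ω, ‖g q‖ ≤ M) {p : ℝ × ℝ} (hp : 0 < p.1) {μ : ℂ} (hμ : 1 ≤ μ.re) (α : ℂ) :
    IntegrableOn (fun q => g q * regSol p μ α 0 q) Ω ∧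
    Tendsto (fun h => ∫ q in Ω, g q * regSol p μ α h q) (𝓝[>] 0)
      (𝓝 (∫ q in Ω, g q * regSol p μ α 0 q)) := by
  obtain ⟨ξ₀, hξ₀, hle⟩ := exists_pos_le_fst hcompact hsub
  obtain ⟨C, hC⟩ := hcompact.exists_bound_of_continuousOn
    ((continuousOn_fst_cpow α).mono hsub)
  have hgi : IntegrableOn g Ω := integrableOn_of_forall_norm_le hΩ.measurableSet
    (measure_lt_top_of_isCompact_closure hcompact) (hg.aestronglyMeasurable hΩ.measurableSet) hM
  set κ := min 1 (p.1 * ξ₀) with hκ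
  have hκ0 : 0 < κ := by rw [hκ]; positivity
  set A := κ⁻¹ ^ ((μ.re - 1) / 2) * κ ^ (-0 - 1 / 2 : ℝ)
  have hA0 : 0 ≤ A := by positivity
  set w : ℝ × ℝ → ℝ := fun q => (2 * |p.1 - q.1| * |p.2 - q.2|) ^ (-0 - 1 / 2 : ℝ)
  have hw0 : ∀ q, 0 ≤ w q := fun q => by positivity
  have hae : ∀ᵐ q ∂(volume.restrict Ω), q ∈ Ω ∧ q.1 ≠ p.1 ∧ q.2 ≠ p.2 := by
    have h1 : ∀ᵐ q : ℝ × ℝ, q.1 ≠ p.1 :=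
      Measure.quasiMeasurePreserving_fst.ae (Measure.ae_ne volume p.1)
    have h2 : ∀ᵐ q : ℝ × ℝ, q.2 ≠ p.2 :=
      Measure.quasiMeasurePreserving_snd.ae (Measure.ae_ne volume p.2)
    filter_upwards [ae_restrict_mem hΩ.measurableSet, ae_restrict_of_ae h1, ae_restrict_of_ae h2]
      with q a b c using ⟨a, b, c⟩
  have hbound : ∀ h, 0 ≤ h → ∀ᵐ q ∂(volume.restrict Ω),
      ‖g q * regSol p μ α h q‖ ≤ M * (C * A * Real.pi) * w q := by
    intro h hh
    filter_upwards [hae] with q ⟨hq, hq1, hq2⟩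
    have hM0 : 0 ≤ M := (norm_nonneg _).trans (hM q hq)
    have h1 : ‖regSol p μ α h q‖ ≤ C * (A * w q) * volume.real (Ioo 0 Real.pi) := by
      refine norm_setIntegral_le_of_norm_le_const (by simp) fun θ hθ => ?_
      refine (norm_sinPow_mul_kern_le hp hμ hξ₀ hκ (hle q (subset_closure hq)) hq1 hq2 hh
        hθ).trans ?_
      exact mul_le_mul_of_nonneg_right (hC q (subset_closure hq)) (mul_nonneg hA0 (hw0 q))
    rw [Real.volume_real_Ioo_of_le Real.pi_pos.le, sub_zero] at h1
    rw [norm_mul]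
    calc _ ≤ M * (C * (A * w q) * Real.pi) :=
          mul_le_mul (hM q hq) h1 (norm_nonneg _) hM0
      _ = _ := by ring
  have hdom : Integrable (fun q => M * (C * A * Real.pi) * w q) (volume.restrict Ω) :=
    (integrableOn_singular hcompact p).const_mul _
  have hpos : ∀ᶠ h in 𝓝[>] (0 : ℝ), 0 < h := self_mem_nhdsWithin
  have hmeas : ∀ h, 0 < h →
      AEStronglyMeasurable (fun q => g q * regSol p μ α h q) (volume.restrict Ω) := fun h hh =>
    (integral_sinPow_swap hμ hΩ.measurableSet hcompact subset_closure hgi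
      (continuousOn_kernDomain_prod hsub hp hh (continuousOn_kern p μ α))).2.1.aestronglyMeasurable
  have hlim : ∀ᵐ q ∂(volume.restrict Ω), Tendsto (fun h => g q * regSol p μ α h q) (𝓝[>] 0)
      (𝓝 (g q * regSol p μ α 0 q)) := by
    filter_upwards [hae] with q ⟨hq, hq1, _⟩
    exact (tendsto_regSol hp hμ (hsub (subset_closure hq)) fun e => hq1 (e ▸ rfl)).const_mul _
  refine ⟨?_, tendsto_integral_filter_of_dominated_convergence _ (hpos.mono hmeas)
    (hpos.mono fun h hh => hbound h hh.le) hdom hlim⟩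
  -- At `h = 0` the kernel is singular at `p` and Fubini with a continuous kernel is not available;
  -- measurability is inherited from the sequence `h = 1 / (n + 1)`.
  have hseq : Tendsto (fun n : ℕ => 1 / ((n : ℝ) + 1)) atTop (𝓝[>] 0) :=
    tendsto_nhdsWithin_iff.2 ⟨tendsto_one_div_add_atTop_nhds_zero_nat,
      .of_forall fun n => by simp only [mem_Ioi]; positivity⟩
  have hm := aestronglyMeasurable_of_tendsto_ae atTop
    (fun n : ℕ => hmeas (1 / ((n : ℝ) + 1)) (by positivity))
    (hlim.mono fun q hq => hq.comp hseq)
  exact hdom.mono' hm (hbound 0 le_rfl)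

/-- The approximate identity is applied to the extension of `g` by zero, which is still continuous
at the interior point `p`. -/
theorem tendsto_integral_mul_delta (hΩ : IsOpen Ω) (hcompact : IsCompact (closure Ω))
    (hsub : closure Ω ⊆ rightHalfPlane) {g : ℝ × ℝ → ℂ} (hg : ContinuousOn g (closure Ω))
    {p : ℝ × ℝ} (hp : p ∈ Ω) {μ : ℂ} (hμ : 1 ≤ μ.re) :
    Tendsto (fun ε : ℝ => ∫ q in Ω, g q * ∫ θ in Ioo 0 Real.pi, ((ε ^ 2 : ℝ) : ℂ) *
        (sinPow μ θ * basePow p (-μ / 2 - 2) (ε ^ 2) θ q)) (𝓝[>] 0)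
      (𝓝 (g p * (2 * Real.pi * (p.1 : ℂ) ^ (-μ) / (μ * (μ + 2))))) := by
  obtain ⟨ξ₀, hξ₀, hle⟩ := exists_pos_le_fst hcompact hsub
  obtain ⟨M, hM⟩ := hcompact.exists_bound_of_continuousOn hg
  have hg' := hg.mono subset_closure
  have hU : Measurable (Ω.indicator g) := by
    classical
    rw [← piecewise_eq_indicator]
    exact hg'.measurable_piecewise continuousOn_const hΩ.measurableSet
  have hUp : Ω.indicator g =ᶠ[𝓝 p] g := by
    filter_upwards [hΩ.mem_nhds hp] with q hq using indicator_of_mem hq g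
  have key := tendsto_integral_deltaKernel (U := Ω.indicator g) (M := max M 0)
    (hsub (subset_closure hp)) hμ hξ₀ hU (fun q => ?_) (fun q hq => ?_)
    (((hg' p hp).continuousAt (hΩ.mem_nhds hp)).congr hUp.symm)
  · rw [indicator_of_mem hp] at key
    refine key.congr fun ε => ?_
    rw [← integral_indicator hΩ.measurableSet]
    refine integral_congr_ae (ae_of_all _ fun q => ?_)
    by_cases hq : q ∈ Ω <;> simp [hq]
  · by_cases hq : q ∈ Ω
    · rw [indicator_of_mem hq]
      exact (hM q (subset_closure hq)).trans (le_max_left _ _)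
    · simp [hq]
  · exact indicator_of_notMem (fun h => hq.not_ge (hle q (subset_closure h))) g

/-- The representation formula for the unnormalized fundamental solution. -/
theorem representation_regSol (hΩ : IsOpen Ω) (hcompact : IsCompact (closure Ω))
    (hsub : closure Ω ⊆ rightHalfPlane) (B : PiecewiseC1Boundary Ω) (hu : IsC2OnClosure Ω u)
    {p : ℝ × ℝ} (hp : p ∈ Ω) {m μ α : ℂ} (hμ1 : 1 ≤ μ.re) (hα : (α - 1) * (α - m) = 0)
    (hμ : μ = 2 * α - m) :
    (∫ q in Ω, weinsteinOp m u q * regSol p μ α 0 q) +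
      2 * Real.pi * (p.1 : ℂ) ^ (α - μ) * u p = B.flux (greenField m Ω u (regSol p μ α 0)) := by
  have hpW : p ∈ rightHalfPlane := hsub (subset_closure hp)
  obtain ⟨M, hM⟩ := hu.exists_weinsteinOp_bound hcompact hsub m
  -- All limits are taken along `h = ε²`, the parametrization of the approximate identity.
  have hsq : Tendsto (fun ε : ℝ => ε ^ 2) (𝓝[>] 0) (𝓝[>] 0) := by
    refine tendsto_nhdsWithin_iff.2 ⟨?_, ?_⟩
    · exact (Continuous.tendsto' (by fun_prop) _ _ (by simp)).mono_left nhdsWithin_le_nhds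
    · filter_upwards [self_mem_nhdsWithin] with ε hε
      exact pow_pos (mem_Ioi.1 hε) 2
  have T1 := (tendsto_integral_mul_regSol hΩ hcompact hsub
    (hu.continuousOn_weinsteinOp hsub m) hM hpW hμ1 α).2.comp hsq
  have T2 := tendsto_integral_mul_delta hΩ hcompact hsub (g := fun q => u q * (q.1 : ℂ) ^ α)
    (hu.continuousOn.mul ((continuousOn_fst_cpow α).mono hsub)) hp hμ1
  have T3 := (B.tendsto_boundaryTerm hΩ hsub m hu hp hμ1 α).comp hsq
  have T4 := T1.add (T2.const_mul (μ * (μ + 2)))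
  have heq := tendsto_nhds_unique (T4.congr' ?_) T3
  · rw [(B.flux_regSol hΩ hsub m hu hp hμ1 α).2, ← heq]
    have hx := ofReal_fst_ne_zero hpW
    have hμ0 : μ ≠ 0 := by rintro rfl; simp at hμ1; linarith
    have hμ2 : μ + 2 ≠ 0 := by
      intro h
      have := congrArg Complex.re h
      simp at this
      linarith
    rw [sub_eq_add_neg, Complex.cpow_add _ _ hx]
    field_simp
  · filter_upwards [self_mem_nhdsWithin] with ε hε
    exact green_regSol hΩ hcompact hsub B hu hpW hμ1 hα hμ (pow_pos hε 2)

/-! ### Normalization and the representation formula. -/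

theorem setIntegral_div_eq_regSol {p q : ℝ × ℝ} (μ α : ℂ) :
    (q.1 : ℂ) ^ α * ∫ θ in (0 : ℝ)..Real.pi,
      (Real.sin θ : ℂ) ^ (μ - 1) / (kernelBase p q θ : ℂ) ^ (μ / 2) = regSol p μ α 0 q := by
  rw [intervalIntegral.integral_of_le Real.pi_pos.le, integral_Ioc_eq_integral_Ioo,
    ← integral_const_mul, regSol]
  refine integral_congr_ae (ae_of_all _ fun θ => ?_)
  simp only [sinPow, kern, basePow, add_zero, neg_div, Complex.cpow_neg]
  ring

/-- The fundamental solution is a multiple of the unnormalized one. -/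
theorem exists_fundSol_eq (m : ℂ) {p : ℝ × ℝ} (hp : p ∈ rightHalfPlane) :
    ∃ μ α c : ℂ, 1 ≤ μ.re ∧ (α - 1) * (α - m) = 0 ∧ μ = 2 * α - m ∧
      2 * Real.pi * (p.1 : ℂ) ^ (α - μ) * c = -1 ∧
      fundSol m p = fun q => c * regSol p μ α 0 q := by
  have hpi : (Real.pi : ℂ) ≠ 0 := Complex.ofReal_ne_zero.2 Real.pi_ne_zero
  have hx := ofReal_fst_ne_zero hp
  by_cases hm : 1 ≤ m.re
  -- Here `α = μ = m`, so the power x^(α-μ) in the normalization is 1.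
  · refine ⟨m, m, -(1 / (2 * Real.pi)), hm, by ring, by ring, ?_, funext fun q => ?_⟩
    · rw [sub_self, Complex.cpow_zero]
      field_simp
    · rw [fundSol, if_pos hm, ← setIntegral_div_eq_regSol]
      ring
  -- Here Re μ = 2 - Re m > 1, the exponents 1 - m and 1 - m/2 are μ - 1 and μ/2, and the factor
  -- x^(1-m) of the constant cancels x^(α-μ).
  · refine ⟨2 - m, 1, -((p.1 : ℂ) ^ (1 - m) / (2 * Real.pi)), ?_, by ring, by ring, ?_,
      funext fun q => ?_⟩
    · simp only [Complex.sub_re, Complex.re_ofNat]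
      linarith
    · rw [show (1 : ℂ) - (2 - m) = -(1 - m) by ring, Complex.cpow_neg]
      have : (p.1 : ℂ) ^ (1 - m) ≠ 0 := by simp [Complex.cpow_eq_zero_iff, hx]
      field_simp
    · rw [fundSol, if_neg hm, ← setIntegral_div_eq_regSol, Complex.cpow_one,
        show 2 - m - 1 = 1 - m by ring, show (2 - m) / 2 = 1 - m / 2 by ring]
      ring

theorem fluxDensity_greenField_const_mul (B : PiecewiseC1Boundary Ω) (m c : ℂ)
    (u k : ℝ × ℝ → ℂ) (i : Fin B.N) : B.fluxDensity (greenField m Ω u fun q => c * k q) i =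
      fun t => c * B.fluxDensity (greenField m Ω u k) i t := by
  funext t
  simp only [B.fluxDensity_greenField, pd₁, pd₂, deriv_const_mul_field]
  ring

end Weinstein

theorem mainTheorem8 (m : ℂ) (Ω : Set (ℝ × ℝ)) (hΩ : IsOpen Ω)
    (hcompact : IsCompact (closure Ω)) (hsub : closure Ω ⊆ Weinstein.rightHalfPlane)
    (B : Weinstein.PiecewiseC1Boundary Ω)
    (u : ℝ × ℝ → ℂ) (hu : Weinstein.IsC2OnClosure Ω u)
    (p : ℝ × ℝ) (hp : p ∈ Ω) :
    IntegrableOn (fun q => Weinstein.weinsteinOp m u q * Weinstein.fundSol m p q) Ω ∧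
    (∀ i, IntervalIntegrable
      (B.fluxDensity (Weinstein.greenField m Ω u (Weinstein.fundSol m p)) i)
      volume (B.a i) (B.b i)) ∧
    u p = (∫ q in Ω, Weinstein.weinsteinOp m u q * Weinstein.fundSol m p q) -
      B.flux (Weinstein.greenField m Ω u (Weinstein.fundSol m p)) := by
  have hpW : p ∈ Weinstein.rightHalfPlane := hsub (subset_closure hp)
  obtain ⟨μ, α, c, hμ1, hα, hμ, hc, hE⟩ := Weinstein.exists_fundSol_eq m hpW
  obtain ⟨M, hM⟩ := hu.exists_weinsteinOp_bound hcompact hsub m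
  have hint := (Weinstein.tendsto_integral_mul_regSol hΩ hcompact hsub
    (hu.continuousOn_weinsteinOp hsub m) hM hpW hμ1 α).1
  have hflux := (B.flux_regSol hΩ hsub m hu hp hμ1 α).1
  have hrep := Weinstein.representation_regSol hΩ hcompact hsub B hu hp hμ1 hα hμ
  rw [hE]
  simp only [mul_left_comm _ c]
  refine ⟨hint.const_mul c, fun i => ?_, ?_⟩
  · rw [Weinstein.fluxDensity_greenField_const_mul]
    exact (hflux i).const_mul c
  · rw [integral_const_mul]
    have hf : B.flux (Weinstein.greenField m Ω u fun q => c * Weinstein.regSol p μ α 0 q) =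
        c * B.flux (Weinstein.greenField m Ω u (Weinstein.regSol p μ α 0)) := by
      simp only [Weinstein.PiecewiseC1Boundary.flux, Weinstein.fluxDensity_greenField_const_mul,
        intervalIntegral.integral_const_mul, Finset.mul_sum]
    rw [hf, ← hrep]
    -- The constant is normalized so that the coefficient of `u p` is -1.
    linear_combination u p * hc
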